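/- Let $X$ be a non-empty compact complex manifold of dimension $n$, $L\to X$ a holomorphic line bundle, and $E\subseteq H^0(X;L)$ a linear subspace of finite dimension $d$ which gives a projective embedding of $X$. Let $\mathcal K$ be the set of smooth Hermitian metrics $h$ on $L$ for which $\omega_h$ is a positive $(1,1)$-form, where $-i\omega_h$ is the curvature of the Chern connection of $(L,h)$; put $d\mu_h=\omega_h^n/n!$ and $V=\int_X d\mu_h$. Let $M$ be the set of Hermitian metrics (positive definite Hermitian forms) on $E$. For $h\in\mathcal K$ let $\mathrm{Hilb}(h)$ be the form $$\|s\|^2_{\mathrm{Hilb}(h)}=\frac dV\int_X|s|_h^2\,d\mu_h$$ on $E$. For $H\in M$ let $FS(H)$ be the Hermitian metric on $L$ with $\sum_\alpha|s_\alpha|^2_{FS(H)}=1$ on $X$, where $(s_\alpha)$ is any $H$-orthonormal basis of $E$. Fix a basis of $E$ and let $\log\det$ of a Hermitian form on $E$ be the logarithm of the determinant of its matrix in that basis. Call $I:\mathcal K\to\mathbf R$ an energy functional if $$\frac{d}{dt}I(h_t)=\int_X\dot\phi_t\,d\mu_{h_t}$$ for every $h_0\in\mathcal K$ and every smooth path $h_t=e^{\phi_t}h_0$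 in $\mathcal K$. Then these notions are well defined: $FS(H)\in\mathcal K$ for all $H\in M$ and $\mathrm{Hilb}(h)\in M$ for all $h\in\mathcal K$; $V$ is positive and is the same for all $h\in\mathcal K$; and an energy functional exists. For every energy functional $I$, put $$\tilde{\mathcal L}(h)=\log\det \mathrm{Hilb}(h)-\frac dV I(h)\quad(h\in\mathcal K),\qquad \tilde Z(H)=-I(FS(H))+\frac Vd\log\det H\quad(H\in M).$$ Then, whether or not there is a balanced point (a pair $(h^*,H^*)$ with $\mathrm{Hilb}(h^*)=H^*$ and $FS(H^*)=h^*$), $\tilde{\mathcal L}$ is bounded below on $\mathcal K$ if and only if $\tilde Z$ is bounded below on $M$. -/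

import Mathlib

open scoped Manifold ContDiff Bundle ComplexConjugate ComplexOrder

noncomputable section

namespace BalancedMetrics

open MeasureTheory

section Wirtinger

variable {n : ℕ}

/-- The Wirtinger derivative `∂u/∂z_j = (∂u/∂x_j - i ∂u/∂y_j) / 2` of a function on `ℂⁿ`. -/
def wirtinger (j : Fin n) (u : (Fin n → ℂ) → ℂ) (z : Fin n → ℂ) : ℂ :=
  (fderiv ℝ u z (Pi.single j 1) - Complex.I * fderiv ℝ u z (Pi.single j Complex.I)) / 2

/-- The Wirtinger derivative `∂u/∂z̄_j = (∂u/∂x_j + i ∂u/∂y_j) / 2` of a function on `ℂⁿ`. -/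
def wirtingerBar (j : Fin n) (u : (Fin n → ℂ) → ℂ) (z : Fin n → ℂ) : ℂ :=
  (fderiv ℝ u z (Pi.single j 1) + Complex.I * fderiv ℝ u z (Pi.single j Complex.I)) / 2

/-- The complex Hessian `(∂²u / ∂z_j ∂z̄_k)_{jk}`. -/
def complexHessian (u : (Fin n → ℂ) → ℂ) (z : Fin n → ℂ) : Matrix (Fin n) (Fin n) ℂ :=
  Matrix.of fun j k => wirtinger j (fun w => wirtingerBar k u w) z

end Wirtinger

section LineBundle

variable {n : ℕ} {X : Type*} [TopologicalSpace X] [ChartedSpace (Fin n → ℂ) X]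
  {L : X → Type*} [∀ x, AddCommGroup (L x)] [∀ x, Module ℂ (L x)]
  [∀ x, TopologicalSpace (L x)] [TopologicalSpace (Bundle.TotalSpace ℂ L)]
  [FiberBundle ℂ L]

/-- The component at `x` of a vector of `L_x` in the trivialization of `L` centred at `p`. -/
def coord (p x : X) (v : L x) : ℂ := (trivializationAt ℂ L p ⟨x, v⟩).2

/-- The local frame of the line bundle `L` given by the trivialization centred at `p`
(holomorphic and nowhere zero on the base set of that trivialization). -/
def frame (p x : X) : L x := (trivializationAt ℂ L p).symm x 1

/-- An open neighbourhood of `p` that carries both holomorphic coordinates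
(the chart at `p`) and the frame `frame p`. -/
def patch (n : ℕ) {X : Type*} [TopologicalSpace X] [ChartedSpace (Fin n → ℂ) X]
    (L : X → Type*) [∀ x, TopologicalSpace (L x)] [TopologicalSpace (Bundle.TotalSpace ℂ L)]
    [∀ x, AddCommGroup (L x)] [FiberBundle ℂ L] (p : X) : Set X :=
  (chartAt (Fin n → ℂ) p).source ∩ (trivializationAt ℂ L p).baseSet

/-- `h` is a smooth Hermitian metric on the line bundle `L`; the value `h x u v` is the inner
product of `u, v ∈ L_x`, conjugate-linear in `u` and linear in `v`, so `|v|²_h = h x v v`. -/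
structure IsHermitianMetric (n : ℕ) {X : Type*} [TopologicalSpace X]
    [ChartedSpace (Fin n → ℂ) X] {L : X → Type*} [∀ x, AddCommGroup (L x)]
    [∀ x, Module ℂ (L x)] [∀ x, TopologicalSpace (L x)]
    [TopologicalSpace (Bundle.TotalSpace ℂ L)] [FiberBundle ℂ L]
    (h : ∀ x, L x → L x → ℂ) : Prop where
  add_right : ∀ x u v w, h x u (v + w) = h x u v + h x u w
  smul_right : ∀ x (c : ℂ) u v, h x u (c • v) = c * h x u v
  conj_symm : ∀ x u v, conj (h x u v) = h x v u
  pos : ∀ x v, v ≠ 0 → 0 < (h x v v).re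
  smooth : ∀ p : X, ContMDiffOn 𝓘(ℝ, Fin n → ℂ) 𝓘(ℝ, ℝ) ∞
    (fun x => (h x (frame p x) (frame p x)).re) (trivializationAt ℂ L p).baseSet

/-- The function `log |e|²_h` in the coordinates centred at `p`, where `e` is the holomorphic frame
`frame p` of `L`. -/
def logNormSq (h : ∀ x, L x → L x → ℂ) (p : X) (z : Fin n → ℂ) : ℂ :=
  ((Real.log (h ((chartAt (Fin n → ℂ) p).symm z)
    (frame p ((chartAt (Fin n → ℂ) p).symm z))
    (frame p ((chartAt (Fin n → ℂ) p).symm z))).re : ℝ) : ℂ)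

/-- The matrix `g` of the form `ω_h = i ∂̄∂ log |e|²_h = i ∑ g_{jk} dz_j ∧ dz̄_k` in the
coordinates centred at `p`, that is `g_{jk} = - ∂² log |e|²_h / ∂z_j ∂z̄_k`. Here `-i ω_h` is the
curvature `∂̄∂ log |e|²_h` of the Chern connection of `(L, h)`. -/
def kahlerMatrix (h : ∀ x, L x → L x → ℂ) (p : X) (z : Fin n → ℂ) :
    Matrix (Fin n) (Fin n) ℂ :=
  - complexHessian (logNormSq h p) z

/-- The space `𝒦` of smooth Hermitian metrics `h` on `L` whose form `ω_h` is positive. -/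
def posMetrics (n : ℕ) {X : Type*} [TopologicalSpace X]
    [ChartedSpace (Fin n → ℂ) X] (L : X → Type*) [∀ x, AddCommGroup (L x)]
    [∀ x, Module ℂ (L x)] [∀ x, TopologicalSpace (L x)]
    [TopologicalSpace (Bundle.TotalSpace ℂ L)] [FiberBundle ℂ L] :
    Set (∀ x, L x → L x → ℂ) :=
  {h | IsHermitianMetric n h ∧
    ∀ p : X, ∀ x ∈ patch n L p, (kahlerMatrix h p (chartAt (Fin n → ℂ) p x)).PosDef}

/-- The volume form `ω_hⁿ / n!` on the patch of `p`, as a measure. In coordinates,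
`ω_hⁿ / n! = det g ∏ (i dz_j ∧ dz̄_j) = 2ⁿ det g ∏ (dx_j ∧ dy_j)`. -/
def patchVolume [MeasurableSpace X] (h : ∀ x, L x → L x → ℂ) (p : X) : Measure X :=
  (((volume : Measure (Fin n → ℂ)).restrict (chartAt (Fin n → ℂ) p '' patch n L p)).withDensity
    fun z => ENNReal.ofReal (2 ^ n * (kahlerMatrix h p z).det.re)).map
      (chartAt (Fin n → ℂ) p).symm

/-- The volume measure `dμ_h = ω_hⁿ / n!` on `X`: the least measure that dominates
`ω_hⁿ / n!` on all patches. (As these agree on overlaps, this is the measure on `X` whose restriction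
to each patch is the given one.) -/
def volumeMeasure (n : ℕ) {X : Type*} [TopologicalSpace X]
    [ChartedSpace (Fin n → ℂ) X] {L : X → Type*} [∀ x, AddCommGroup (L x)]
    [∀ x, Module ℂ (L x)] [∀ x, TopologicalSpace (L x)]
    [TopologicalSpace (Bundle.TotalSpace ℂ L)] [FiberBundle ℂ L]
    [MeasurableSpace X] (h : ∀ x, L x → L x → ℂ) : Measure X :=
  ⨆ p : X, patchVolume (n := n) h p

/-- The volume `V` of `X`, computed with `dμ_h` (the same for all `h ∈ 𝒦`). -/
def vol (n : ℕ) {X : Type*} [TopologicalSpace X]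
    [ChartedSpace (Fin n → ℂ) X] {L : X → Type*} [∀ x, AddCommGroup (L x)]
    [∀ x, Module ℂ (L x)] [∀ x, TopologicalSpace (L x)]
    [TopologicalSpace (Bundle.TotalSpace ℂ L)] [FiberBundle ℂ L]
    [MeasurableSpace X] (h : ∀ x, L x → L x → ℂ) : ℝ :=
  (volumeMeasure n h).real Set.univ

/-- The metric `e^φ h`. -/
def rescale (φ : X → ℝ) (h : ∀ x, L x → L x → ℂ) : ∀ x, L x → L x → ℂ :=
  fun x u v => (Real.exp (φ x) : ℂ) * h x u v

/-- `I` is a functional on `𝒦` with `dI/dt = ∫ φ̇ dμ_{h_t}` along every smooth path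
`h_t = e^{φ_t} h₀`, `a < t < b`, in `𝒦`. (Only the values of `I` on `𝒦` are constrained.) -/
def IsEnergy (n : ℕ) {X : Type*} [TopologicalSpace X]
    [ChartedSpace (Fin n → ℂ) X] {L : X → Type*} [∀ x, AddCommGroup (L x)]
    [∀ x, Module ℂ (L x)] [∀ x, TopologicalSpace (L x)]
    [TopologicalSpace (Bundle.TotalSpace ℂ L)] [FiberBundle ℂ L]
    [MeasurableSpace X] (I : (∀ x, L x → L x → ℂ) → ℝ) : Prop :=
  ∀ h₀ ∈ posMetrics n L, ∀ (a b : ℝ) (φ : ℝ → X → ℝ),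
    ContMDiffOn (𝓘(ℝ, ℝ).prod 𝓘(ℝ, Fin n → ℂ)) 𝓘(ℝ, ℝ) ∞
      (fun q : ℝ × X => φ q.1 q.2) (Set.Ioo a b ×ˢ Set.univ) →
    (∀ t ∈ Set.Ioo a b, rescale (φ t) h₀ ∈ posMetrics n L) →
    ∀ t ∈ Set.Ioo a b,
      HasDerivAt (fun s => I (rescale (φ s) h₀))
        (∫ x, deriv (fun s => φ s x) t ∂(volumeMeasure n (rescale (φ t) h₀))) t

end LineBundle

section LinearSystem

variable {n : ℕ} {X : Type*} [TopologicalSpace X] [ChartedSpace (Fin n → ℂ) X]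
  {L : X → Type*} [∀ x, AddCommGroup (L x)] [∀ x, Module ℂ (L x)]
  [∀ x, TopologicalSpace (L x)] [TopologicalSpace (Bundle.TotalSpace ℂ L)]
  [FiberBundle ℂ L] [VectorBundle ℂ ℂ L]

/-- A linear system `E ⊆ H⁰(X; L)` gives a projective embedding of `X`: no point of `X` is a common
zero of `E`; the map `x ↦ {s ∈ E | s(x) = 0}` from `X` to the hyperplanes of `E`, i.e. to `ℙ(E*)`, is
injective; and its differential is injective, i.e. for each tangent vector `v ≠ 0` at `x` some
`s ∈ E` has `s(x) = 0` and derivative `ds_x(v) ≠ 0` (which, as `s(x) = 0`, can be computed in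
any local trivialization of `L`). -/
structure GivesEmbedding (E : Submodule ℂ Cₛ^ω⟮𝓘(ℂ, Fin n → ℂ); ℂ, L⟯) : Prop where
  basePointFree : ∀ x, ∃ s ∈ E, s x ≠ 0
  injective : Function.Injective fun x : X => {s : E | s.1 x = 0}
  immersive : ∀ (x : X) (v : TangentSpace 𝓘(ℂ, Fin n → ℂ) x), v ≠ 0 →
    ∃ s ∈ E, s x = 0 ∧
      mfderiv 𝓘(ℂ, Fin n → ℂ) 𝓘(ℂ, ℂ) (fun y => coord x y (s y)) x v ≠ 0

/-- The logarithm of the determinant of a Hermitian form on `E`, i.e. of the determinant of its matrix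
in the basis `b`. -/
def logDet {E : Type*} [AddCommGroup E] [Module ℂ E]
    (b : Module.Basis (Fin (Module.finrank ℂ E)) ℂ E) (B : E → E → ℂ) : ℝ :=
  Real.log (Matrix.of fun i j => B (b i) (b j)).det.re

/-- The space `M` of Hermitian metrics on `E`: positive definite Hermitian forms
(conjugate-linear in the first variable). -/
abbrev HermitianForms (E : Type*) [AddCommGroup E] [Module ℂ E] : Type _ :=
  InnerProductSpace.Core ℂ E

theorem exists_orthonormal {E : Type*} [AddCommGroup E] [Module ℂ E] [FiniteDimensional ℂ E]
    (H : HermitianForms E) : ∃ s : Module.Basis (Fin (Module.finrank ℂ E)) ℂ E,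
      ∀ i j, H.inner (s i) (s j) = if i = j then 1 else 0 := by
  let _ : NormedAddCommGroup E := H.toNormedAddCommGroup
  let _ : InnerProductSpace ℂ E := InnerProductSpace.ofCore H.toCore
  refine ⟨(stdOrthonormalBasis ℂ E).toBasis, fun i j => ?_⟩
  have h := orthonormal_iff_ite.mp (stdOrthonormalBasis ℂ E).orthonormal i j
  simpa using h

/-- An `H`-orthonormal basis of `E`. -/
def orthonormalBasis {E : Type*} [AddCommGroup E] [Module ℂ E] [FiniteDimensional ℂ E]
    (H : HermitianForms E) : Module.Basis (Fin (Module.finrank ℂ E)) ℂ E :=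
  (exists_orthonormal H).choose

variable (E : Submodule ℂ Cₛ^ω⟮𝓘(ℂ, Fin n → ℂ); ℂ, L⟯)

/-- `Hilb(h)`: the Hermitian form `⟨s, t⟩ = (d / V) ∫ (s, t)_h dμ_h` on `E`, where `d = dim E`. -/
def hilb [MeasurableSpace X] (h : ∀ x, L x → L x → ℂ) (s t : E) : ℂ :=
  ((Module.finrank ℂ E : ℝ) / vol n h : ℝ) * ∫ x, h x (s.1 x) (t.1 x) ∂(volumeMeasure n h)

/-- `FS(H)`: the Hermitian metric on `L` with `∑_α |s_α|² = 1` at each point of `X`, for an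
`H`-orthonormal basis `(s_α)` of `E` (any such basis gives the same metric). -/
def fubiniStudy [FiniteDimensional ℂ E] (H : HermitianForms E) : ∀ x, L x → L x → ℂ :=
  fun x u v => conj (coord x x u) * coord x x v /
    ((∑ α, ‖coord x x ((orthonormalBasis H α).1 x)‖ ^ 2 : ℝ) : ℂ)

/-- `ℒ̃ = log det ∘ Hilb - (d / V) I`. -/
def lTilde [MeasurableSpace X] (b : Module.Basis (Fin (Module.finrank ℂ E)) ℂ E)
    (I : (∀ x, L x → L x → ℂ) → ℝ) (h : ∀ x, L x → L x → ℂ) : ℝ :=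
  logDet b (hilb E h) - (Module.finrank ℂ E : ℝ) / vol n h * I h

/-- `Z̃ = - I ∘ FS + (V / d) log det`. -/
def zTilde [MeasurableSpace X] [FiniteDimensional ℂ E]
    (b : Module.Basis (Fin (Module.finrank ℂ E)) ℂ E)
    (I : (∀ x, L x → L x → ℂ) → ℝ) (H : HermitianForms E) : ℝ :=
  - I (fubiniStudy E H) +
    vol n (fubiniStudy E H) / (Module.finrank ℂ E : ℝ) * logDet b H.inner

end LinearSystem

end BalancedMetrics

end

/-! Two inequalities, each sending one functional below the other, carry the equivalence; no
balanced point enters. Write `d` for the dimension of `E` and `V` for the volume.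

The first is `lTilde (FS H) ≤ (d / V) * zTilde H` (`lTilde_fubiniStudy_le`). In an `H`-orthonormal
basis the matrix of `Hilb (FS H)` has trace `(d / V) ∫ ∑ |s_α|² = d`, because the integrand is 1.
Since `log λ ≤ λ - 1` for each eigenvalue, the logarithm of its determinant is at most `d - d = 0`,
so passing from `H` to `Hilb (FS H)` does not raise `log det`, while the energy terms coincide.

The second is `zTilde (Hilb h) ≤ (V / d) * lTilde h` (`zTilde_le_lTilde`). Here the determinants
coincide and the claim is `I h ≤ I (FS (Hilb h))`. Write `FS (Hilb h) = e^ψ h` and let `ρ = ∑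
|s_α|²_h` be the Bergman function of a `Hilb h`-orthonormal basis. Then `ρ = e^(-ψ)` and `ρ` has
mean 1, so `ψ ≥ 1 - ρ` gives `∫ ψ dμ_h ≥ 0`. The energy is convex along the segments `e^(tψ) h`,
hence `I (e^ψ h) ≥ I h + ∫ ψ dμ_h` (`IsEnergy.add_integral_le`).

The analysis behind this is Kähler calculus by hand. The form of `e^(tψ) h` is `ω_h - t i∂∂̄ψ`,
affine in `t`, so `t`-derivatives of volume forms are Laplacians by Jacobi's formula. Green's
formula (`integral_green`) rests on the divergence-freeness of the adjugate of the Kähler matrix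
(`sum_wirtinger_adjugate`), which is closedness of `ω`. It yields the constancy of the volume, the
sign of `∫ f Δf` and thereby convexity, and the symmetry that makes the form `φ ↦ ∫ φ dμ_h` on the
space of metrics exact, so that its integral along segments is an energy (`hasDerivAt_relEnergy`).
Positivity of the Fubini-Study form is a Gram matrix computation for an immersion. -/

set_option linter.unusedSectionVars false

namespace BalancedMetrics

open MeasureTheory

/-! ### Wirtinger derivatives and complex Hessians on `ℂⁿ` -/

section WirtingerCalculus

variable {n : ℕ}

theorem single_I (j : Fin n) :
    (Pi.single j Complex.I : Fin n → ℂ) = Complex.I • Pi.single j (1 : ℂ) := by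
  rw [← Pi.single_smul]; simp

/-- A real-linear map is the sum of a complex-linear and an antilinear one. The Wirtinger
derivatives are the coefficients of these two parts of the differential, and the holomorphic chain
rule follows by separating them. -/
theorem realLinear_apply (T : (Fin n → ℂ) →L[ℝ] ℂ) (w : Fin n → ℂ) :
    T w = ∑ l, ((T (Pi.single l 1) - Complex.I * T (Pi.single l Complex.I)) / 2 * w l +
      (T (Pi.single l 1) + Complex.I * T (Pi.single l Complex.I)) / 2 * conj (w l)) := by
  have hw : w = ∑ l, ((w l).re • (Pi.single l 1 : Fin n → ℂ) +
      (w l).im • (Pi.single l Complex.I : Fin n → ℂ)) := by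
    ext k
    simp [Finset.sum_apply, Pi.single_apply, Finset.sum_add_distrib, Complex.re_add_im]
  conv_lhs => rw [hw]
  rw [map_sum]
  refine Finset.sum_congr rfl fun l _ => ?_
  rw [map_add, map_smul, map_smul, Complex.real_smul, Complex.real_smul]
  have h0 := Complex.re_add_im (w l)
  have h1 : conj (w l) = (w l).re - (w l).im * Complex.I := by
    apply Complex.ext <;> simp
  rw [h1]
  linear_combination ((T (Pi.single l 1) - Complex.I * T (Pi.single l Complex.I)) / 2) * h0 +
    ((w l).im : ℂ) * T (Pi.single l Complex.I) * Complex.I_mul_I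

theorem fderiv_apply_eq_wirtinger (u : (Fin n → ℂ) → ℂ) (z w : Fin n → ℂ) :
    fderiv ℝ u z w = ∑ l, (wirtinger l u z * w l + wirtingerBar l u z * conj (w l)) :=
  realLinear_apply _ w

theorem fderiv_sub_I_mul (u : (Fin n → ℂ) → ℂ) (z w : Fin n → ℂ) :
    (fderiv ℝ u z w - Complex.I * fderiv ℝ u z (Complex.I • w)) / 2 =
      ∑ l, wirtinger l u z * w l := by
  rw [fderiv_apply_eq_wirtinger, fderiv_apply_eq_wirtinger, Finset.mul_sum,
    ← Finset.sum_sub_distrib, Finset.sum_div]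
  refine Finset.sum_congr rfl fun l _ => ?_
  simp only [Pi.smul_apply, smul_eq_mul, map_mul, Complex.conj_I]
  linear_combination (wirtingerBar l u z * conj (w l) - wirtinger l u z * w l) / 2 *
    Complex.I_mul_I

theorem fderiv_add_I_mul (u : (Fin n → ℂ) → ℂ) (z w : Fin n → ℂ) :
    (fderiv ℝ u z w + Complex.I * fderiv ℝ u z (Complex.I • w)) / 2 =
      ∑ l, wirtingerBar l u z * conj (w l) := by
  rw [fderiv_apply_eq_wirtinger, fderiv_apply_eq_wirtinger, Finset.mul_sum,
    ← Finset.sum_add_distrib, Finset.sum_div]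
  refine Finset.sum_congr rfl fun l _ => ?_
  simp only [Pi.smul_apply, smul_eq_mul, map_mul, Complex.conj_I]
  linear_combination (-wirtingerBar l u z * conj (w l) + wirtinger l u z * w l) / 2 *
    Complex.I_mul_I

theorem wirtinger_congr {u v : (Fin n → ℂ) → ℂ} {z : Fin n → ℂ}
    (h : u =ᶠ[nhds z] v) (j : Fin n) : wirtinger j u z = wirtinger j v z := by
  simp only [wirtinger, h.fderiv_eq]

theorem wirtingerBar_congr {u v : (Fin n → ℂ) → ℂ} {z : Fin n → ℂ}
    (h : u =ᶠ[nhds z] v) (j : Fin n) : wirtingerBar j u z = wirtingerBar j v z := by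
  simp only [wirtingerBar, h.fderiv_eq]

theorem wirtingerBar_eventuallyEq {u v : (Fin n → ℂ) → ℂ} {z : Fin n → ℂ}
    (h : u =ᶠ[nhds z] v) (j : Fin n) : wirtingerBar j u =ᶠ[nhds z] wirtingerBar j v := by
  filter_upwards [h.eventuallyEq_nhds] with w hw using wirtingerBar_congr hw j

theorem complexHessian_congr {u v : (Fin n → ℂ) → ℂ} {z : Fin n → ℂ}
    (h : u =ᶠ[nhds z] v) : complexHessian u z = complexHessian v z := by
  ext j k
  exact wirtinger_congr (wirtingerBar_eventuallyEq h k) j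

section Rules

variable {u v : (Fin n → ℂ) → ℂ} {z : Fin n → ℂ} (j : Fin n)

theorem wirtinger_const (c : ℂ) : wirtinger j (fun _ => c) z = 0 := by
  simp [wirtinger]

theorem wirtinger_add (hu : DifferentiableAt ℝ u z) (hv : DifferentiableAt ℝ v z) :
    wirtinger j (fun w => u w + v w) z = wirtinger j u z + wirtinger j v z := by
  simp only [wirtinger, fderiv_fun_add hu hv, add_apply]; ring

theorem wirtingerBar_add (hu : DifferentiableAt ℝ u z) (hv : DifferentiableAt ℝ v z) :
    wirtingerBar j (fun w => u w + v w) z = wirtingerBar j u z + wirtingerBar j v z := by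
  simp only [wirtingerBar, fderiv_fun_add hu hv, add_apply]; ring

theorem wirtinger_mul (hu : DifferentiableAt ℝ u z) (hv : DifferentiableAt ℝ v z) :
    wirtinger j (fun w => u w * v w) z = u z * wirtinger j v z + wirtinger j u z * v z := by
  simp only [wirtinger, fderiv_fun_mul hu hv, add_apply,
    smul_apply, smul_eq_mul]; ring

theorem wirtingerBar_mul (hu : DifferentiableAt ℝ u z) (hv : DifferentiableAt ℝ v z) :
    wirtingerBar j (fun w => u w * v w) z =
      u z * wirtingerBar j v z + wirtingerBar j u z * v z := by
  simp only [wirtingerBar, fderiv_fun_mul hu hv, add_apply,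
    smul_apply, smul_eq_mul]; ring

theorem wirtinger_const_mul (c : ℂ) :
    wirtinger j (fun w => c * u w) z = c * wirtinger j u z := by
  have : fderiv ℝ (fun w => c * u w) z = c • fderiv ℝ u z :=
    congrFun (fderiv_const_smul_field (𝕜 := ℝ) (f := u) c) z
  simp only [wirtinger, this, smul_apply, smul_eq_mul]; ring

theorem wirtingerBar_const_mul (c : ℂ) :
    wirtingerBar j (fun w => c * u w) z = c * wirtingerBar j u z := by
  have : fderiv ℝ (fun w => c * u w) z = c • fderiv ℝ u z :=
    congrFun (fderiv_const_smul_field (𝕜 := ℝ) (f := u) c) z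
  simp only [wirtingerBar, this, smul_apply, smul_eq_mul]; ring

theorem wirtinger_sum {ι : Type*} (s : Finset ι) {f : ι → (Fin n → ℂ) → ℂ}
    (hf : ∀ i ∈ s, DifferentiableAt ℝ (f i) z) :
    wirtinger j (fun w => ∑ i ∈ s, f i w) z = ∑ i ∈ s, wirtinger j (f i) z := by
  simp only [wirtinger, fderiv_fun_sum hf, sum_apply, Finset.mul_sum,
    ← Finset.sum_sub_distrib, Finset.sum_div]

theorem wirtingerBar_sum {ι : Type*} (s : Finset ι) {f : ι → (Fin n → ℂ) → ℂ}
    (hf : ∀ i ∈ s, DifferentiableAt ℝ (f i) z) :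
    wirtingerBar j (fun w => ∑ i ∈ s, f i w) z = ∑ i ∈ s, wirtingerBar j (f i) z := by
  simp only [wirtingerBar, fderiv_fun_sum hf, sum_apply, Finset.mul_sum,
    ← Finset.sum_add_distrib, Finset.sum_div]

theorem fderiv_conj_apply (hu : DifferentiableAt ℝ u z) (w : Fin n → ℂ) :
    fderiv ℝ (fun y => conj (u y)) z w = conj (fderiv ℝ u z w) := by
  have h := (Complex.conjCLE.toContinuousLinearMap.hasFDerivAt (x := u z)).comp z hu.hasFDerivAt
  have e : fderiv ℝ (fun y => conj (u y)) z = _ := h.fderiv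
  rw [e]; simp

theorem wirtinger_conj (hu : DifferentiableAt ℝ u z) :
    wirtinger j (fun y => conj (u y)) z = conj (wirtingerBar j u z) := by
  simp only [wirtinger, wirtingerBar, fderiv_conj_apply hu, map_div₀, map_add, map_mul,
    Complex.conj_I, Complex.conj_ofNat]
  ring

theorem wirtingerBar_conj (hu : DifferentiableAt ℝ u z) :
    wirtingerBar j (fun y => conj (u y)) z = conj (wirtinger j u z) := by
  simp only [wirtinger, wirtingerBar, fderiv_conj_apply hu, map_div₀, map_sub, map_mul,
    Complex.conj_I, Complex.conj_ofNat]
  ring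

theorem wirtingerBar_holomorphic (hu : DifferentiableAt ℂ u z) : wirtingerBar j u z = 0 := by
  simp only [wirtingerBar, hu.fderiv_restrictScalars ℝ, ContinuousLinearMap.coe_restrictScalars',
    single_I, map_smul, smul_eq_mul]
  linear_combination fderiv ℂ u z (Pi.single j 1) / 2 * Complex.I_mul_I

theorem wirtinger_holomorphic (hu : DifferentiableAt ℂ u z) :
    wirtinger j u z = fderiv ℂ u z (Pi.single j 1) := by
  simp only [wirtinger, hu.fderiv_restrictScalars ℝ, ContinuousLinearMap.coe_restrictScalars',
    single_I, map_smul, smul_eq_mul]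
  linear_combination -fderiv ℂ u z (Pi.single j 1) / 2 * Complex.I_mul_I

theorem conj_wirtinger_ofReal {f : (Fin n → ℂ) → ℝ} (hf : DifferentiableAt ℝ f z) :
    conj (wirtinger j (fun w => (f w : ℂ)) z) = wirtingerBar j (fun w => (f w : ℂ)) z := by
  have h : DifferentiableAt ℝ (fun w => (f w : ℂ)) z :=
    Complex.ofRealCLM.differentiableAt.comp z hf
  rw [← wirtingerBar_conj j h]
  simp only [Complex.conj_ofReal]

theorem fderiv_log_apply {S : (Fin n → ℂ) → ℝ} (hS : DifferentiableAt ℝ S z) (h0 : S z ≠ 0)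
    (w : Fin n → ℂ) :
    fderiv ℝ (fun y => ((Real.log (S y) : ℝ) : ℂ)) z w =
      fderiv ℝ (fun y => (S y : ℂ)) z w / (S z : ℂ) := by
  have h1 : HasFDerivAt (fun y => ((Real.log (S y) : ℝ) : ℂ)) _ z :=
    (Complex.ofRealCLM.hasFDerivAt (x := Real.log (S z))).comp z (hS.hasFDerivAt.log h0)
  have h2 : HasFDerivAt (fun y => (S y : ℂ)) _ z :=
    (Complex.ofRealCLM.hasFDerivAt (x := S z)).comp z hS.hasFDerivAt
  rw [h1.fderiv, h2.fderiv]
  simp; ring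

theorem wirtingerBar_log {S : (Fin n → ℂ) → ℝ} (hS : DifferentiableAt ℝ S z) (h0 : S z ≠ 0) :
    wirtingerBar j (fun y => ((Real.log (S y) : ℝ) : ℂ)) z =
      wirtingerBar j (fun y => (S y : ℂ)) z / (S z : ℂ) := by
  simp only [wirtingerBar, fderiv_log_apply hS h0]; ring

theorem wirtinger_inv (hu : DifferentiableAt ℝ u z) (h0 : u z ≠ 0) :
    wirtinger j (fun w => (u w)⁻¹) z = - wirtinger j u z / (u z) ^ 2 := by
  have h : HasFDerivAt (fun w => (u w)⁻¹) _ z :=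
    ((hasDerivAt_inv h0).hasFDerivAt.restrictScalars ℝ).comp z hu.hasFDerivAt
  simp only [wirtinger, h.fderiv]
  simp; ring

end Rules

/-- The Jacobian matrix `∂F_l/∂z_k` of a holomorphic map. -/
noncomputable def jacobianMatrix (F : (Fin n → ℂ) → Fin n → ℂ) (z : Fin n → ℂ) :
    Matrix (Fin n) (Fin n) ℂ :=
  Matrix.of fun l k => fderiv ℂ F z (Pi.single k 1) l

theorem fderiv_comp_apply {u : (Fin n → ℂ) → ℂ} {F : (Fin n → ℂ) → Fin n → ℂ} {z : Fin n → ℂ}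
    (hu : DifferentiableAt ℝ u (F z)) (hF : DifferentiableAt ℂ F z) (w : Fin n → ℂ) :
    fderiv ℝ (fun y => u (F y)) z w = fderiv ℝ u (F z) (fderiv ℂ F z w) := by
  have h : HasFDerivAt (fun y => u (F y)) _ z :=
    hu.hasFDerivAt.comp z (hF.hasFDerivAt.restrictScalars ℝ)
  rw [h.fderiv]; rfl

theorem wirtinger_comp {u : (Fin n → ℂ) → ℂ} {F : (Fin n → ℂ) → Fin n → ℂ} {z : Fin n → ℂ}
    (hu : DifferentiableAt ℝ u (F z)) (hF : DifferentiableAt ℂ F z) (j : Fin n) :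
    wirtinger j (fun y => u (F y)) z = ∑ m, wirtinger m u (F z) * jacobianMatrix F z m j := by
  rw [wirtinger, fderiv_comp_apply hu hF, fderiv_comp_apply hu hF, single_I, map_smul,
    fderiv_sub_I_mul]
  rfl

theorem wirtingerBar_comp {u : (Fin n → ℂ) → ℂ} {F : (Fin n → ℂ) → Fin n → ℂ} {z : Fin n → ℂ}
    (hu : DifferentiableAt ℝ u (F z)) (hF : DifferentiableAt ℂ F z) (j : Fin n) :
    wirtingerBar j (fun y => u (F y)) z =
      ∑ m, wirtingerBar m u (F z) * conj (jacobianMatrix F z m j) := by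
  rw [wirtingerBar, fderiv_comp_apply hu hF, fderiv_comp_apply hu hF, single_I, map_smul,
    fderiv_add_I_mul]
  rfl

section Smooth

variable {u : (Fin n → ℂ) → ℂ} {z : Fin n → ℂ}

theorem contDiffAt_wirtinger {m k : ℕ∞ω} (hu : ContDiffAt ℝ m u z) (h : k + 1 ≤ m) (j : Fin n) :
    ContDiffAt ℝ k (wirtinger j u) z := by
  have h1 := hu.fderiv_right h
  unfold wirtinger
  exact ((h1.clm_apply contDiffAt_const).sub
    (contDiffAt_const.mul (h1.clm_apply contDiffAt_const))).div_const 2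

theorem contDiffAt_wirtingerBar {m k : ℕ∞ω} (hu : ContDiffAt ℝ m u z) (h : k + 1 ≤ m)
    (j : Fin n) : ContDiffAt ℝ k (wirtingerBar j u) z := by
  have h1 := hu.fderiv_right h
  unfold wirtingerBar
  exact ((h1.clm_apply contDiffAt_const).add
    (contDiffAt_const.mul (h1.clm_apply contDiffAt_const))).div_const 2

theorem differentiableAt_wirtingerBar (hu : ContDiffAt ℝ 2 u z) (j : Fin n) :
    DifferentiableAt ℝ (wirtingerBar j u) z :=
  (contDiffAt_wirtingerBar (k := 1) hu (by norm_num) j).differentiableAt (by simp)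

theorem eventually_differentiableAt (hu : ContDiffAt ℝ 2 u z) :
    ∀ᶠ w in nhds z, DifferentiableAt ℝ u w := by
  filter_upwards [hu.eventually (by simp)] with w hw using hw.differentiableAt (by simp)

/-- Symmetry of the second real derivative. Applied to `∂̄` of a local potential, it expresses that
the Kähler form is closed. -/
theorem wirtinger_comm (hu : ContDiffAt ℝ 2 u z) (j l : Fin n) :
    wirtinger j (fun w => wirtinger l u w) z = wirtinger l (fun w => wirtinger j u w) z := by
  have h1 : DifferentiableAt ℝ (fderiv ℝ u) z :=
    (hu.fderiv_right (m := 1) (by norm_num)).differentiableAt (by simp)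
  have hs := hu.isSymmSndFDerivAt (by simp)
  have key : ∀ (a b v : Fin n → ℂ), fderiv ℝ (fun w => (fderiv ℝ u w a -
      Complex.I * fderiv ℝ u w b) / 2) z v =
      (fderiv ℝ (fderiv ℝ u) z v a - Complex.I * fderiv ℝ (fderiv ℝ u) z v b) / 2 := by
    intro a b v
    have e : HasFDerivAt (fun w => (fderiv ℝ u w a - Complex.I * fderiv ℝ u w b) / 2) _ z :=
      ((h1.hasFDerivAt.clm_apply (hasFDerivAt_const a z)).sub
        ((h1.hasFDerivAt.clm_apply (hasFDerivAt_const b z)).const_mul Complex.I)).mul_const 2⁻¹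
    rw [e.fderiv]
    simp; ring
  unfold wirtinger
  simp only [key]
  rw [hs.eq (Pi.single j 1) (Pi.single l 1), hs.eq (Pi.single j 1) (Pi.single l Complex.I),
    hs.eq (Pi.single j Complex.I) (Pi.single l 1),
    hs.eq (Pi.single j Complex.I) (Pi.single l Complex.I)]
  ring

theorem complexHessian_add {v : (Fin n → ℂ) → ℂ} (hu : ContDiffAt ℝ 2 u z)
    (hv : ContDiffAt ℝ 2 v z) :
    complexHessian (fun w => u w + v w) z = complexHessian u z + complexHessian v z := by
  ext j k
  have h : (fun w => wirtingerBar k (fun w => u w + v w) w) =ᶠ[nhds z]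
      fun w => wirtingerBar k u w + wirtingerBar k v w := by
    filter_upwards [eventually_differentiableAt hu, eventually_differentiableAt hv] with w h1 h2
      using wirtingerBar_add k h1 h2
  simp only [complexHessian, Matrix.of_apply, Matrix.add_apply]
  rw [wirtinger_congr h]
  exact wirtinger_add j (differentiableAt_wirtingerBar hu k) (differentiableAt_wirtingerBar hv k)

theorem complexHessian_const_mul (c : ℂ) (u : (Fin n → ℂ) → ℂ) (z : Fin n → ℂ) :
    complexHessian (fun w => c * u w) z = c • complexHessian u z := by
  ext j k
  simp only [complexHessian, Matrix.of_apply, Matrix.smul_apply, smul_eq_mul,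
    wirtingerBar_const_mul, wirtinger_const_mul]

theorem complexHessian_sum {ι : Type*} (s : Finset ι) {f : ι → (Fin n → ℂ) → ℂ}
    (hf : ∀ i ∈ s, ContDiffAt ℝ 2 (f i) z) :
    complexHessian (fun w => ∑ i ∈ s, f i w) z = ∑ i ∈ s, complexHessian (f i) z := by
  ext j k
  have h : (fun w => wirtingerBar k (fun w => ∑ i ∈ s, f i w) w) =ᶠ[nhds z]
      fun w => ∑ i ∈ s, wirtingerBar k (f i) w := by
    have : ∀ᶠ w in nhds z, ∀ i ∈ s, DifferentiableAt ℝ (f i) w :=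
      (Finset.eventually_all s).2 fun i hi => eventually_differentiableAt (hf i hi)
    filter_upwards [this] with w hw using wirtingerBar_sum k s hw
  rw [Matrix.sum_apply]
  simp only [complexHessian, Matrix.of_apply]
  rw [wirtinger_congr h]
  exact wirtinger_sum j s fun i hi => differentiableAt_wirtingerBar (hf i hi) k

theorem complexHessian_mul {v : (Fin n → ℂ) → ℂ} (hu : ContDiffAt ℝ 2 u z)
    (hv : ContDiffAt ℝ 2 v z) (j k : Fin n) :
    complexHessian (fun w => u w * v w) z j k =
      u z * complexHessian v z j k + v z * complexHessian u z j k +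
        wirtinger j u z * wirtingerBar k v z + wirtinger j v z * wirtingerBar k u z := by
  have h : (fun w => wirtingerBar k (fun w => u w * v w) w) =ᶠ[nhds z]
      fun w => u w * wirtingerBar k v w + wirtingerBar k u w * v w := by
    filter_upwards [eventually_differentiableAt hu, eventually_differentiableAt hv] with w h1 h2
      using wirtingerBar_mul k h1 h2
  have du := hu.differentiableAt (by simp)
  have dv := hv.differentiableAt (by simp)
  have du' := differentiableAt_wirtingerBar hu k
  have dv' := differentiableAt_wirtingerBar hv k
  simp only [complexHessian, Matrix.of_apply]
  rw [wirtinger_congr h, wirtinger_add j (du.fun_mul dv') (du'.fun_mul dv), wirtinger_mul j du dv',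
    wirtinger_mul j du' dv]
  ring

/-- The chain rule for `∂̄` produces conjugated Jacobian entries. These are antiholomorphic, so `∂`
annihilates them and no second derivatives of `F` survive. -/
theorem complexHessian_comp {F : (Fin n → ℂ) → Fin n → ℂ} (hu : ContDiffAt ℝ 2 u (F z))
    (hF : ContDiffAt ℂ 2 F z) :
    complexHessian (fun y => u (F y)) z =
      (jacobianMatrix F z).transpose * complexHessian u (F z) *
        (jacobianMatrix F z).map conj := by
  ext j k
  have hF1 : DifferentiableAt ℂ F z := hF.differentiableAt (by simp)
  have hJ : ∀ l, DifferentiableAt ℂ (fun w => jacobianMatrix F w l k) z := by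
    intro l
    have h1 : DifferentiableAt ℂ (fderiv ℂ F) z :=
      (hF.fderiv_right (m := 1) (by norm_num)).differentiableAt (by simp)
    exact differentiableAt_pi.1 (h1.clm_apply (differentiableAt_const _)) l
  have h : (fun w => wirtingerBar k (fun y => u (F y)) w) =ᶠ[nhds z]
      fun w => ∑ l, wirtingerBar l u (F w) * conj (jacobianMatrix F w l k) := by
    have h2 : ∀ᶠ w in nhds z, DifferentiableAt ℂ F w := by
      filter_upwards [hF.eventually (by simp)] with w hw using hw.differentiableAt (by simp)
    filter_upwards [hF1.continuousAt.eventually (eventually_differentiableAt hu), h2] with w h1 h2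
      using wirtingerBar_comp h1 h2 k
  have d1 : ∀ l, DifferentiableAt ℝ (fun w => wirtingerBar l u (F w)) z := fun l =>
    (differentiableAt_wirtingerBar hu l).comp z (hF1.restrictScalars ℝ)
  have d2 : ∀ l, DifferentiableAt ℝ (fun w => conj (jacobianMatrix F w l k)) z := fun l =>
    Complex.conjCLE.differentiableAt.comp z ((hJ l).restrictScalars ℝ)
  have e : complexHessian (fun y => u (F y)) z j k =
      ∑ l, (∑ m, wirtinger m (wirtingerBar l u) (F z) * jacobianMatrix F z m j) *
        conj (jacobianMatrix F z l k) := by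
    simp only [complexHessian, Matrix.of_apply]
    rw [wirtinger_congr h, wirtinger_sum j _ fun l _ => (d1 l).fun_mul (d2 l)]
    refine Finset.sum_congr rfl fun l _ => ?_
    rw [wirtinger_mul j (d1 l) (d2 l), wirtinger_conj j ((hJ l).restrictScalars ℝ),
      wirtingerBar_holomorphic j (hJ l), map_zero, mul_zero, zero_add,
      wirtinger_comp (differentiableAt_wirtingerBar hu l) hF1]
  rw [e, Matrix.mul_apply]
  refine Finset.sum_congr rfl fun l _ => ?_
  rw [Matrix.mul_apply, Matrix.map_apply]
  congr 1
  refine Finset.sum_congr rfl fun m _ => ?_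
  rw [mul_comm]; rfl

theorem wirtingerBar_log_normSq {τ : (Fin n → ℂ) → ℂ} (hτ : DifferentiableAt ℂ τ z)
    (h0 : τ z ≠ 0) (k : Fin n) :
    wirtingerBar k (fun w => ((Real.log (‖τ w‖ ^ 2) : ℝ) : ℂ)) z =
      conj (fderiv ℂ τ z (Pi.single k 1) * (τ z)⁻¹) := by
  have hr := hτ.restrictScalars ℝ
  have hS : DifferentiableAt ℝ (fun w => ‖τ w‖ ^ 2) z := hr.norm_sq ℝ
  have hc : DifferentiableAt ℝ (fun w => conj (τ w)) z :=
    Complex.conjCLE.differentiableAt.comp z hr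
  have h1 : (fun w => ((‖τ w‖ ^ 2 : ℝ) : ℂ)) = fun w => τ w * conj (τ w) := by
    ext w; rw [Complex.mul_conj, Complex.normSq_eq_norm_sq]
  rw [wirtingerBar_log k hS (by positivity), h1, wirtingerBar_mul k hr hc,
    wirtingerBar_conj k hr, wirtingerBar_holomorphic k hτ, wirtinger_holomorphic k hτ]
  have h2 : ((‖τ z‖ ^ 2 : ℝ) : ℂ) = τ z * conj (τ z) := by
    rw [Complex.mul_conj, Complex.normSq_eq_norm_sq]
  rw [h2, map_mul, map_inv₀]
  have h3 : conj (τ z) ≠ 0 := by simpa using h0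
  field_simp
  ring

/-- `log |τ|²` is pluriharmonic: its `∂̄`-derivative is the conjugate of the holomorphic function
`τ' / τ`, which `∂` kills. This is what makes the curvature form independent of the holomorphic
frame. -/
theorem complexHessian_log_normSq {τ : (Fin n → ℂ) → ℂ} (hτ : ContDiffAt ℂ 2 τ z)
    (h0 : τ z ≠ 0) :
    complexHessian (fun w => ((Real.log (‖τ w‖ ^ 2) : ℝ) : ℂ)) z = 0 := by
  ext j k
  have hd := hτ.differentiableAt (by simp)
  have h : (fun w => wirtingerBar k (fun w => ((Real.log (‖τ w‖ ^ 2) : ℝ) : ℂ)) w) =ᶠ[nhds z]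
      fun w => conj (fderiv ℂ τ w (Pi.single k 1) * (τ w)⁻¹) := by
    filter_upwards [hτ.eventually (by simp), hd.continuousAt.eventually_ne h0] with w h1 h2
      using wirtingerBar_log_normSq (h1.differentiableAt (by simp)) h2 k
  have h1 : DifferentiableAt ℂ (fderiv ℂ τ) z :=
    (hτ.fderiv_right (m := 1) (by norm_num)).differentiableAt (by simp)
  have h2 : DifferentiableAt ℂ (fun w => fderiv ℂ τ w (Pi.single k 1) * (τ w)⁻¹) z :=
    (h1.clm_apply (differentiableAt_const _)).mul (hd.inv h0)
  simp only [complexHessian, Matrix.of_apply, Matrix.zero_apply]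
  rw [wirtinger_congr h, wirtinger_conj j (h2.restrictScalars ℝ), wirtingerBar_holomorphic j h2,
    map_zero]

end Smooth

end WirtingerCalculus

end BalancedMetrics

namespace BalancedMetrics

open MeasureTheory

/-! ### Jacobi's formula, the Piola identity and congruences -/

section Determinants

variable {n : ℕ}

theorem det_updateRow_eq_sum (A : Matrix (Fin n) (Fin n) ℂ) (i : Fin n) (y : Fin n → ℂ) :
    (A.updateRow i y).det = ∑ k, A.adjugate k i * y k := by
  rw [← Matrix.cramer_transpose_apply, Matrix.cramer_eq_adjugate_mulVec,
    ← Matrix.adjugate_transpose]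
  rfl

/-- Jacobi's formula: the determinant is multilinear in the rows, so its derivative replaces one row
at a time, and each resulting determinant expands along that row in cofactors. -/
theorem hasFDerivAt_det {F : Type*} [NormedAddCommGroup F] [NormedSpace ℝ F]
    {A : F → Matrix (Fin n) (Fin n) ℂ} {A' : Fin n → Fin n → F →L[ℝ] ℂ} {z : F}
    (hA : ∀ i k, HasFDerivAt (fun x => A x i k) (A' i k) z) :
    HasFDerivAt (fun x => (A x).det) (∑ i, ∑ k, (A z).adjugate k i • A' i k) z := by
  let D : ContinuousMultilinearMap ℂ (fun _ : Fin n => Fin n → ℂ) ℂ :=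
    ⟨(Matrix.detRowAlternating (n := Fin n) (R := ℂ)).toMultilinearMap,
      Continuous.matrix_det (A := fun x : Fin n → Fin n → ℂ => Matrix.of x) continuous_id⟩
  have hD : ∀ x : Fin n → Fin n → ℂ, D x = (Matrix.of x).det := fun x => rfl
  have h1 : HasFDerivAt (fun x => (fun i k => A x i k : Fin n → Fin n → ℂ))
      (ContinuousLinearMap.pi fun i => ContinuousLinearMap.pi fun k => A' i k) z :=
    hasFDerivAt_pi.2 fun i => hasFDerivAt_pi.2 fun k => hA i k
  have h2 := ((D.hasFDerivAt fun i k => A z i k).restrictScalars ℝ).comp z h1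
  refine h2.congr_fderiv ?_
  ext v
  refine (D.linearDeriv_apply (fun i k => A z i k) fun i k => A' i k v).trans ?_
  simp only [sum_apply, smul_apply, smul_eq_mul]
  refine Finset.sum_congr rfl fun i _ => ?_
  exact det_updateRow_eq_sum (A z) i _

theorem hasDerivAt_det {A : ℝ → Matrix (Fin n) (Fin n) ℂ} {A' : Matrix (Fin n) (Fin n) ℂ} {t : ℝ}
    (hA : ∀ i k, HasDerivAt (fun x => A x i k) (A' i k) t) :
    HasDerivAt (fun x => (A x).det) (((A t).adjugate * A').trace) t := by
  have h := (hasFDerivAt_det fun i k => (hA i k).hasFDerivAt).hasDerivAt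
  refine h.congr_deriv ?_
  simp only [sum_apply, smul_apply, smul_eq_mul, Matrix.trace, Matrix.diag_apply, Matrix.mul_apply,
    ContinuousLinearMap.toSpanSingleton_apply, one_smul]
  exact Finset.sum_comm

theorem contDiffAt_det {F : Type*} [NormedAddCommGroup F] [NormedSpace ℝ F] {m : ℕ∞ω}
    {A : F → Matrix (Fin n) (Fin n) ℂ} {z : F}
    (hA : ∀ i k, ContDiffAt ℝ m (fun x => A x i k) z) :
    ContDiffAt ℝ m (fun x => (A x).det) z := by
  simp only [Matrix.det_apply]
  refine ContDiffAt.sum fun σ _ => ?_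
  exact (contDiffAt_prod fun i _ => hA (σ i) i).const_smul _

theorem contDiffAt_adjugate {F : Type*} [NormedAddCommGroup F] [NormedSpace ℝ F] {m : ℕ∞ω}
    {A : F → Matrix (Fin n) (Fin n) ℂ} {z : F}
    (hA : ∀ i k, ContDiffAt ℝ m (fun x => A x i k) z) (i k : Fin n) :
    ContDiffAt ℝ m (fun x => (A x).adjugate i k) z := by
  simp only [Matrix.adjugate_apply]
  refine contDiffAt_det fun a b => ?_
  by_cases h : a = k
  · subst h; simpa using contDiffAt_const
  · simpa [Matrix.updateRow_ne h] using hA a b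

theorem wirtinger_det {A : (Fin n → ℂ) → Matrix (Fin n) (Fin n) ℂ} {z : Fin n → ℂ}
    (hA : ∀ i k, DifferentiableAt ℝ (fun x => A x i k) z) (j : Fin n) :
    wirtinger j (fun x => (A x).det) z =
      ∑ i, ∑ k, (A z).adjugate k i * wirtinger j (fun x => A x i k) z := by
  have h := hasFDerivAt_det fun i k => (hA i k).hasFDerivAt
  simp only [wirtinger, h.fderiv, sum_apply, smul_apply, smul_eq_mul, Finset.mul_sum,
    ← Finset.sum_sub_distrib, Finset.sum_div]
  refine Finset.sum_congr rfl fun i _ => Finset.sum_congr rfl fun k _ => ?_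
  ring

/-- The Piola identity. Differentiating `A * adj A = det A • 1` and summing gives `A v + ∑ (∂_j
A_lk) adj_kj = ∂_l det A`, where `v` is the divergence of the adjugate. By `hsymm` the sum on the
left is Jacobi's expression for `∂_l det A`, so `A v = 0`, and `A` is invertible. -/
theorem sum_wirtinger_adjugate {A : (Fin n → ℂ) → Matrix (Fin n) (Fin n) ℂ} {z : Fin n → ℂ}
    (hA : ∀ i k, ContDiffAt ℝ 1 (fun x => A x i k) z) (hdet : (A z).det ≠ 0)
    (hsymm : ∀ j l k, wirtinger j (fun x => A x l k) z = wirtinger l (fun x => A x j k) z)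
    (k : Fin n) : ∑ j, wirtinger j (fun x => (A x).adjugate k j) z = 0 := by
  have dA : ∀ i k, DifferentiableAt ℝ (fun x => A x i k) z :=
    fun i k => (hA i k).differentiableAt (by simp)
  have dadj : ∀ i k, DifferentiableAt ℝ (fun x => (A x).adjugate i k) z :=
    fun i k => (contDiffAt_adjugate hA i k).differentiableAt (by simp)
  have ddet : DifferentiableAt ℝ (fun x => (A x).det) z :=
    (contDiffAt_det hA).differentiableAt (by simp)
  have key : ∀ l j, ∑ k, (A z l k * wirtinger j (fun x => (A x).adjugate k j) z +
      wirtinger j (fun x => A x l k) z * (A z).adjugate k j) =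
      (if l = j then 1 else 0) * wirtinger j (fun x => (A x).det) z := by
    intro l j
    have e : (fun x => ∑ k, A x l k * (A x).adjugate k j) =
        fun x => (if l = j then 1 else 0) * (A x).det := by
      ext x
      rw [← Matrix.mul_apply, Matrix.mul_adjugate, Matrix.smul_apply, Matrix.one_apply,
        smul_eq_mul, mul_comm]
    rw [← wirtinger_const_mul, ← e, wirtinger_sum j _ fun k _ => (dA l k).fun_mul (dadj k j)]
    exact Finset.sum_congr rfl fun k _ => (wirtinger_mul j (dA l k) (dadj k j)).symm
  have h0 : (A z).mulVec (fun k => ∑ j, wirtinger j (fun x => (A x).adjugate k j) z) = 0 := by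
    ext l
    have h1 := Finset.sum_congr rfl fun j (_ : j ∈ Finset.univ) => key l j
    simp only [Finset.sum_add_distrib, ite_mul, one_mul, zero_mul, Finset.sum_ite_eq,
      Finset.mem_univ, if_true] at h1
    rw [wirtinger_det dA l] at h1
    have h2 : ∑ j, ∑ k, wirtinger j (fun x => A x l k) z * (A z).adjugate k j =
        ∑ j, ∑ k, (A z).adjugate k j * wirtinger l (fun x => A x j k) z :=
      Finset.sum_congr rfl fun j _ => Finset.sum_congr rfl fun k _ => by rw [hsymm, mul_comm]
    rw [h2, add_eq_right] at h1
    simp only [Matrix.mulVec, dotProduct, Finset.mul_sum, Pi.zero_apply]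
    rw [Finset.sum_comm]; exact h1
  exact congrFun (Matrix.eq_zero_of_mulVec_eq_zero hdet h0) k

/-- Under a change of coordinates this trace and the determinant of `G` pick up the same factor
`|det J|²`, so the quotient of the two, a Laplacian, is a function on the manifold. -/
theorem trace_adjugate_mul_conj {J G U : Matrix (Fin n) (Fin n) ℂ} :
    ((J.transpose * G * J.map conj).adjugate * (J.transpose * U * J.map conj)).trace =
      (Complex.normSq J.det : ℂ) * (G.adjugate * U).trace := by
  have h1 : J.transpose.adjugate * J.transpose = J.det • 1 := by
    rw [Matrix.adjugate_mul, Matrix.det_transpose]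
  have h2 : J.map conj * (J.map conj).adjugate = conj J.det • 1 := by
    rw [Matrix.mul_adjugate]; congr 1
    exact ((starRingEnd ℂ).map_det J).symm
  have : (J.transpose * G * J.map conj).adjugate * (J.transpose * U * J.map conj) =
      (J.map conj).adjugate * (G.adjugate * (J.transpose.adjugate * J.transpose) * U) *
        J.map conj := by
    simp only [Matrix.adjugate_mul_distrib, Matrix.mul_assoc]
  rw [this, Matrix.trace_mul_comm, ← Matrix.mul_assoc, h2, h1]
  simp only [Matrix.smul_mul, Matrix.one_mul, Matrix.mul_smul, Matrix.mul_one, Matrix.trace_smul,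
    smul_eq_mul, Complex.normSq_eq_conj_mul_self]
  ring

theorem det_conj_mul {J G : Matrix (Fin n) (Fin n) ℂ} :
    (J.transpose * G * J.map conj).det = (Complex.normSq J.det : ℂ) * G.det := by
  have : (J.map conj).det = conj J.det := ((starRingEnd ℂ).map_det J).symm
  rw [Matrix.det_mul, Matrix.det_mul, this, Matrix.det_transpose, Complex.normSq_eq_conj_mul_self]
  ring

end Determinants

/-! ### Green's formula on an open subset of `ℂⁿ` -/

section Green

variable {n : ℕ}

theorem integral_wirtinger_eq_zero {W : (Fin n → ℂ) → ℂ} (hW : ContDiff ℝ 1 W)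
    (hc : HasCompactSupport W) (j : Fin n) : ∫ z, wirtinger j W z = 0 := by
  have hd : Continuous (fderiv ℝ W) := hW.continuous_fderiv (by simp)
  have hi : ∀ v, Integrable (fun z => fderiv ℝ W z v) := fun v =>
    (hd.clm_apply continuous_const).integrable_of_hasCompactSupport
      (hc.fderiv_apply (𝕜 := ℝ) v)
  have h0 : ∀ v, ∫ z, fderiv ℝ W z v = 0 := by
    intro v
    -- Integration by parts against the constant function 1, whose derivative is zero.
    have := integral_bilinear_hasLineDerivAt_right_eq_neg_left_of_integrable
      (μ := (volume : Measure (Fin n → ℂ)))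
      (f := W) (f' := fun z => fderiv ℝ W z v) (g := fun _ => (1 : ℝ)) (g' := fun _ => 0) (v := v)
      (B := (ContinuousLinearMap.lsmul ℝ ℝ).flip)
      (by simpa using hi v) (by simp)
      (by simpa using hW.continuous.integrable_of_hasCompactSupport hc)
      (fun x _ => ((hW.differentiable (by simp)) x).hasFDerivAt.hasLineDerivAt v)
      (fun x _ => by simpa using (hasFDerivAt_const (1 : ℝ) x).hasLineDerivAt v)
    simpa using this
  unfold wirtinger
  rw [integral_div, integral_sub (hi _) ((hi _).const_mul _), integral_const_mul, h0, h0]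
  simp

/-- The divergence theorem without boundary term: since the field vanishes on `Ω` off the compact
set `K`, its extension by zero is `C¹` on all of `ℂⁿ`. -/
theorem setIntegral_sum_wirtinger_eq_zero {Ω K : Set (Fin n → ℂ)} (hΩ : IsOpen Ω)
    (hK : IsCompact K) (hKΩ : K ⊆ Ω) {W : Fin n → (Fin n → ℂ) → ℂ}
    (hW : ∀ j, ∀ z ∈ Ω, ContDiffAt ℝ 1 (W j) z) (h0 : ∀ j, ∀ z ∈ Ω, z ∉ K → W j z = 0) :
    Integrable (fun z => ∑ j, wirtinger j (W j) z) (volume.restrict Ω) ∧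
      ∫ z in Ω, ∑ j, wirtinger j (W j) z = 0 := by
  classical
  set W' : Fin n → (Fin n → ℂ) → ℂ := fun j => Ω.indicator (W j) with hW'
  have h0' : ∀ j, ∀ z ∉ K, W' j z = 0 := by
    intro j z hz
    by_cases h : z ∈ Ω
    · simp [hW', h, h0 j z h hz]
    · simp [hW', h]
  have heq : ∀ j, ∀ z ∈ Ω, W' j =ᶠ[nhds z] W j := by
    intro j z hz
    filter_upwards [hΩ.mem_nhds hz] with w hw using Set.indicator_of_mem hw _
  have hzero : ∀ j, ∀ z ∉ K, W' j =ᶠ[nhds z] fun _ => 0 := by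
    intro j z hz
    filter_upwards [hK.isClosed.isOpen_compl.mem_nhds hz] with w hw using h0' j w hw
  have hs : ∀ j, ContDiff ℝ 1 (W' j) := by
    intro j
    rw [contDiff_iff_contDiffAt]
    intro z
    by_cases hz : z ∈ Ω
    · exact (hW j z hz).congr_of_eventuallyEq (heq j z hz)
    · exact contDiffAt_const.congr_of_eventuallyEq (hzero j z fun h => hz (hKΩ h))
  have hc : ∀ j, HasCompactSupport (W' j) := fun j =>
    HasCompactSupport.intro hK (h0' j)
  have hw0 : ∀ j, ∀ z ∉ K, wirtinger j (W' j) z = 0 := by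
    intro j z hz
    rw [wirtinger_congr (hzero j z hz), wirtinger_const]
  have hi : ∀ j, Integrable (fun z => wirtinger j (W' j) z) := by
    intro j
    have hd : Continuous (fderiv ℝ (W' j)) := (hs j).continuous_fderiv (by simp)
    refine Continuous.integrable_of_hasCompactSupport ?_ (HasCompactSupport.intro hK (hw0 j))
    unfold wirtinger
    fun_prop
  have e : ∀ z ∈ Ω, ∑ j, wirtinger j (W j) z = ∑ j, wirtinger j (W' j) z := fun z hz =>
    Finset.sum_congr rfl fun j _ => (wirtinger_congr (heq j z hz) j).symm
  constructor
  · refine (integrable_finsetSum Finset.univ fun j _ => hi j).restrict.congr ?_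
    filter_upwards [ae_restrict_mem hΩ.measurableSet] with z hz using (e z hz).symm
  rw [setIntegral_congr_fun hΩ.measurableSet e,
    setIntegral_eq_integral_of_forall_compl_eq_zero, integral_finsetSum _ fun j _ => hi j]
  · exact Finset.sum_eq_zero fun j _ => integral_wirtinger_eq_zero (hs j) (hc j) j
  · exact fun z hz => Finset.sum_eq_zero fun j _ => hw0 j z fun h => hz (hKΩ h)

theorem trace_mul_eq_sum (A B : Matrix (Fin n) (Fin n) ℂ) :
    (A * B).trace = ∑ j, ∑ k, A k j * B j k := by
  simp only [Matrix.trace, Matrix.diag_apply, Matrix.mul_apply]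
  exact Finset.sum_comm

theorem contDiffAt_ofReal {m : ℕ∞ω} {f : (Fin n → ℂ) → ℝ} {z : Fin n → ℂ}
    (hf : ContDiffAt ℝ m f z) : ContDiffAt ℝ m (fun w => (f w : ℂ)) z :=
  Complex.ofRealCLM.contDiff.contDiffAt.comp z hf

/-- The field `adj_kj (f ∂̄_k u - u ∂̄_k f)` has the Green integrand as the real part of its
divergence. The derivatives of the adjugate cancel by the Piola identity. The terms with one
derivative on each of `f` and `u` form `X - conj X`, because the adjugate is Hermitian and `f`, `u`
are real, and this is purely imaginary. -/
theorem green_pointwise {ψ : (Fin n → ℂ) → ℂ} {f u : (Fin n → ℂ) → ℝ} {z : Fin n → ℂ}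
    (hψ : ContDiffAt ℝ 3 ψ z) (hG : (-complexHessian ψ z).PosDef)
    (hf : ContDiffAt ℝ 2 f z) (hu : ContDiffAt ℝ 2 u z) :
    (∑ j, wirtinger j (fun w => ∑ k, (-complexHessian ψ w).adjugate k j *
      ((f w : ℂ) * wirtingerBar k (fun w => (u w : ℂ)) w -
        (u w : ℂ) * wirtingerBar k (fun w => (f w : ℂ)) w)) z).re =
    (((-complexHessian ψ z).adjugate * complexHessian (fun w => (u w : ℂ)) z).trace).re * f z -
    (((-complexHessian ψ z).adjugate * complexHessian (fun w => (f w : ℂ)) z).trace).re * u z := by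
  have hA : ∀ i k, ContDiffAt ℝ 1 (fun w => (-complexHessian ψ w) i k) z := by
    intro i k
    refine ContDiffAt.neg ?_
    exact contDiffAt_wirtinger (m := 2) (contDiffAt_wirtingerBar hψ (by norm_num) k) (by norm_num) i
  have hsymm : ∀ j l k, wirtinger j (fun w => (-complexHessian ψ w) l k) z =
      wirtinger l (fun w => (-complexHessian ψ w) j k) z := by
    intro j l k
    have hc := wirtinger_comm (contDiffAt_wirtingerBar (k := 2) hψ (by norm_num) k) j l
    have e : ∀ a, (fun w => (-complexHessian ψ w) a k) =
        fun w => (-1) * wirtinger a (fun y => wirtingerBar k ψ y) w := by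
      intro a; ext w; simp [complexHessian]
    rw [e, e, wirtinger_const_mul, wirtinger_const_mul]
    congr 1
  have hadj := sum_wirtinger_adjugate hA hG.det_pos.ne' hsymm
  have dadj : ∀ i k, DifferentiableAt ℝ (fun w => (-complexHessian ψ w).adjugate i k) z :=
    fun i k => (contDiffAt_adjugate hA i k).differentiableAt (by simp)
  have hf' := contDiffAt_ofReal hf
  have hu' := contDiffAt_ofReal hu
  have df := hf'.differentiableAt (by simp)
  have du := hu'.differentiableAt (by simp)
  have df2 := differentiableAt_wirtingerBar hf'
  have du2 := differentiableAt_wirtingerBar hu'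
  set A := (-complexHessian ψ z).adjugate with hAdef
  have hAherm : ∀ i k, conj (A i k) = A k i := by
    intro i k
    have h : A.IsHermitian := by
      rw [Matrix.IsHermitian, hAdef, Matrix.adjugate_conjTranspose, hG.isHermitian.eq]
    exact h.apply k i
  have h1 : ∀ j, wirtinger j (fun w => ∑ k, (-complexHessian ψ w).adjugate k j *
      ((f w : ℂ) * wirtingerBar k (fun w => (u w : ℂ)) w -
        (u w : ℂ) * wirtingerBar k (fun w => (f w : ℂ)) w)) z =
      ∑ k, (A k j * (((f z : ℂ) * complexHessian (fun w => (u w : ℂ)) z j k +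
        wirtinger j (fun w => (f w : ℂ)) z * wirtingerBar k (fun w => (u w : ℂ)) z) -
        ((u z : ℂ) * complexHessian (fun w => (f w : ℂ)) z j k +
        wirtinger j (fun w => (u w : ℂ)) z * wirtingerBar k (fun w => (f w : ℂ)) z)) +
        wirtinger j (fun w => (-complexHessian ψ w).adjugate k j) z *
        ((f z : ℂ) * wirtingerBar k (fun w => (u w : ℂ)) z -
        (u z : ℂ) * wirtingerBar k (fun w => (f w : ℂ)) z)) := by
    intro j
    rw [wirtinger_sum j _ fun k _ => (dadj k j).fun_mul ((df.fun_mul (du2 k)).fun_sub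
      (du.fun_mul (df2 k)))]
    refine Finset.sum_congr rfl fun k _ => ?_
    rw [wirtinger_mul j (dadj k j) ((df.fun_mul (du2 k)).fun_sub (du.fun_mul (df2 k)))]
    congr 2
    have e : (fun w => (f w : ℂ) * wirtingerBar k (fun w => (u w : ℂ)) w -
        (u w : ℂ) * wirtingerBar k (fun w => (f w : ℂ)) w) =
        fun w => (f w : ℂ) * wirtingerBar k (fun w => (u w : ℂ)) w +
        (-1) * ((u w : ℂ) * wirtingerBar k (fun w => (f w : ℂ)) w) := by
      ext w; ring
    rw [e, wirtinger_add j (df.fun_mul (du2 k)) ((du.fun_mul (df2 k)).const_mul _),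
      wirtinger_const_mul, wirtinger_mul j df (du2 k), wirtinger_mul j du (df2 k)]
    simp only [complexHessian, Matrix.of_apply]
    ring
  have h2 : ∑ j, ∑ k, wirtinger j (fun w => (-complexHessian ψ w).adjugate k j) z *
        ((f z : ℂ) * wirtingerBar k (fun w => (u w : ℂ)) z -
        (u z : ℂ) * wirtingerBar k (fun w => (f w : ℂ)) z) = 0 := by
    rw [Finset.sum_comm]
    refine Finset.sum_eq_zero fun k _ => ?_
    rw [← Finset.sum_mul, hadj, zero_mul]
  set X := ∑ j, ∑ k, A k j * (wirtinger j (fun w => (f w : ℂ)) z *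
    wirtingerBar k (fun w => (u w : ℂ)) z) with hX
  have h3 : conj X = ∑ j, ∑ k, A k j * (wirtinger j (fun w => (u w : ℂ)) z *
      wirtingerBar k (fun w => (f w : ℂ)) z) := by
    rw [hX, map_sum, Finset.sum_comm]
    simp only [map_sum]
    rw [Finset.sum_comm, Finset.sum_comm]
    refine Finset.sum_congr rfl fun j _ => Finset.sum_congr rfl fun k _ => ?_
    rw [map_mul, map_mul, hAherm, conj_wirtinger_ofReal j (hf.differentiableAt (by simp)),
      ← conj_wirtinger_ofReal k (hu.differentiableAt (by simp)), Complex.conj_conj]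
    ring
  have h4 : ∑ j, wirtinger j (fun w => ∑ k, (-complexHessian ψ w).adjugate k j *
      ((f w : ℂ) * wirtingerBar k (fun w => (u w : ℂ)) w -
        (u w : ℂ) * wirtingerBar k (fun w => (f w : ℂ)) w)) z =
      (A * complexHessian (fun w => (u w : ℂ)) z).trace * (f z : ℂ) -
      (A * complexHessian (fun w => (f w : ℂ)) z).trace * (u z : ℂ) + (X - conj X) := by
    rw [h3, hX, trace_mul_eq_sum, trace_mul_eq_sum, ← add_zero (_ + _), ← h2]
    simp only [h1, Finset.sum_mul, ← Finset.sum_add_distrib, ← Finset.sum_sub_distrib]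
    refine Finset.sum_congr rfl fun j _ => Finset.sum_congr rfl fun k _ => ?_
    ring
  rw [h4, Complex.add_re, Complex.sub_re, Complex.sub_re, Complex.re_mul_ofReal,
    Complex.re_mul_ofReal, Complex.conj_re]
  ring

theorem setIntegral_green {Ω K : Set (Fin n → ℂ)} (hΩ : IsOpen Ω)
    (hK : IsCompact K) (hKΩ : K ⊆ Ω) {ψ : (Fin n → ℂ) → ℂ} {f u : (Fin n → ℂ) → ℝ}
    (hψ : ∀ z ∈ Ω, ContDiffAt ℝ 3 ψ z) (hG : ∀ z ∈ Ω, (-complexHessian ψ z).PosDef)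
    (hf : ∀ z ∈ Ω, ContDiffAt ℝ 2 f z) (hu : ∀ z ∈ Ω, ContDiffAt ℝ 2 u z)
    (h0 : ∀ z ∈ Ω, z ∉ K → f z = 0) :
    ∫ z in Ω,
      ((((-complexHessian ψ z).adjugate * complexHessian (fun w => (u w : ℂ)) z).trace).re * f z -
      (((-complexHessian ψ z).adjugate * complexHessian (fun w => (f w : ℂ)) z).trace).re * u z) =
      0 := by
  have hmain := setIntegral_sum_wirtinger_eq_zero hΩ hK hKΩ
    (W := fun j w => ∑ k, (-complexHessian ψ w).adjugate k j *
      ((f w : ℂ) * wirtingerBar k (fun w => (u w : ℂ)) w -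
        (u w : ℂ) * wirtingerBar k (fun w => (f w : ℂ)) w)) ?_ ?_
  rotate_left
  · intro j z hz
    have hA : ∀ i k, ContDiffAt ℝ 1 (fun w => (-complexHessian ψ w) i k) z := by
      intro i k
      refine ContDiffAt.neg ?_
      exact contDiffAt_wirtinger (m := 2)
        (contDiffAt_wirtingerBar (hψ z hz) (by norm_num) k) (by norm_num) i
    have hf' := contDiffAt_ofReal (hf z hz)
    have hu' := contDiffAt_ofReal (hu z hz)
    refine ContDiffAt.sum fun k _ => (contDiffAt_adjugate hA k j).mul (ContDiffAt.sub ?_ ?_)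
    · exact (hf'.of_le (by norm_num)).mul (contDiffAt_wirtingerBar hu' (by norm_num) k)
    · exact (hu'.of_le (by norm_num)).mul (contDiffAt_wirtingerBar hf' (by norm_num) k)
  · intro j z hz hzK
    have hev : (fun w => (f w : ℂ)) =ᶠ[nhds z] fun _ => 0 := by
      filter_upwards [hΩ.mem_nhds hz, hK.isClosed.isOpen_compl.mem_nhds hzK] with w h1 h2
      simp [h0 w h1 h2]
    refine Finset.sum_eq_zero fun k _ => ?_
    rw [wirtingerBar_congr hev, h0 z hz hzK]
    simp [wirtingerBar]
  obtain ⟨hi, h⟩ := hmain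
  rw [← setIntegral_congr_fun hΩ.measurableSet
    fun z hz => green_pointwise (hψ z hz) (hG z hz) (hf z hz) (hu z hz)]
  have := integral_re hi
  simp only [RCLike.re_eq_complex_re] at this
  rw [this, h]; rfl

end Green

end BalancedMetrics

namespace BalancedMetrics

open MeasureTheory

/-! ### Holomorphic changes of coordinates -/

section Charts

theorem contDiffAt_comp_chart_symm {𝕜 : Type*} [NontriviallyNormedField 𝕜] {F G : Type*}
    [NormedAddCommGroup F] [NormedSpace 𝕜 F] [NormedAddCommGroup G] [NormedSpace 𝕜 G]
    {X : Type*} [TopologicalSpace X] [ChartedSpace F X] {m : ℕ∞ω} [IsManifold 𝓘(𝕜, F) m X]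
    {f : X → G} {p x : X} (hx : x ∈ (chartAt F p).source)
    (hf : ContMDiffAt 𝓘(𝕜, F) 𝓘(𝕜, G) m f x) :
    ContDiffAt 𝕜 m (fun z => f ((chartAt F p).symm z)) (chartAt F p x) := by
  rw [← contMDiffAt_iff_contDiffAt]
  have h1 : ContMDiffAt 𝓘(𝕜, F) 𝓘(𝕜, F) m (chartAt F p).symm (chartAt F p x) :=
    (contMDiffOn_chart_symm (I := 𝓘(𝕜, F)) (x := p)).contMDiffAt
      ((chartAt F p).open_target.mem_nhds ((chartAt F p).map_source hx))
  have h2 : ContMDiffAt 𝓘(𝕜, F) 𝓘(𝕜, G) m f ((chartAt F p).symm (chartAt F p x)) := by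
    rwa [(chartAt F p).left_inv hx]
  exact h2.comp (chartAt F p x) h1

variable {n : ℕ} {X : Type*} [TopologicalSpace X] [ChartedSpace (Fin n → ℂ) X]

theorem isManifold_real [IsManifold 𝓘(ℂ, Fin n → ℂ) ω X] :
    IsManifold 𝓘(ℝ, Fin n → ℂ) ∞ X := by
  refine isManifold_of_contDiffOn _ _ _ fun e e' he he' => ?_
  have h := (contDiffGroupoid ω 𝓘(ℂ, Fin n → ℂ)).compatible he he'
  rw [contDiffGroupoid, mem_groupoid_of_pregroupoid] at h
  exact (ContDiffOn.restrict_scalars ℝ h.1).of_le le_top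

theorem two_le_infty : (2 : ℕ∞ω) ≤ ∞ := (WithTop.coe_le_coe (α := ℕ∞)).2 le_top

theorem three_le_infty : (3 : ℕ∞ω) ≤ ∞ := (WithTop.coe_le_coe (α := ℕ∞)).2 le_top

theorem contMDiffAt_real_of_complex {f : X → ℂ} {x : X}
    (hf : ContMDiffAt 𝓘(ℂ, Fin n → ℂ) 𝓘(ℂ, ℂ) ω f x) :
    ContMDiffAt 𝓘(ℝ, Fin n → ℂ) 𝓘(ℝ, ℂ) ∞ f x := by
  rw [contMDiffAt_iff] at hf ⊢
  refine ⟨hf.1, ?_⟩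
  exact (ContDiffWithinAt.restrict_scalars ℝ hf.2).of_le le_top

/-- The change of coordinates from the chart at `p` to the chart at `q`. -/
noncomputable def transition (p q : X) (z : Fin n → ℂ) : Fin n → ℂ :=
  chartAt (Fin n → ℂ) q ((chartAt (Fin n → ℂ) p).symm z)

theorem transition_apply_chart {p q x : X} (hp : x ∈ (chartAt (Fin n → ℂ) p).source) :
    transition (n := n) p q (chartAt (Fin n → ℂ) p x) = chartAt (Fin n → ℂ) q x := by
  rw [transition, (chartAt (Fin n → ℂ) p).left_inv hp]

theorem eventually_chart_symm_mem {p x : X} (hp : x ∈ (chartAt (Fin n → ℂ) p).source)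
    {U : Set X} (hU : U ∈ nhds x) :
    ∀ᶠ z in nhds (chartAt (Fin n → ℂ) p x), (chartAt (Fin n → ℂ) p).symm z ∈ U := by
  have h := (chartAt (Fin n → ℂ) p).continuousAt_symm ((chartAt (Fin n → ℂ) p).map_source hp)
  rw [ContinuousAt, (chartAt (Fin n → ℂ) p).left_inv hp] at h
  exact h hU

/-- The Jacobian of the change of coordinates at a point of `X`. -/
noncomputable def transitionMatrix (n : ℕ) {X : Type*} [TopologicalSpace X] [ChartedSpace (Fin n → ℂ) X]
    (p q x : X) : Matrix (Fin n) (Fin n) ℂ :=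
  jacobianMatrix (transition (n := n) p q) (chartAt (Fin n → ℂ) p x)

theorem det_fderiv_eq (F : (Fin n → ℂ) → Fin n → ℂ) (z : Fin n → ℂ) :
    (fderiv ℂ F z).det = (jacobianMatrix F z).det := by
  have : (fderiv ℂ F z : (Fin n → ℂ) →ₗ[ℂ] Fin n → ℂ) = Matrix.toLin' (jacobianMatrix F z) := by
    ext v
    simp [jacobianMatrix]
  rw [ContinuousLinearMap.det, this, LinearMap.det_toLin']

variable [IsManifold 𝓘(ℂ, Fin n → ℂ) ω X]

theorem contDiffAt_transition {p q x : X} (hp : x ∈ (chartAt (Fin n → ℂ) p).source)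
    (hq : x ∈ (chartAt (Fin n → ℂ) q).source) :
    ContDiffAt ℂ ω (transition (n := n) p q) (chartAt (Fin n → ℂ) p x) :=
  contDiffAt_comp_chart_symm hp ((contMDiffOn_chart (I := 𝓘(ℂ, Fin n → ℂ)) (x := q)).contMDiffAt
      ((chartAt (Fin n → ℂ) q).open_source.mem_nhds hq))

/-- The two changes of coordinates are inverse to each other near the point, so their differentials
compose to the identity. -/
theorem det_transitionMatrix_ne_zero {p q x : X} (hp : x ∈ (chartAt (Fin n → ℂ) p).source)
    (hq : x ∈ (chartAt (Fin n → ℂ) q).source) : (transitionMatrix n p q x).det ≠ 0 := by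
  have h1 := ((contDiffAt_transition hp hq).differentiableAt (by simp)).hasFDerivAt
  have h2 := ((contDiffAt_transition hq hp).differentiableAt (by simp)).hasFDerivAt
  rw [← transition_apply_chart (q := q) hp] at h2
  have h3 := h2.comp _ h1
  have h4 : transition (n := n) q p ∘ transition p q =ᶠ[nhds (chartAt (Fin n → ℂ) p x)] id := by
    filter_upwards [eventually_chart_symm_mem hp
      ((chartAt (Fin n → ℂ) q).open_source.mem_nhds hq),
      (chartAt (Fin n → ℂ) p).open_target.mem_nhds ((chartAt (Fin n → ℂ) p).map_source hp)]
      with z hz hz'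
    simp only [Function.comp, transition, id]
    rw [(chartAt (Fin n → ℂ) q).left_inv hz, (chartAt (Fin n → ℂ) p).right_inv hz']
  have h5 := h3.unique ((hasFDerivAt_id _).congr_of_eventuallyEq h4)
  rw [transitionMatrix, ← det_fderiv_eq]
  intro h0
  have h6 : LinearMap.det ((fderiv ℂ (transition (n := n) q p)
      (transition p q (chartAt (Fin n → ℂ) p x))).toLinearMap ∘ₗ
      (fderiv ℂ (transition (n := n) p q) (chartAt (Fin n → ℂ) p x)).toLinearMap) =
      LinearMap.det LinearMap.id :=
    congrArg (fun T : (Fin n → ℂ) →L[ℂ] Fin n → ℂ => LinearMap.det T.toLinearMap) h5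
  rw [LinearMap.det_comp, LinearMap.det_id] at h6
  rw [ContinuousLinearMap.det] at h0
  rw [h0, mul_zero] at h6
  exact zero_ne_one h6

/-- The complex Hessian of `u` in the chart at `p`, at the point `x`. -/
noncomputable def chartHessian (n : ℕ) {X : Type*} [TopologicalSpace X] [ChartedSpace (Fin n → ℂ) X]
    (u : X → ℝ) (p x : X) : Matrix (Fin n) (Fin n) ℂ :=
  complexHessian (fun z => (u ((chartAt (Fin n → ℂ) p).symm z) : ℂ)) (chartAt (Fin n → ℂ) p x)

theorem contDiffAt_chart {u : X → ℝ} {p x : X} (hp : x ∈ (chartAt (Fin n → ℂ) p).source)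
    (hu : ContMDiffAt 𝓘(ℝ, Fin n → ℂ) 𝓘(ℝ, ℝ) ∞ u x) :
    ContDiffAt ℝ ∞ (fun z => u ((chartAt (Fin n → ℂ) p).symm z)) (chartAt (Fin n → ℂ) p x) :=
  have : IsManifold 𝓘(ℝ, Fin n → ℂ) ∞ X := isManifold_real
  contDiffAt_comp_chart_symm hp hu

theorem chartHessian_transition {u : X → ℝ} {p q x : X}
    (hu : ContMDiffAt 𝓘(ℝ, Fin n → ℂ) 𝓘(ℝ, ℝ) ∞ u x)
    (hp : x ∈ (chartAt (Fin n → ℂ) p).source) (hq : x ∈ (chartAt (Fin n → ℂ) q).source) :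
    chartHessian n u p x = (transitionMatrix n p q x).transpose * chartHessian n u q x *
      (transitionMatrix n p q x).map conj := by
  have h4 : (fun z => (u ((chartAt (Fin n → ℂ) p).symm z) : ℂ))
      =ᶠ[nhds (chartAt (Fin n → ℂ) p x)]
      fun z => (u ((chartAt (Fin n → ℂ) q).symm (transition p q z)) : ℂ) := by
    filter_upwards [eventually_chart_symm_mem hp
      ((chartAt (Fin n → ℂ) q).open_source.mem_nhds hq)] with z hz
    rw [transition, (chartAt (Fin n → ℂ) q).left_inv hz]
  rw [chartHessian, complexHessian_congr h4, complexHessian_comp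
    (u := fun z => (u ((chartAt (Fin n → ℂ) q).symm z) : ℂ)), transition_apply_chart hp]
  · rfl
  · rw [transition_apply_chart hp]
    exact contDiffAt_ofReal ((contDiffAt_chart hq hu).of_le two_le_infty)
  · exact (contDiffAt_transition hp hq).of_le le_top

end Charts

end BalancedMetrics

namespace BalancedMetrics

open MeasureTheory

/-! ### Holomorphic frames and the invariance of the Kähler matrix -/

section Frames

variable {n : ℕ} {X : Type*} [TopologicalSpace X] [ChartedSpace (Fin n → ℂ) X]
  {L : X → Type*} [∀ x, AddCommGroup (L x)] [∀ x, Module ℂ (L x)]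
  [∀ x, TopologicalSpace (L x)] [TopologicalSpace (Bundle.TotalSpace ℂ L)]
  [FiberBundle ℂ L]

theorem patch_open (p : X) : IsOpen (patch n L p) :=
  (chartAt (Fin n → ℂ) p).open_source.inter (trivializationAt ℂ L p).open_baseSet

theorem mem_patch_self (p : X) : p ∈ patch n L p :=
  ⟨mem_chart_source _ p, FiberBundle.mem_baseSet_trivializationAt ℂ L p⟩

theorem chart_image_patch_open (p : X) : IsOpen (chartAt (Fin n → ℂ) p '' patch n L p) :=
  (chartAt (Fin n → ℂ) p).isOpen_image_of_subset_source (patch_open p) fun _ h => h.1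

/-- The function `|e|²_h`, where `e` is the frame `frame p`. -/
noncomputable def frameSq (h : ∀ x, L x → L x → ℂ) (p x : X) : ℝ := (h x (frame p x) (frame p x)).re

theorem logNormSq_def (h : ∀ x, L x → L x → ℂ) (p : X) : logNormSq (n := n) h p =
    fun z => ((Real.log (frameSq h p ((chartAt (Fin n → ℂ) p).symm z)) : ℝ) : ℂ) := rfl

variable [VectorBundle ℂ ℂ L]

section Linear

variable {p x : X}

theorem coord_eq_linearMapAt (hx : x ∈ (trivializationAt ℂ L p).baseSet) (v : L x) :
    coord p x v = (trivializationAt ℂ L p).linearMapAt ℂ x v := by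
  rw [Bundle.Trivialization.coe_linearMapAt_of_mem _ hx]; rfl

theorem coord_smul (hx : x ∈ (trivializationAt ℂ L p).baseSet) (c : ℂ) (v : L x) :
    coord p x (c • v) = c * coord p x v := by
  rw [coord_eq_linearMapAt hx, coord_eq_linearMapAt hx, map_smul, smul_eq_mul]

theorem coord_add (hx : x ∈ (trivializationAt ℂ L p).baseSet) (v w : L x) :
    coord p x (v + w) = coord p x v + coord p x w := by
  rw [coord_eq_linearMapAt hx, coord_eq_linearMapAt hx, coord_eq_linearMapAt hx, map_add]

theorem coord_zero (hx : x ∈ (trivializationAt ℂ L p).baseSet) : coord p x (0 : L x) = 0 := by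
  rw [coord_eq_linearMapAt hx, map_zero]

theorem coord_frame (hx : x ∈ (trivializationAt ℂ L p).baseSet) :
    coord p x (frame p x : L x) = 1 := by
  rw [coord, frame, Bundle.Trivialization.apply_mk_symm _ hx]

theorem eq_coord_smul_frame (hx : x ∈ (trivializationAt ℂ L p).baseSet) (v : L x) :
    v = coord p x v • (frame p x : L x) := by
  have h1 := (trivializationAt ℂ L p).symm_apply_apply_mk hx v
  have h2 := congrFun ((trivializationAt ℂ L p).coe_symmₗ (R := ℂ) hx)
  rw [frame, ← h2, ← map_smul, smul_eq_mul, mul_one, h2, coord, h1]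

theorem coord_ne_zero (hx : x ∈ (trivializationAt ℂ L p).baseSet) {v : L x} (hv : v ≠ 0) :
    coord p x v ≠ 0 := by
  intro h
  apply hv
  rw [eq_coord_smul_frame hx v, h, zero_smul]

theorem frame_ne_zero (hx : x ∈ (trivializationAt ℂ L p).baseSet) : (frame p x : L x) ≠ 0 := by
  intro h
  have := coord_frame hx
  rw [h, coord_zero hx] at this
  exact zero_ne_one this

end Linear

namespace IsHermitianMetric

variable {h : ∀ x, L x → L x → ℂ} (hh : IsHermitianMetric n h) {p x : X}

include hh

theorem smul_left (c : ℂ) (u v : L x) : h x (c • u) v = conj c * h x u v := by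
  rw [← hh.conj_symm, hh.smul_right, map_mul, hh.conj_symm]

theorem add_left (u v w : L x) : h x (u + v) w = h x u w + h x v w := by
  rw [← hh.conj_symm, hh.add_right, map_add, hh.conj_symm, hh.conj_symm]

theorem self_eq_re (v : L x) : h x v v = ((h x v v).re : ℂ) :=
  (Complex.conj_eq_iff_re.1 (hh.conj_symm x v v)).symm

theorem apply_eq (hx : x ∈ (trivializationAt ℂ L p).baseSet) (u v : L x) :
    h x u v = conj (coord p x u) * coord p x v * (frameSq h p x : ℂ) := by
  conv_lhs => rw [eq_coord_smul_frame hx u, eq_coord_smul_frame hx v]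
  rw [hh.smul_right, hh.smul_left, hh.self_eq_re, frameSq]
  ring

theorem re_self_eq (hx : x ∈ (trivializationAt ℂ L p).baseSet) (v : L x) :
    (h x v v).re = ‖coord p x v‖ ^ 2 * frameSq h p x := by
  rw [hh.apply_eq hx, ← Complex.normSq_eq_conj_mul_self, Complex.normSq_eq_norm_sq,
    Complex.re_ofReal_mul, Complex.ofReal_re]

theorem frameSq_pos (hx : x ∈ (trivializationAt ℂ L p).baseSet) : 0 < frameSq h p x :=
  hh.pos x _ (frame_ne_zero hx)

theorem contMDiffAt_frameSq (hx : x ∈ (trivializationAt ℂ L p).baseSet) :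
    ContMDiffAt 𝓘(ℝ, Fin n → ℂ) 𝓘(ℝ, ℝ) ∞ (frameSq h p) x :=
  (hh.smooth p).contMDiffAt ((trivializationAt ℂ L p).open_baseSet.mem_nhds hx)

end IsHermitianMetric

variable [IsManifold 𝓘(ℂ, Fin n → ℂ) ω X]

theorem contDiffAt_logFrameSq {h : ∀ x, L x → L x → ℂ} (hh : IsHermitianMetric n h) {p x : X}
    (hx : x ∈ patch n L p) :
    ContDiffAt ℝ ∞ (fun z => Real.log (frameSq h p ((chartAt (Fin n → ℂ) p).symm z)))
      (chartAt (Fin n → ℂ) p x) := by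
  refine (contDiffAt_chart hx.1 (hh.contMDiffAt_frameSq hx.2)).log ?_
  rw [(chartAt (Fin n → ℂ) p).left_inv hx.1]
  exact (hh.frameSq_pos hx.2).ne'

theorem contDiffAt_logNormSq {h : ∀ x, L x → L x → ℂ} (hh : IsHermitianMetric n h) {p x : X}
    (hx : x ∈ patch n L p) :
    ContDiffAt ℝ ∞ (logNormSq h p) (chartAt (Fin n → ℂ) p x) :=
  contDiffAt_ofReal (contDiffAt_logFrameSq hh hx)

variable [ContMDiffVectorBundle ω ℂ L 𝓘(ℂ, Fin n → ℂ)]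

theorem contDiffAt_coord_frame {p q x : X} (hp : x ∈ patch n L p)
    (hq : x ∈ (trivializationAt ℂ L q).baseSet) :
    ContDiffAt ℂ ω (fun z => coord q ((chartAt (Fin n → ℂ) p).symm z)
      (frame p ((chartAt (Fin n → ℂ) p).symm z) : L _)) (chartAt (Fin n → ℂ) p x) := by
  refine contDiffAt_comp_chart_symm (f := fun y => coord q y (frame p y : L y)) hp.1 ?_
  have h1 := contMDiffOn_coordChangeL (n := ω) (IB := 𝓘(ℂ, Fin n → ℂ)) (𝕜 := ℂ)
    (trivializationAt ℂ L p) (trivializationAt ℂ L q)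
  have hmem : (trivializationAt ℂ L p).baseSet ∩ (trivializationAt ℂ L q).baseSet ∈ nhds x :=
    ((trivializationAt ℂ L p).open_baseSet.inter (trivializationAt ℂ L q).open_baseSet).mem_nhds
      ⟨hp.2, hq⟩
  have h2 := (h1.contMDiffAt hmem).clm_apply (contMDiffAt_const (c := (1 : ℂ)))
  refine h2.congr_of_eventuallyEq ?_
  filter_upwards [hmem] with y hy
  exact (Bundle.Trivialization.coordChangeL_apply _ _ hy 1).symm

/-- The two frames differ by a holomorphic nonvanishing factor `τ`, so the local potentials differ
by a change of variables and the term `log |τ|²`. The latter is pluriharmonic, and the former acts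
by congruence with the Jacobian. -/
theorem kahlerMatrix_transition {h : ∀ x, L x → L x → ℂ} (hh : IsHermitianMetric n h) {p q x : X}
    (hp : x ∈ patch n L p) (hq : x ∈ patch n L q) :
    kahlerMatrix h p (chartAt (Fin n → ℂ) p x) = (transitionMatrix n p q x).transpose *
      kahlerMatrix h q (chartAt (Fin n → ℂ) q x) * (transitionMatrix n p q x).map conj := by
  have hev : logNormSq h p =ᶠ[nhds (chartAt (Fin n → ℂ) p x)] fun z =>
      logNormSq h q (transition p q z) + ((Real.log (‖coord q ((chartAt (Fin n → ℂ) p).symm z)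
      (frame p ((chartAt (Fin n → ℂ) p).symm z) : L _)‖ ^ 2) : ℝ) : ℂ) := by
    filter_upwards [eventually_chart_symm_mem hp.1
      (((patch_open p).inter (patch_open q)).mem_nhds ⟨hp, hq⟩)] with z hz
    set y := (chartAt (Fin n → ℂ) p).symm z with hy
    rw [logNormSq_def, logNormSq_def, ← Complex.ofReal_add]
    simp only [transition]
    rw [← hy, (chartAt (Fin n → ℂ) q).left_inv hz.2.1, add_comm, ← Real.log_mul, frameSq,
      hh.re_self_eq hz.2.2]
    · exact pow_ne_zero 2 (norm_ne_zero_iff.2 (coord_ne_zero hz.2.2 (frame_ne_zero hz.1.2)))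
    · exact (hh.frameSq_pos hz.2.2).ne'
  have hτ := contDiffAt_coord_frame (L := L) hp hq.2
  have hτ0 : coord q ((chartAt (Fin n → ℂ) p).symm (chartAt (Fin n → ℂ) p x))
      (frame p ((chartAt (Fin n → ℂ) p).symm (chartAt (Fin n → ℂ) p x)) : L _) ≠ 0 := by
    rw [(chartAt (Fin n → ℂ) p).left_inv hp.1]
    exact coord_ne_zero hq.2 (frame_ne_zero hp.2)
  have hq' := contDiffAt_logNormSq hh hq
  have hF : ContDiffAt ℂ 2 (transition (n := n) p q) (chartAt (Fin n → ℂ) p x) :=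
    (contDiffAt_transition hp.1 hq.1).of_le le_top
  rw [← transition_apply_chart (q := q) hp.1] at hq'
  have hlog : ContDiffAt ℝ 2 (fun z => ((Real.log (‖coord q ((chartAt (Fin n → ℂ) p).symm z)
      (frame p ((chartAt (Fin n → ℂ) p).symm z) : L _)‖ ^ 2) : ℝ) : ℂ))
      (chartAt (Fin n → ℂ) p x) := by
    refine contDiffAt_ofReal (ContDiffAt.log ?_ (by positivity))
    exact ((hτ.restrict_scalars ℝ).norm_sq ℝ).of_le le_top
  rw [kahlerMatrix, complexHessian_congr hev, complexHessian_add
    (u := fun z => logNormSq h q (transition p q z)) _ hlog, complexHessian_comp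
    (hq'.of_le two_le_infty) hF, complexHessian_log_normSq (hτ.of_le le_top) hτ0,
    transition_apply_chart hp.1, add_zero, kahlerMatrix, transitionMatrix]
  · simp
  · exact (hq'.of_le two_le_infty).comp _ (hF.restrict_scalars ℝ)

theorem posDef_transition {h : ∀ x, L x → L x → ℂ} (hh : IsHermitianMetric n h) {p q x : X}
    (hp : x ∈ patch n L p) (hq : x ∈ patch n L q)
    (hG : (kahlerMatrix h q (chartAt (Fin n → ℂ) q x)).PosDef) :
    (kahlerMatrix h p (chartAt (Fin n → ℂ) p x)).PosDef := by
  rw [kahlerMatrix_transition hh hp hq]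
  set J := transitionMatrix n p q x with hJ
  have hJ0 : (J.map conj).det ≠ 0 := by
    have : (J.map conj).det = conj J.det := ((starRingEnd ℂ).map_det J).symm
    rw [this]
    simpa using det_transitionMatrix_ne_zero hp.1 hq.1
  have e : J.transpose = (J.map conj).conjTranspose := by
    ext i k; simp [Matrix.conjTranspose_apply]
  rw [e]
  exact hG.conjTranspose_mul_mul_same (Matrix.mulVec_injective_of_isUnit
    ((Matrix.isUnit_iff_isUnit_det _).2 (isUnit_iff_ne_zero.2 hJ0)))

/-- Positivity is invariant under congruence, so it need only be tested at each point in the chart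
centred there. -/
theorem mem_posMetrics_of_posDef_self {h : ∀ x, L x → L x → ℂ} (hh : IsHermitianMetric n h)
    (hG : ∀ x, (kahlerMatrix h x (chartAt (Fin n → ℂ) x x)).PosDef) : h ∈ posMetrics n L :=
  ⟨hh, fun _ x hx => posDef_transition hh hx (mem_patch_self x) (hG x)⟩

end Frames

/-! ### Conformal changes `e^φ h` of the metric -/

section Rescale

variable {n : ℕ} {X : Type*} [TopologicalSpace X] [ChartedSpace (Fin n → ℂ) X]
  [IsManifold 𝓘(ℂ, Fin n → ℂ) ω X]
  {L : X → Type*} [∀ x, AddCommGroup (L x)] [∀ x, Module ℂ (L x)]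
  [∀ x, TopologicalSpace (L x)] [TopologicalSpace (Bundle.TotalSpace ℂ L)]
  [FiberBundle ℂ L]

theorem rescale_zero (h : ∀ x, L x → L x → ℂ) : rescale (fun _ => 0) h = h := by
  ext x u v; simp [rescale]

theorem rescale_rescale (φ ψ : X → ℝ) (h : ∀ x, L x → L x → ℂ) :
    rescale φ (rescale ψ h) = rescale (fun x => φ x + ψ x) h := by
  ext x u v; simp [rescale, Complex.exp_add, mul_assoc]

theorem frameSq_rescale (φ : X → ℝ) (h : ∀ x, L x → L x → ℂ) (p x : X) :
    frameSq (rescale φ h) p x = Real.exp (φ x) * frameSq h p x := by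
  simp only [frameSq, rescale, Complex.re_ofReal_mul]

theorem isHermitianMetric_rescale {φ : X → ℝ} (hφ : ContMDiff 𝓘(ℝ, Fin n → ℂ) 𝓘(ℝ, ℝ) ∞ φ)
    {h : ∀ x, L x → L x → ℂ} (hh : IsHermitianMetric n h) :
    IsHermitianMetric n (rescale φ h) where
  add_right x u v w := by simp only [rescale, hh.add_right]; ring
  smul_right x c u v := by simp only [rescale, hh.smul_right]; ring
  conj_symm x u v := by simp only [rescale, map_mul, Complex.conj_ofReal, hh.conj_symm]
  pos x v hv := by
    rw [rescale, Complex.re_ofReal_mul]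
    exact mul_pos (Real.exp_pos _) (hh.pos x v hv)
  smooth p := by
    have : (fun x => (rescale φ h x (frame p x) (frame p x)).re) =
        fun x => Real.exp (φ x) * (h x (frame p x) (frame p x)).re :=
      funext fun x => frameSq_rescale φ h p x
    rw [this]
    exact ((Real.contDiff_exp.contMDiff.comp hφ).contMDiffOn).mul (hh.smooth p)

variable [VectorBundle ℂ ℂ L]

theorem kahlerMatrix_rescale {φ : X → ℝ} (hφ : ContMDiff 𝓘(ℝ, Fin n → ℂ) 𝓘(ℝ, ℝ) ∞ φ)
    {h : ∀ x, L x → L x → ℂ} (hh : IsHermitianMetric n h) {p x : X} (hx : x ∈ patch n L p) :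
    kahlerMatrix (rescale φ h) p (chartAt (Fin n → ℂ) p x) =
      kahlerMatrix h p (chartAt (Fin n → ℂ) p x) - chartHessian n φ p x := by
  have hev : logNormSq (rescale φ h) p =ᶠ[nhds (chartAt (Fin n → ℂ) p x)] fun z =>
      logNormSq h p z + (φ ((chartAt (Fin n → ℂ) p).symm z) : ℂ) := by
    filter_upwards [eventually_chart_symm_mem hx.1 ((patch_open p).mem_nhds hx)] with z hz
    rw [logNormSq_def, logNormSq_def, ← Complex.ofReal_add]
    simp only
    rw [frameSq_rescale, Real.log_mul (Real.exp_pos _).ne' (hh.frameSq_pos hz.2).ne', Real.log_exp,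
      add_comm]
  rw [kahlerMatrix, complexHessian_congr hev, complexHessian_add
    ((contDiffAt_logNormSq hh hx).of_le two_le_infty)
    (contDiffAt_ofReal ((contDiffAt_chart hx.1 (hφ x)).of_le two_le_infty)), kahlerMatrix,
    chartHessian]
  abel

theorem exists_rescale_eq {h k : ∀ x, L x → L x → ℂ} (hh : IsHermitianMetric n h)
    (hk : IsHermitianMetric n k) :
    ∃ φ : X → ℝ, ContMDiff 𝓘(ℝ, Fin n → ℂ) 𝓘(ℝ, ℝ) ∞ φ ∧ k = rescale φ h := by
  have key : ∀ p x, x ∈ (trivializationAt ℂ L p).baseSet →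
      frameSq k x x / frameSq h x x = frameSq k p x / frameSq h p x := by
    intro p x hx
    have hxx := FiberBundle.mem_baseSet_trivializationAt ℂ L x
    have h1 : frameSq h p x = _ := hh.re_self_eq hxx (frame p x)
    have h2 : frameSq k p x = _ := hk.re_self_eq hxx (frame p x)
    have h3 : ‖coord x x (frame p x : L x)‖ ^ 2 ≠ 0 :=
      pow_ne_zero 2 (norm_ne_zero_iff.2 (coord_ne_zero hxx (frame_ne_zero hx)))
    rw [h1, h2, mul_div_mul_left _ _ h3]
  -- As `L` has rank one, the ratio of the two norms is the same for every frame. Each point may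
  -- thus use its own frame in the definition, while smoothness near a point is read off in one
  -- fixed frame.
  refine ⟨fun x => Real.log (frameSq k x x / frameSq h x x), fun x => ?_, ?_⟩
  · have hx := FiberBundle.mem_baseSet_trivializationAt ℂ L x
    have h1 : ContMDiffAt 𝓘(ℝ, Fin n → ℂ) 𝓘(ℝ, ℝ) ∞
        (fun y => Real.log (frameSq k x y) - Real.log (frameSq h x y)) x :=
      ((Real.contDiffAt_log.2 (hk.frameSq_pos hx).ne').contMDiffAt.comp x
        (hk.contMDiffAt_frameSq hx)).sub
        ((Real.contDiffAt_log.2 (hh.frameSq_pos hx).ne').contMDiffAt.comp x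
        (hh.contMDiffAt_frameSq hx))
    refine h1.congr_of_eventuallyEq ?_
    filter_upwards [(trivializationAt ℂ L x).open_baseSet.mem_nhds hx] with y hy
    rw [key x y hy, Real.log_div (hk.frameSq_pos hy).ne' (hh.frameSq_pos hy).ne']
  · ext x u v
    have hx := FiberBundle.mem_baseSet_trivializationAt ℂ L x
    have h1 := hh.frameSq_pos hx
    rw [rescale, Real.exp_log (div_pos (hk.frameSq_pos hx) h1), hk.apply_eq hx, hh.apply_eq hx,
      Complex.ofReal_div]
    have : (frameSq h x x : ℂ) ≠ 0 := by exact_mod_cast h1.ne'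
    field_simp

variable [ContMDiffVectorBundle ω ℂ L 𝓘(ℂ, Fin n → ℂ)]

/-- The Kähler matrix of `e^(tφ) h` is affine in `t`, hence on `[0, 1]` a convex combination of
those of the two endpoints. The space of positive metrics is convex in this sense, so segments are
available as paths. -/
theorem rescale_mem_posMetrics_of_convex {φ : X → ℝ}
    (hφ : ContMDiff 𝓘(ℝ, Fin n → ℂ) 𝓘(ℝ, ℝ) ∞ φ) {h : ∀ x, L x → L x → ℂ}
    (h0 : h ∈ posMetrics n L) (h1 : rescale φ h ∈ posMetrics n L) {t : ℝ}
    (ht : t ∈ Set.Icc (0 : ℝ) 1) : rescale (fun x => t * φ x) h ∈ posMetrics n L := by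
  have hs : ContMDiff 𝓘(ℝ, Fin n → ℂ) 𝓘(ℝ, ℝ) ∞ (fun x => t * φ x) := contMDiff_const.mul hφ
  refine ⟨isHermitianMetric_rescale hs h0.1, fun p x hx => ?_⟩
  have e1 := h1.2 p x hx
  have e0 := h0.2 p x hx
  rw [kahlerMatrix_rescale hφ h0.1 hx] at e1
  rw [kahlerMatrix_rescale hs h0.1 hx]
  have e : chartHessian n (fun x => t * φ x) p x = (t : ℂ) • chartHessian n φ p x := by
    simp only [chartHessian, Complex.ofReal_mul]
    rw [complexHessian_const_mul]
  rw [e]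
  set G := kahlerMatrix h p (chartAt (Fin n → ℂ) p x)
  set U := chartHessian n φ p x
  have : G - (t : ℂ) • U = (1 - t : ℝ) • G + t • (G - U) := by
    ext i k; simp; ring
  rw [this]
  rcases eq_or_lt_of_le ht.1 with h | h
  · subst h; simpa using e0
  · exact Matrix.PosDef.posSemidef_add (e0.posSemidef.smul (sub_nonneg.2 ht.2)) (e1.smul h)

end Rescale

end BalancedMetrics

namespace BalancedMetrics

open MeasureTheory

/-! ### The volume measure: gluing, finiteness and positivity on open sets -/

section Volume

variable {n : ℕ} {X : Type*} [TopologicalSpace X] [ChartedSpace (Fin n → ℂ) X]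
  [IsManifold 𝓘(ℂ, Fin n → ℂ) ω X]
  {L : X → Type*} [∀ x, AddCommGroup (L x)] [∀ x, Module ℂ (L x)]
  [∀ x, TopologicalSpace (L x)] [TopologicalSpace (Bundle.TotalSpace ℂ L)]
  [FiberBundle ℂ L] [VectorBundle ℂ ℂ L] {h : ∀ x, L x → L x → ℂ}

theorem contDiffAt_kahlerMatrix (hh : IsHermitianMetric n h) {p x : X} (hx : x ∈ patch n L p)
    (i k : Fin n) :
    ContDiffAt ℝ 1 (fun z => kahlerMatrix h p z i k) (chartAt (Fin n → ℂ) p x) := by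
  refine ContDiffAt.neg ?_
  exact contDiffAt_wirtinger (m := 2) (contDiffAt_wirtingerBar
    ((contDiffAt_logNormSq hh hx).of_le three_le_infty) (by norm_num) k) (by norm_num) i

theorem continuousOn_density (hh : IsHermitianMetric n h) (p : X) :
    ContinuousOn (fun z => 2 ^ n * (kahlerMatrix h p z).det.re)
      (chartAt (Fin n → ℂ) p '' patch n L p) := by
  rintro _ ⟨x, hx, rfl⟩
  have h1 := (contDiffAt_det fun i k => contDiffAt_kahlerMatrix hh hx i k).continuousAt
  exact (continuousAt_const.mul (Complex.continuous_re.continuousAt.comp h1)).continuousWithinAt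

theorem density_pos (hh : h ∈ posMetrics n L) {p : X} {z : Fin n → ℂ}
    (hz : z ∈ chartAt (Fin n → ℂ) p '' patch n L p) :
    0 < 2 ^ n * (kahlerMatrix h p z).det.re := by
  obtain ⟨x, hx, rfl⟩ := hz
  have := (hh.2 p x hx).det_pos
  exact mul_pos (by positivity) (Complex.pos_iff.1 this).1

theorem chart_symm_mem_patch {p : X} {z : Fin n → ℂ}
    (hz : z ∈ chartAt (Fin n → ℂ) p '' patch n L p) :
    (chartAt (Fin n → ℂ) p).symm z ∈ patch n L p ∧
      chartAt (Fin n → ℂ) p ((chartAt (Fin n → ℂ) p).symm z) = z := by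
  obtain ⟨x, hx, rfl⟩ := hz
  rw [(chartAt (Fin n → ℂ) p).left_inv hx.1]
  exact ⟨hx, rfl⟩

theorem continuousOn_chart_symm_patch (p : X) : ContinuousOn (chartAt (Fin n → ℂ) p).symm
    (chartAt (Fin n → ℂ) p '' patch n L p) :=
  (chartAt (Fin n → ℂ) p).continuousOn_symm.mono (by
    rintro _ ⟨x, hx, rfl⟩; exact (chartAt (Fin n → ℂ) p).map_source hx.1)

theorem preimage_inter_image_patch {p : X} {A : Set X} (hA : A ⊆ patch n L p) :
    (chartAt (Fin n → ℂ) p).symm ⁻¹' A ∩ chartAt (Fin n → ℂ) p '' patch n L p =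
      chartAt (Fin n → ℂ) p '' A := by
  ext z
  constructor
  · rintro ⟨hz, hz'⟩
    exact ⟨_, hz, (chart_symm_mem_patch hz').2⟩
  · rintro ⟨x, hx, rfl⟩
    refine ⟨?_, x, hA hx, rfl⟩
    rw [Set.mem_preimage, (chartAt (Fin n → ℂ) p).left_inv (hA hx).1]
    exact hx

variable [MeasurableSpace X] [BorelSpace X]

theorem measurableSet_preimage_inter_patch (p : X) {A : Set X} (hA : MeasurableSet A) :
    MeasurableSet ((chartAt (Fin n → ℂ) p).symm ⁻¹' A ∩
      chartAt (Fin n → ℂ) p '' patch n L p) := by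
  have hΩ := (chart_image_patch_open (n := n) (L := L) p).measurableSet
  have h1 := (continuousOn_iff_continuous_domRestrict.1
    (continuousOn_chart_symm_patch (n := n) (L := L) p)).measurable hA
  have h2 := hΩ.subtype_image h1
  convert h2 using 1
  ext z
  simp [and_comm]

theorem aemeasurable_chart_symm (h : ∀ x, L x → L x → ℂ) (p : X) :
    AEMeasurable (chartAt (Fin n → ℂ) p).symm
      (((volume : Measure (Fin n → ℂ)).restrict
        (chartAt (Fin n → ℂ) p '' patch n L p)).withDensity
        fun z => ENNReal.ofReal (2 ^ n * (kahlerMatrix h p z).det.re)) :=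
  ((continuousOn_chart_symm_patch p).aemeasurable
    (chart_image_patch_open p).measurableSet).mono_ac (withDensity_absolutelyContinuous _ _)

theorem patchVolume_apply (p : X) {A : Set X} (hA : MeasurableSet A) :
    patchVolume (n := n) h p A = ∫⁻ z in (chartAt (Fin n → ℂ) p).symm ⁻¹' A ∩
      chartAt (Fin n → ℂ) p '' patch n L p,
        ENNReal.ofReal (2 ^ n * (kahlerMatrix h p z).det.re) := by
  rw [patchVolume, Measure.map_apply_of_aemeasurable (aemeasurable_chart_symm h p) hA,
    withDensity_apply', Measure.restrict_restrict' (chart_image_patch_open p).measurableSet]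

theorem patchVolume_inter_patch (p : X) {A : Set X} (hA : MeasurableSet A) :
    patchVolume (n := n) h p (A ∩ patch n L p) = patchVolume (n := n) h p A := by
  rw [patchVolume_apply p hA, patchVolume_apply p (hA.inter (patch_open p).measurableSet)]
  congr 2
  ext z
  constructor
  · rintro ⟨hz, hz'⟩; exact ⟨hz.1, hz'⟩
  · rintro ⟨hz, hz'⟩; exact ⟨⟨hz, (chart_symm_mem_patch hz').1⟩, hz'⟩

theorem abs_det_restrictScalars (T : (Fin n → ℂ) →L[ℂ] Fin n → ℂ) :
    |(T.restrictScalars ℝ).det| = Complex.normSq T.det := by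
  have : (T.restrictScalars ℝ).det = Complex.normSq T.det := by
    rw [ContinuousLinearMap.det, ContinuousLinearMap.det]
    change LinearMap.det ((T : (Fin n → ℂ) →ₗ[ℂ] Fin n → ℂ).restrictScalars ℝ) = _
    rw [LinearMap.det_restrictScalars, Algebra.norm_complex_apply]
  rw [this, abs_of_nonneg (Complex.normSq_nonneg _)]

variable [ContMDiffVectorBundle ω ℂ L 𝓘(ℂ, Fin n → ℂ)]

/-- The change of variables formula contributes the real Jacobian `|det J|²`, which is exactly the
factor between the determinants of the two Kähler matrices. -/
theorem patchVolume_eq_of_subset (hh : IsHermitianMetric n h) {p q : X} {A : Set X}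
    (hA : MeasurableSet A) (hp : A ⊆ patch n L p) (hq : A ⊆ patch n L q) :
    patchVolume (n := n) h p A = patchVolume (n := n) h q A := by
  have hS := measurableSet_preimage_inter_patch (n := n) (L := L) p hA
  rw [patchVolume_apply p hA, patchVolume_apply q hA]
  rw [preimage_inter_image_patch hp] at hS ⊢
  rw [preimage_inter_image_patch hq]
  have himg : chartAt (Fin n → ℂ) q '' A =
      transition (n := n) p q '' (chartAt (Fin n → ℂ) p '' A) := by
    rw [Set.image_image]
    exact Set.image_congr fun x hx => (transition_apply_chart (hp hx).1).symm
  have hinj : Set.InjOn (transition (n := n) p q) (chartAt (Fin n → ℂ) p '' A) := by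
    rintro _ ⟨x, hx, rfl⟩ _ ⟨y, hy, rfl⟩ hxy
    rw [transition_apply_chart (hp hx).1, transition_apply_chart (hp hy).1] at hxy
    rw [(chartAt (Fin n → ℂ) q).injOn (hq hx).1 (hq hy).1 hxy]
  have hder : ∀ z ∈ chartAt (Fin n → ℂ) p '' A, HasFDerivWithinAt (transition (n := n) p q)
      ((fderiv ℂ (transition (n := n) p q) z).restrictScalars ℝ)
      (chartAt (Fin n → ℂ) p '' A) z := by
    rintro _ ⟨x, hx, rfl⟩
    exact (((contDiffAt_transition (hp hx).1 (hq hx).1).differentiableAt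
      (by simp)).hasFDerivAt.restrictScalars ℝ).hasFDerivWithinAt
  rw [himg, lintegral_image_eq_lintegral_abs_det_fderiv_mul volume hS hder hinj]
  refine setLIntegral_congr_fun hS ?_
  rintro _ ⟨x, hx, rfl⟩
  simp only
  rw [abs_det_restrictScalars, ← ENNReal.ofReal_mul (Complex.normSq_nonneg _),
    transition_apply_chart (hp hx).1, kahlerMatrix_transition hh (hp hx) (hq hx), det_conj_mul,
    Complex.re_ofReal_mul, det_fderiv_eq, transitionMatrix]
  ring_nf

variable [CompactSpace X]

theorem exists_seq_patch_cover [Nonempty X] (n : ℕ) (L : X → Type*) [ChartedSpace (Fin n → ℂ) X]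
    [∀ x, AddCommGroup (L x)] [∀ x, Module ℂ (L x)]
    [∀ x, TopologicalSpace (L x)] [TopologicalSpace (Bundle.TotalSpace ℂ L)] [FiberBundle ℂ L] :
    ∃ p : ℕ → X, ⋃ i, patch n L (p i) = Set.univ := by
  obtain ⟨s, hs, hcov⟩ := countable_cover_nhds_of_sigmaCompact
    fun x => (patch_open (n := n) (L := L) x).mem_nhds (mem_patch_self x)
  have hne : s.Nonempty := by
    rw [Set.nonempty_iff_ne_empty]
    rintro rfl
    simp only [Set.mem_empty_iff_false, Set.iUnion_of_empty, Set.iUnion_empty] at hcov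
    exact Set.empty_ne_univ hcov
  obtain ⟨p, rfl⟩ := hs.exists_eq_range hne
  exact ⟨p, by rw [← hcov, Set.biUnion_range]⟩

/-- The supremum of measures is identified by an upper bound `ν`: cut `X` into countably many
disjoint pieces, each inside a patch, and use the patch volume on each. As patch volumes agree on
overlaps, `ν` agrees with every patch volume on its patch, so it dominates all of them and hence
their supremum. The opposite inequality is the definition of a supremum. -/
theorem volumeMeasure_eq_patchVolume [Nonempty X] (hh : IsHermitianMetric n h) {q : X} {A : Set X}
    (hA : MeasurableSet A) (hq : A ⊆ patch n L q) :
    volumeMeasure n h A = patchVolume (n := n) h q A := by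
  obtain ⟨p, hcov⟩ := exists_seq_patch_cover (X := X) n L
  set T := disjointed fun i => patch n L (p i) with hT
  have hTm : ∀ i, MeasurableSet (T i) :=
    fun i => MeasurableSet.disjointed (fun i => (patch_open (p i)).measurableSet) i
  have hTs : ∀ i, T i ⊆ patch n L (p i) := fun i => disjointed_subset _ i
  have hTd : Pairwise (Function.onFun Disjoint T) := disjoint_disjointed _
  have hTu : ⋃ i, T i = Set.univ := by rw [hT, iUnion_disjointed, hcov]
  set ν := Measure.sum fun i => (patchVolume (n := n) h (p i)).restrict (T i) with hν
  have hνA : ∀ B, MeasurableSet B → ν B = ∑' i, patchVolume (n := n) h (p i) (B ∩ T i) := by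
    intro B hB
    rw [hν, Measure.sum_apply _ hB]
    exact tsum_congr fun i => Measure.restrict_apply hB
  have hdec : ∀ (m : Measure X) B, MeasurableSet B → m B = ∑' i, m (B ∩ T i) := by
    intro m B hB
    rw [← measure_iUnion (fun i j hij => ((hTd hij).inter_left' _).inter_right' _)
      fun i => hB.inter (hTm i), ← Set.inter_iUnion, hTu, Set.inter_univ]
  have hνq : ∀ q B, MeasurableSet B → B ⊆ patch n L q → ν B = patchVolume (n := n) h q B := by
    intro q B hB hBq
    rw [hνA B hB, hdec _ B hB]
    exact tsum_congr fun i => patchVolume_eq_of_subset hh (hB.inter (hTm i))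
      (Set.inter_subset_right.trans (hTs i)) (Set.inter_subset_left.trans hBq)
  have hle : volumeMeasure n h ≤ ν := by
    refine iSup_le fun q => Measure.le_iff.2 fun B hB => ?_
    rw [← patchVolume_inter_patch q hB, ← hνq q _ (hB.inter (patch_open q).measurableSet)
      Set.inter_subset_right]
    exact measure_mono Set.inter_subset_left
  refine le_antisymm ((hle A).trans (hνq q A hA hq).le) ?_
  exact (le_iSup (fun p : X => patchVolume (n := n) h p) q) A

theorem restrict_patch_volumeMeasure [Nonempty X] (hh : IsHermitianMetric n h) (p : X) :
    (volumeMeasure n h).restrict (patch n L p) = patchVolume (n := n) h p := by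
  ext A hA
  rw [Measure.restrict_apply hA, volumeMeasure_eq_patchVolume hh
    (hA.inter (patch_open p).measurableSet) Set.inter_subset_right, patchVolume_inter_patch p hA]

theorem setIntegral_patch [Nonempty X] (hh : h ∈ posMetrics n L) (p : X) {f : X → ℝ}
    (hf : Continuous f) :
    ∫ x in patch n L p, f x ∂(volumeMeasure n h) =
      ∫ z in chartAt (Fin n → ℂ) p '' patch n L p,
        2 ^ n * (kahlerMatrix h p z).det.re * f ((chartAt (Fin n → ℂ) p).symm z) := by
  have hΩ := (chart_image_patch_open (n := n) (L := L) p).measurableSet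
  rw [restrict_patch_volumeMeasure hh.1, patchVolume,
    integral_map (aemeasurable_chart_symm h p) hf.aestronglyMeasurable,
    integral_withDensity_eq_integral_toReal_smul₀
      ((continuousOn_density hh.1 p).aemeasurable hΩ).ennreal_ofReal
      (Filter.Eventually.of_forall fun _ => ENNReal.ofReal_lt_top)]
  refine setIntegral_congr_fun hΩ fun z hz => ?_
  rw [ENNReal.toReal_ofReal (density_pos hh hz).le, smul_eq_mul]

theorem integral_eq_of_support [Nonempty X] (hh : h ∈ posMetrics n L) {p : X} {f : X → ℝ}
    (hf : Continuous f) (hs : ∀ x ∉ patch n L p, f x = 0) :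
    ∫ x, f x ∂(volumeMeasure n h) =
      ∫ z in chartAt (Fin n → ℂ) p '' patch n L p,
        2 ^ n * (kahlerMatrix h p z).det.re * f ((chartAt (Fin n → ℂ) p).symm z) := by
  rw [← setIntegral_patch hh p hf, setIntegral_eq_integral_of_forall_compl_eq_zero hs]

/-- The density is continuous, hence bounded on a closed coordinate ball, so the measure is locally
finite; compactness of `X` does the rest. -/
theorem isFiniteMeasure_volumeMeasure [Nonempty X] (hh : h ∈ posMetrics n L) :
    IsFiniteMeasure (volumeMeasure n h) := by
  have hloc : IsLocallyFiniteMeasure (volumeMeasure n h) := by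
    refine ⟨fun x => ?_⟩
    have hx := mem_patch_self (n := n) (L := L) x
    obtain ⟨r, hr, hball⟩ := Metric.nhds_basis_closedBall.mem_iff.1
      ((chart_image_patch_open (n := n) (L := L) x).mem_nhds ⟨x, hx, rfl⟩)
    have hcpt := isCompact_closedBall (chartAt (Fin n → ℂ) x x) r
    obtain ⟨C, hC⟩ := (hcpt.image_of_continuousOn
      ((continuousOn_density hh.1 x).mono hball)).bddAbove
    set U := patch n L x ∩ chartAt (Fin n → ℂ) x ⁻¹' Metric.ball (chartAt (Fin n → ℂ) x x) r
    have hU : IsOpen U := ((chartAt (Fin n → ℂ) x).continuousOn.mono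
      fun y hy => hy.1).isOpen_inter_preimage (patch_open x) Metric.isOpen_ball
    refine ⟨U, hU.mem_nhds ⟨hx, Metric.mem_ball_self hr⟩, ?_⟩
    rw [volumeMeasure_eq_patchVolume hh.1 hU.measurableSet Set.inter_subset_left,
      patchVolume_apply x hU.measurableSet]
    calc _ ≤ ∫⁻ z in Metric.closedBall (chartAt (Fin n → ℂ) x x) r,
          ENNReal.ofReal (2 ^ n * (kahlerMatrix h x z).det.re) := by
          refine lintegral_mono_set ?_
          rintro z ⟨hz, hz'⟩
          have := hz.2
          rw [Set.mem_preimage, (chart_symm_mem_patch hz').2] at this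
          exact Metric.ball_subset_closedBall this
      _ ≤ ∫⁻ z in Metric.closedBall (chartAt (Fin n → ℂ) x x) r, ENNReal.ofReal C :=
          setLIntegral_mono measurable_const fun z hz =>
            ENNReal.ofReal_le_ofReal (hC ⟨z, hz, rfl⟩)
      _ < ⊤ := by
          rw [setLIntegral_const]
          exact ENNReal.mul_lt_top ENNReal.ofReal_lt_top hcpt.measure_lt_top
  exact ⟨isCompact_univ.measure_lt_top⟩

theorem isOpenPosMeasure_volumeMeasure [Nonempty X] (hh : h ∈ posMetrics n L) :
    (volumeMeasure n h).IsOpenPosMeasure := by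
  refine ⟨fun U hU hne h0 => ?_⟩
  obtain ⟨x, hx⟩ := hne
  have hV := hU.inter (patch_open (n := n) (L := L) x)
  have h1 := measure_mono_null (Set.inter_subset_left (t := patch n L x)) h0
  rw [volumeMeasure_eq_patchVolume hh.1 hV.measurableSet Set.inter_subset_right,
    patchVolume_apply x hV.measurableSet, preimage_inter_image_patch Set.inter_subset_right] at h1
  have hS : IsOpen (chartAt (Fin n → ℂ) x '' (U ∩ patch n L x)) :=
    (chartAt (Fin n → ℂ) x).isOpen_image_of_subset_source hV fun _ h => h.2.1
  have hsub := Set.image_mono (f := chartAt (Fin n → ℂ) x)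
    (Set.inter_subset_right : U ∩ patch n L x ⊆ patch n L x)
  rw [lintegral_eq_zero_iff' (((continuousOn_density hh.1 x).mono hsub).aemeasurable
    hS.measurableSet).ennreal_ofReal] at h1
  have h2 : ∀ᵐ z ∂(volume : Measure (Fin n → ℂ)).restrict
      (chartAt (Fin n → ℂ) x '' (U ∩ patch n L x)), False := by
    filter_upwards [h1, ae_restrict_mem hS.measurableSet] with z hz hz'
    have := density_pos hh (hsub hz')
    simp only [Pi.zero_apply, ENNReal.ofReal_eq_zero] at hz
    exact absurd hz (not_le.2 this)
  rw [Filter.eventually_false_iff_eq_bot, ae_eq_bot, Measure.restrict_eq_zero] at h2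
  exact (hS.measure_pos volume ⟨_, x, ⟨hx, mem_patch_self x⟩, rfl⟩).ne' h2

end Volume

end BalancedMetrics

namespace BalancedMetrics

open MeasureTheory

/-! ### Complex Hessians of functions depending on a real parameter -/

section Slices

variable {n : ℕ}

/-- The Wirtinger derivative `∂/∂z_j` of a function on `ℝ × ℂⁿ`. -/
noncomputable def sliceWirtinger (j : Fin n) (F : ℝ × (Fin n → ℂ) → ℂ) (q : ℝ × (Fin n → ℂ)) : ℂ :=
  (fderiv ℝ F q (0, Pi.single j 1) - Complex.I * fderiv ℝ F q (0, Pi.single j Complex.I)) / 2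

/-- The Wirtinger derivative `∂/∂z̄_j` of a function on `ℝ × ℂⁿ`. -/
noncomputable def sliceWirtingerBar (j : Fin n) (F : ℝ × (Fin n → ℂ) → ℂ)
    (q : ℝ × (Fin n → ℂ)) : ℂ :=
  (fderiv ℝ F q (0, Pi.single j 1) + Complex.I * fderiv ℝ F q (0, Pi.single j Complex.I)) / 2

variable {F : ℝ × (Fin n → ℂ) → ℂ} {s : ℝ} {z : Fin n → ℂ}

theorem fderiv_slice_apply (hF : DifferentiableAt ℝ F (s, z)) (v : Fin n → ℂ) :
    fderiv ℝ (fun w => F (s, w)) z v = fderiv ℝ F (s, z) (0, v) := by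
  have h : HasFDerivAt (fun w => F (s, w)) _ z := hF.hasFDerivAt.comp z (hasFDerivAt_prodMk_right s z)
  rw [h.fderiv]; rfl

theorem hasDerivAt_slice {G : Type*} [NormedAddCommGroup G] [NormedSpace ℝ G]
    {F : ℝ × (Fin n → ℂ) → G} (hF : DifferentiableAt ℝ F (s, z)) :
    HasDerivAt (fun t => F (t, z)) (fderiv ℝ F (s, z) (1, 0)) s := by
  have h : HasFDerivAt (fun t => F (t, z)) _ s := hF.hasFDerivAt.comp s (hasFDerivAt_prodMk_left s z)
  exact h.hasDerivAt

theorem wirtinger_slice (hF : DifferentiableAt ℝ F (s, z)) (j : Fin n) :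
    wirtinger j (fun w => F (s, w)) z = sliceWirtinger j F (s, z) := by
  simp only [wirtinger, sliceWirtinger, fderiv_slice_apply hF]

theorem wirtingerBar_slice (hF : DifferentiableAt ℝ F (s, z)) (j : Fin n) :
    wirtingerBar j (fun w => F (s, w)) z = sliceWirtingerBar j F (s, z) := by
  simp only [wirtingerBar, sliceWirtingerBar, fderiv_slice_apply hF]

theorem contDiffAt_sliceWirtinger {m k : ℕ∞ω} {q : ℝ × (Fin n → ℂ)} (hF : ContDiffAt ℝ m F q)
    (h : k + 1 ≤ m) (j : Fin n) : ContDiffAt ℝ k (sliceWirtinger j F) q := by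
  have h1 := hF.fderiv_right h
  unfold sliceWirtinger
  exact ((h1.clm_apply contDiffAt_const).sub
    (contDiffAt_const.mul (h1.clm_apply contDiffAt_const))).div_const 2

theorem contDiffAt_sliceWirtingerBar {m k : ℕ∞ω} {q : ℝ × (Fin n → ℂ)} (hF : ContDiffAt ℝ m F q)
    (h : k + 1 ≤ m) (j : Fin n) : ContDiffAt ℝ k (sliceWirtingerBar j F) q := by
  have h1 := hF.fderiv_right h
  unfold sliceWirtingerBar
  exact ((h1.clm_apply contDiffAt_const).add
    (contDiffAt_const.mul (h1.clm_apply contDiffAt_const))).div_const 2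

/-- Expresses the Hessian of a slice through derivatives on `ℝ × ℂⁿ`, so that smoothness in the
parameter and the point jointly can be used. -/
theorem complexHessian_slice (hF : ContDiffAt ℝ 2 F (s, z)) (j k : Fin n) :
    complexHessian (fun w => F (s, w)) z j k =
      sliceWirtinger j (sliceWirtingerBar k F) (s, z) := by
  have h1 : (fun w => wirtingerBar k (fun w => F (s, w)) w) =ᶠ[nhds z]
      fun w => sliceWirtingerBar k F (s, w) := by
    have h2 : ∀ᶠ q in nhds (s, z), DifferentiableAt ℝ F q := by
      filter_upwards [hF.eventually (by simp)] with w hw using hw.differentiableAt (by simp)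
    have h3 : Filter.Tendsto (fun w : Fin n → ℂ => (s, w)) (nhds z) (nhds (s, z)) :=
      (Continuous.prodMk_right s).continuousAt
    filter_upwards [h3.eventually h2] with w hw using wirtingerBar_slice hw k
  simp only [complexHessian, Matrix.of_apply]
  rw [wirtinger_congr h1]
  exact wirtinger_slice ((contDiffAt_sliceWirtingerBar (k := 1) hF (by norm_num) k).differentiableAt
    (by simp)) j

theorem fderiv_fderiv_comm {E : Type*} [NormedAddCommGroup E] [NormedSpace ℝ E] {f : E → ℂ} {q : E}
    (hf : ContDiffAt ℝ 2 f q) (v w : E) :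
    fderiv ℝ (fun y => fderiv ℝ f y v) q w = fderiv ℝ (fun y => fderiv ℝ f y w) q v := by
  have h1 : DifferentiableAt ℝ (fderiv ℝ f) q :=
    (hf.fderiv_right (m := 1) (by norm_num)).differentiableAt (by simp)
  have key : ∀ a b, fderiv ℝ (fun y => fderiv ℝ f y a) q b = fderiv ℝ (fderiv ℝ f) q b a := by
    intro a b
    rw [(h1.hasFDerivAt.clm_apply (hasFDerivAt_const a q)).fderiv]
    simp
  rw [key, key, (hf.isSymmSndFDerivAt (by simp)).eq]

theorem fderiv_half_apply {E : Type*} [NormedAddCommGroup E] [NormedSpace ℝ E] {f g : E → ℂ} {q : E}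
    (hf : DifferentiableAt ℝ f q) (hg : DifferentiableAt ℝ g q) (c : ℂ) (v : E) :
    fderiv ℝ (fun y => (f y + c * g y) / 2) q v =
      (fderiv ℝ f q v + c * fderiv ℝ g q v) / 2 := by
  have h : HasFDerivAt (fun y => (f y + c * g y) / 2) _ q :=
    (hf.hasFDerivAt.add (hg.hasFDerivAt.const_mul c)).mul_const 2⁻¹
  rw [h.fderiv]
  simp; ring

theorem fderiv_sliceWirtinger_comm {q : ℝ × (Fin n → ℂ)} (hF : ContDiffAt ℝ 2 F q) (j : Fin n)
    (v : ℝ × (Fin n → ℂ)) :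
    fderiv ℝ (sliceWirtinger j F) q v = sliceWirtinger j (fun y => fderiv ℝ F y v) q := by
  have h1 : DifferentiableAt ℝ (fderiv ℝ F) q :=
    (hF.fderiv_right (m := 1) (by norm_num)).differentiableAt (by simp)
  have e : sliceWirtinger j F = fun y => (fderiv ℝ F y (0, Pi.single j 1) +
      (-Complex.I) * fderiv ℝ F y (0, Pi.single j Complex.I)) / 2 := by
    ext y; simp only [sliceWirtinger]; ring
  rw [e, fderiv_half_apply (h1.clm_apply (differentiableAt_const _))
    (h1.clm_apply (differentiableAt_const _)), fderiv_fderiv_comm hF (0, Pi.single j 1) v,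
    fderiv_fderiv_comm hF (0, Pi.single j Complex.I) v,
    sliceWirtinger]
  ring

theorem fderiv_sliceWirtingerBar_comm {q : ℝ × (Fin n → ℂ)} (hF : ContDiffAt ℝ 2 F q) (j : Fin n)
    (v : ℝ × (Fin n → ℂ)) :
    fderiv ℝ (sliceWirtingerBar j F) q v = sliceWirtingerBar j (fun y => fderiv ℝ F y v) q := by
  have h1 : DifferentiableAt ℝ (fderiv ℝ F) q :=
    (hF.fderiv_right (m := 1) (by norm_num)).differentiableAt (by simp)
  unfold sliceWirtingerBar
  rw [fderiv_half_apply (h1.clm_apply (differentiableAt_const _))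
    (h1.clm_apply (differentiableAt_const _)), fderiv_fderiv_comm hF (0, Pi.single j 1) v,
    fderiv_fderiv_comm hF (0, Pi.single j Complex.I) v]

/-- Derivatives in the parameter and in space commute; the symmetry of second derivatives is used
twice, once for each Wirtinger derivative. -/
theorem hasDerivAt_sliceHessian (hF : ContDiffAt ℝ 3 F (s, z)) (j k : Fin n) :
    HasDerivAt (fun t => sliceWirtinger j (sliceWirtingerBar k F) (t, z))
      (sliceWirtinger j (sliceWirtingerBar k fun q => fderiv ℝ F q (1, 0)) (s, z)) s := by
  have h1 := contDiffAt_sliceWirtingerBar (k := 2) hF (by norm_num) k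
  have h2 := contDiffAt_sliceWirtinger (k := 1) h1 (by norm_num) j
  have h3 := hasDerivAt_slice (h2.differentiableAt (by simp))
  rw [fderiv_sliceWirtinger_comm h1] at h3
  have h4 : (fun y => fderiv ℝ (sliceWirtingerBar k F) y (1, 0)) =ᶠ[nhds (s, z)]
      sliceWirtingerBar k fun q => fderiv ℝ F q (1, 0) := by
    filter_upwards [(hF.of_le (m := 2) (by norm_num)).eventually (by simp)] with y hy
      using fderiv_sliceWirtingerBar_comm hy k _
  have h5 : sliceWirtinger j (fun y => fderiv ℝ (sliceWirtingerBar k F) y (1, 0)) (s, z) =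
      sliceWirtinger j (sliceWirtingerBar k fun q => fderiv ℝ F q (1, 0)) (s, z) := by
    unfold sliceWirtinger
    rw [h4.fderiv_eq]
  rwa [h5] at h3

end Slices

/-! ### Smooth paths of functions on `X` -/

section Paths

variable {n : ℕ} {X : Type*} [TopologicalSpace X] [ChartedSpace (Fin n → ℂ) X]

/-- `ψ_t`, `a < t < b`, is a smooth path of smooth functions. -/
def SmoothPath (n : ℕ) {X : Type*} [TopologicalSpace X] [ChartedSpace (Fin n → ℂ) X]
    (a b : ℝ) (ψ : ℝ → X → ℝ) : Prop :=
  ContMDiffOn (𝓘(ℝ, ℝ).prod 𝓘(ℝ, Fin n → ℂ)) 𝓘(ℝ, ℝ) ∞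
      (fun q : ℝ × X => ψ q.1 q.2) (Set.Ioo a b ×ˢ Set.univ)

/-- The derivative of a path of functions. -/
noncomputable def pathDeriv (ψ : ℝ → X → ℝ) (s : ℝ) (x : X) : ℝ := deriv (fun t => ψ t x) s

theorem smoothPath_mul {a b : ℝ} {σ : ℝ → ℝ} (hσ : ContDiff ℝ ∞ σ) {u : X → ℝ}
    (hu : ContMDiff 𝓘(ℝ, Fin n → ℂ) 𝓘(ℝ, ℝ) ∞ u) : SmoothPath n a b fun t x => σ t * u x :=
  ((hσ.contMDiff.comp contMDiff_fst).mul (hu.comp contMDiff_snd)).contMDiffOn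

theorem smoothPath_const {a b : ℝ} {u : X → ℝ}
    (hu : ContMDiff 𝓘(ℝ, Fin n → ℂ) 𝓘(ℝ, ℝ) ∞ u) : SmoothPath n a b fun _ => u :=
  (hu.comp contMDiff_snd).contMDiffOn

variable {a b : ℝ} {ψ : ℝ → X → ℝ} (hψ : SmoothPath n a b ψ) {s : ℝ} (hs : s ∈ Set.Ioo a b)

include hψ hs

theorem SmoothPath.contMDiffAt (x : X) : ContMDiffAt (𝓘(ℝ, ℝ).prod 𝓘(ℝ, Fin n → ℂ)) 𝓘(ℝ, ℝ) ∞
    (fun q : ℝ × X => ψ q.1 q.2) (s, x) :=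
  ContMDiffOn.contMDiffAt hψ (prod_mem_nhds (isOpen_Ioo.mem_nhds hs) Filter.univ_mem)

theorem SmoothPath.slice : ContMDiff 𝓘(ℝ, Fin n → ℂ) 𝓘(ℝ, ℝ) ∞ (ψ s) := fun x =>
  (hψ.contMDiffAt hs x).comp x (contMDiffAt_const.prodMk contMDiffAt_id)

theorem SmoothPath.continuousAt (x : X) : ContinuousAt (fun q : ℝ × X => ψ q.1 q.2) (s, x) :=
  (hψ.contMDiffAt hs x).continuousAt

variable [IsManifold 𝓘(ℂ, Fin n → ℂ) ω X]

theorem SmoothPath.contDiffAt_chart {p x : X} (hx : x ∈ (chartAt (Fin n → ℂ) p).source) :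
    ContDiffAt ℝ ∞ (fun q : ℝ × (Fin n → ℂ) => ψ q.1 ((chartAt (Fin n → ℂ) p).symm q.2))
      (s, chartAt (Fin n → ℂ) p x) := by
  have : IsManifold 𝓘(ℝ, Fin n → ℂ) ∞ X := isManifold_real
  rw [← contMDiffAt_iff_contDiffAt]
  have h1 : ContMDiffAt 𝓘(ℝ, Fin n → ℂ) 𝓘(ℝ, Fin n → ℂ) ∞ (chartAt (Fin n → ℂ) p).symm
      (chartAt (Fin n → ℂ) p x) :=
    (contMDiffOn_chart_symm (I := 𝓘(ℝ, Fin n → ℂ)) (x := p)).contMDiffAt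
      ((chartAt (Fin n → ℂ) p).open_target.mem_nhds ((chartAt (Fin n → ℂ) p).map_source hx))
  have h2 : ContMDiffAt 𝓘(ℝ, ℝ × (Fin n → ℂ)) 𝓘(ℝ, Fin n → ℂ) ∞
      (fun q : ℝ × (Fin n → ℂ) => (chartAt (Fin n → ℂ) p).symm q.2)
      (s, chartAt (Fin n → ℂ) p x) :=
    h1.comp (s, chartAt (Fin n → ℂ) p x) contDiffAt_snd.contMDiffAt
  have h3 : ContMDiffAt 𝓘(ℝ, ℝ × (Fin n → ℂ)) 𝓘(ℝ, ℝ) ∞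
      (fun q : ℝ × (Fin n → ℂ) => q.1) (s, chartAt (Fin n → ℂ) p x) :=
    contDiffAt_fst.contMDiffAt
  have h4 := hψ.contMDiffAt hs x
  have h5 : (s, x) = (s, (chartAt (Fin n → ℂ) p).symm (chartAt (Fin n → ℂ) p x)) := by
    rw [(chartAt (Fin n → ℂ) p).left_inv hx]
  rw [h5] at h4
  exact h4.comp (s, chartAt (Fin n → ℂ) p x) (h3.prodMk h2)

theorem SmoothPath.contDiffAt_chart_ofReal {p x : X}
    (hx : x ∈ (chartAt (Fin n → ℂ) p).source) :
    ContDiffAt ℝ ∞ (fun q : ℝ × (Fin n → ℂ) => (ψ q.1 ((chartAt (Fin n → ℂ) p).symm q.2) : ℂ))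
      (s, chartAt (Fin n → ℂ) p x) :=
  Complex.ofRealCLM.contDiff.contDiffAt.comp _ (hψ.contDiffAt_chart hs hx)

theorem SmoothPath.hasDerivAt (x : X) : HasDerivAt (fun t => ψ t x) (pathDeriv ψ s x) s := by
  have h1 := (hψ.contMDiffAt hs x).comp s (contMDiffAt_id.prodMk contMDiffAt_const)
  exact ((contMDiffAt_iff_contDiffAt.1 h1).differentiableAt (by simp)).hasDerivAt

theorem SmoothPath.pathDeriv_eq {p x : X} (hx : x ∈ (chartAt (Fin n → ℂ) p).source) :
    pathDeriv ψ s x = fderiv ℝ (fun q : ℝ × (Fin n → ℂ) =>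
      ψ q.1 ((chartAt (Fin n → ℂ) p).symm q.2)) (s, chartAt (Fin n → ℂ) p x) (1, 0) := by
  have h1 := hasDerivAt_slice ((hψ.contDiffAt_chart hs hx).differentiableAt (by simp))
  simp only [(chartAt (Fin n → ℂ) p).left_inv hx] at h1
  exact (hψ.hasDerivAt hs x).unique h1

theorem SmoothPath.pathDeriv_ofReal_eq {p x : X} (hx : x ∈ (chartAt (Fin n → ℂ) p).source) :
    (pathDeriv ψ s x : ℂ) = fderiv ℝ (fun q : ℝ × (Fin n → ℂ) =>
      (ψ q.1 ((chartAt (Fin n → ℂ) p).symm q.2) : ℂ)) (s, chartAt (Fin n → ℂ) p x) (1, 0) := by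
  have h1 := hasDerivAt_slice ((hψ.contDiffAt_chart_ofReal hs hx).differentiableAt (by simp))
  simp only [(chartAt (Fin n → ℂ) p).left_inv hx] at h1
  exact (hψ.hasDerivAt hs x).ofReal_comp.unique h1

omit hs in
theorem SmoothPath.pathDeriv : SmoothPath n a b (pathDeriv ψ) := by
  have : IsManifold 𝓘(ℝ, Fin n → ℂ) ∞ X := isManifold_real
  rintro ⟨s, x⟩ ⟨hs, -⟩
  refine ContMDiffAt.contMDiffWithinAt ?_
  have hx := mem_chart_source (Fin n → ℂ) x
  have h1 : ContDiffAt ℝ ∞ (fun y => fderiv ℝ (fun q : ℝ × (Fin n → ℂ) =>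
      ψ q.1 ((chartAt (Fin n → ℂ) x).symm q.2)) y (1, 0)) (s, chartAt (Fin n → ℂ) x x) :=
    ((hψ.contDiffAt_chart hs hx).fderiv_right (m := ∞) (by simp)).clm_apply contDiffAt_const
  have h2 : ContMDiffAt (𝓘(ℝ, ℝ).prod 𝓘(ℝ, Fin n → ℂ)) 𝓘(ℝ, ℝ × (Fin n → ℂ)) ∞
      (fun q : ℝ × X => (q.1, chartAt (Fin n → ℂ) x q.2)) (s, x) := by
    refine contMDiffAt_fst.prodMk_space (ContMDiffAt.comp (I' := 𝓘(ℝ, Fin n → ℂ))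
      (s, x) ?_ contMDiffAt_snd)
    exact (contMDiffOn_chart (I := 𝓘(ℝ, Fin n → ℂ)) (x := x)).contMDiffAt
      ((chartAt (Fin n → ℂ) x).open_source.mem_nhds hx)
  refine (h1.contMDiffAt.comp (s, x) h2).congr_of_eventuallyEq ?_
  filter_upwards [prod_mem_nhds (isOpen_Ioo.mem_nhds hs)
    ((chartAt (Fin n → ℂ) x).open_source.mem_nhds hx)] with q hq
  exact hψ.pathDeriv_eq hq.1 hq.2

theorem SmoothPath.chartHessian_eq {p x : X} (hx : x ∈ (chartAt (Fin n → ℂ) p).source)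
    (j k : Fin n) : chartHessian n (ψ s) p x j k =
      sliceWirtinger j (sliceWirtingerBar k fun q : ℝ × (Fin n → ℂ) =>
        (ψ q.1 ((chartAt (Fin n → ℂ) p).symm q.2) : ℂ)) (s, chartAt (Fin n → ℂ) p x) :=
  complexHessian_slice ((hψ.contDiffAt_chart_ofReal hs hx).of_le two_le_infty) j k

theorem SmoothPath.continuousAt_chartHessian {p x : X}
    (hx : x ∈ (chartAt (Fin n → ℂ) p).source) :
    ContinuousAt (fun q : ℝ × X => chartHessian n (ψ q.1) p q.2) (s, x) := by
  refine continuousAt_pi.2 fun j => continuousAt_pi.2 fun k => ?_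
  have h1 := contDiffAt_sliceWirtinger (k := 1) (contDiffAt_sliceWirtingerBar (k := 2)
    ((hψ.contDiffAt_chart_ofReal hs hx).of_le three_le_infty) (by norm_num) k) (by norm_num) j
  have h2 : ContinuousAt (fun q : ℝ × X => (q.1, chartAt (Fin n → ℂ) p q.2)) (s, x) :=
    continuousAt_fst.prodMk (((chartAt (Fin n → ℂ) p).continuousAt hx).comp continuousAt_snd)
  refine (ContinuousAt.comp (f := fun q : ℝ × X => (q.1, chartAt (Fin n → ℂ) p q.2)) (x := (s, x))
    h1.continuousAt h2).congr ?_
  filter_upwards [prod_mem_nhds (isOpen_Ioo.mem_nhds hs)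
    ((chartAt (Fin n → ℂ) p).open_source.mem_nhds hx)] with q hq
  exact (hψ.chartHessian_eq hq.1 hq.2 j k).symm

theorem SmoothPath.hasDerivAt_chartHessian {p x : X}
    (hx : x ∈ (chartAt (Fin n → ℂ) p).source) (j k : Fin n) :
    HasDerivAt (fun t => chartHessian n (ψ t) p x j k)
      (chartHessian n (BalancedMetrics.pathDeriv ψ s) p x j k) s := by
  have h1 := hasDerivAt_sliceHessian ((hψ.contDiffAt_chart_ofReal hs hx).of_le three_le_infty) j k
  rw [hψ.pathDeriv.chartHessian_eq hs hx]
  -- The identification holds only for times in the open interval and points in the target of the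
  -- chart. A neighbourhood is enough, because the slice derivatives are local.
  have h2 : (fun q : ℝ × (Fin n → ℂ) =>
      (BalancedMetrics.pathDeriv ψ q.1 ((chartAt (Fin n → ℂ) p).symm q.2) : ℂ))
      =ᶠ[nhds (s, chartAt (Fin n → ℂ) p x)] fun y => fderiv ℝ (fun q : ℝ × (Fin n → ℂ) =>
      (ψ q.1 ((chartAt (Fin n → ℂ) p).symm q.2) : ℂ)) y (1, 0) := by
    filter_upwards [prod_mem_nhds (isOpen_Ioo.mem_nhds hs)
      ((chartAt (Fin n → ℂ) p).open_target.mem_nhds ((chartAt (Fin n → ℂ) p).map_source hx))]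
      with q hq
    rw [hψ.pathDeriv_ofReal_eq hq.1 ((chartAt (Fin n → ℂ) p).map_target hq.2),
      (chartAt (Fin n → ℂ) p).right_inv hq.2]
  have h3 : sliceWirtinger j (sliceWirtingerBar k fun q : ℝ × (Fin n → ℂ) =>
      (BalancedMetrics.pathDeriv ψ q.1 ((chartAt (Fin n → ℂ) p).symm q.2) : ℂ))
      (s, chartAt (Fin n → ℂ) p x) = sliceWirtinger j (sliceWirtingerBar k fun y =>
      fderiv ℝ (fun q : ℝ × (Fin n → ℂ) =>
      (ψ q.1 ((chartAt (Fin n → ℂ) p).symm q.2) : ℂ)) y (1, 0)) (s, chartAt (Fin n → ℂ) p x) := by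
    have h4 : sliceWirtingerBar k (fun q : ℝ × (Fin n → ℂ) =>
      (BalancedMetrics.pathDeriv ψ q.1 ((chartAt (Fin n → ℂ) p).symm q.2) : ℂ))
      =ᶠ[nhds (s, chartAt (Fin n → ℂ) p x)] sliceWirtingerBar k fun y =>
      fderiv ℝ (fun q : ℝ × (Fin n → ℂ) =>
      (ψ q.1 ((chartAt (Fin n → ℂ) p).symm q.2) : ℂ)) y (1, 0) := by
      filter_upwards [h2.eventuallyEq_nhds] with y hy
      simp only [sliceWirtingerBar, hy.fderiv_eq]
    simp only [sliceWirtinger, h4.fderiv_eq]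
  rw [h3]
  refine h1.congr_of_eventuallyEq ?_
  filter_upwards [isOpen_Ioo.mem_nhds hs] with t ht using hψ.chartHessian_eq ht hx j k

end Paths

/-! ### Differentiation under the integral over a compact space -/

section ParametricIntegral

/-- On a compact neighbourhood of `s` times the compact space `K` the derivative is bounded by a
constant, which is integrable for a finite measure and serves as the dominating function. -/
theorem hasDerivAt_integral_of_continuousOn {K : Type*} [TopologicalSpace K] [CompactSpace K]
    [MeasurableSpace K] [BorelSpace K] [SecondCountableTopology K] {ν : Measure K}
    [IsFiniteMeasure ν] {a b : ℝ}
    {F F' : ℝ → K → ℝ} (hF : ContinuousOn (fun q : ℝ × K => F q.1 q.2) (Set.Ioo a b ×ˢ Set.univ))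
    (hF' : ContinuousOn (fun q : ℝ × K => F' q.1 q.2) (Set.Ioo a b ×ˢ Set.univ))
    (hder : ∀ s ∈ Set.Ioo a b, ∀ x, HasDerivAt (fun t => F t x) (F' s x) s) {s : ℝ}
    (hs : s ∈ Set.Ioo a b) :
    HasDerivAt (fun t => ∫ x, F t x ∂ν) (∫ x, F' s x ∂ν) s := by
  have slice : ∀ {G : ℝ → K → ℝ}, ContinuousOn (fun q : ℝ × K => G q.1 q.2)
      (Set.Ioo a b ×ˢ Set.univ) → ∀ t ∈ Set.Ioo a b, Continuous (G t) := by
    intro G hG t ht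
    exact hG.comp_continuous (Continuous.prodMk_right t) fun x => ⟨ht, trivial⟩
  obtain ⟨ε, hε, hball⟩ := Metric.nhds_basis_closedBall.mem_iff.1 (isOpen_Ioo.mem_nhds hs)
  obtain ⟨C, hC⟩ := ((isCompact_closedBall s ε).prod isCompact_univ).exists_bound_of_continuousOn
    (hF'.mono (Set.prod_mono hball subset_rfl))
  have hint : ∀ {f : K → ℝ}, Continuous f → Integrable f ν := fun hf =>
    hf.integrable_of_hasCompactSupport (HasCompactSupport.of_compactSpace _)
  refine (hasDerivAt_integral_of_dominated_loc_of_deriv_le (F := F) (bound := fun _ => C)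
    (Metric.closedBall_mem_nhds s hε) ?_ (hint (slice hF s hs))
    (slice hF' s hs).aestronglyMeasurable ?_ (integrable_const C) ?_).2
  · filter_upwards [isOpen_Ioo.mem_nhds hs] with t ht using (slice hF t ht).aestronglyMeasurable
  · exact Filter.Eventually.of_forall fun x t ht => hC (t, x) ⟨ht, trivial⟩
  · exact Filter.Eventually.of_forall fun x t ht => hder t (hball ht) x

end ParametricIntegral

end BalancedMetrics

namespace BalancedMetrics

open MeasureTheory

/-! ### Densities of volume forms and Laplacians along a segment of metrics -/

section RelativeVolume

/-- The density of the volume form of `e^{tψ} h` with respect to that of `h`, computed in the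
coordinates centred at `p`. -/
noncomputable def relVol (n : ℕ) {X : Type*} [TopologicalSpace X]
    [ChartedSpace (Fin n → ℂ) X] {L : X → Type*} [∀ x, AddCommGroup (L x)]
    [∀ x, Module ℂ (L x)] [∀ x, TopologicalSpace (L x)]
    [TopologicalSpace (Bundle.TotalSpace ℂ L)] [FiberBundle ℂ L]
    (h : ∀ x, L x → L x → ℂ) (t : ℝ) (ψ : X → ℝ) (p x : X) : ℝ :=
  (kahlerMatrix h p (chartAt (Fin n → ℂ) p x) - (t : ℂ) • chartHessian n ψ p x).det.re /
    (kahlerMatrix h p (chartAt (Fin n → ℂ) p x)).det.re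

/-- The density of the `(n, n)`-form `i ∂∂̄u ∧ ω^{n-1} / (n-1)!` with respect to the volume form of
`h`, where `ω` is the form of `e^{tψ} h`, computed in the coordinates centred at `p`. -/
noncomputable def relLap (n : ℕ) {X : Type*} [TopologicalSpace X]
    [ChartedSpace (Fin n → ℂ) X] {L : X → Type*} [∀ x, AddCommGroup (L x)]
    [∀ x, Module ℂ (L x)] [∀ x, TopologicalSpace (L x)]
    [TopologicalSpace (Bundle.TotalSpace ℂ L)] [FiberBundle ℂ L]
    (h : ∀ x, L x → L x → ℂ) (t : ℝ) (ψ u : X → ℝ) (p x : X) : ℝ :=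
  ((kahlerMatrix h p (chartAt (Fin n → ℂ) p x) - (t : ℂ) • chartHessian n ψ p x).adjugate *
    chartHessian n u p x).trace.re / (kahlerMatrix h p (chartAt (Fin n → ℂ) p x)).det.re

/-- The Laplacian of the form `ω_h`. -/
noncomputable def laplacian (n : ℕ) {X : Type*} [TopologicalSpace X]
    [ChartedSpace (Fin n → ℂ) X] {L : X → Type*} [∀ x, AddCommGroup (L x)]
    [∀ x, Module ℂ (L x)] [∀ x, TopologicalSpace (L x)]
    [TopologicalSpace (Bundle.TotalSpace ℂ L)] [FiberBundle ℂ L]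
    (h : ∀ x, L x → L x → ℂ) (u : X → ℝ) (p x : X) : ℝ :=
  relLap n h 0 (fun _ => 0) u p x

variable {n : ℕ} {X : Type*} [TopologicalSpace X] [ChartedSpace (Fin n → ℂ) X]
  {L : X → Type*} [∀ x, AddCommGroup (L x)] [∀ x, Module ℂ (L x)]
  [∀ x, TopologicalSpace (L x)] [TopologicalSpace (Bundle.TotalSpace ℂ L)]
  [FiberBundle ℂ L] {h : ∀ x, L x → L x → ℂ}

theorem det_re_pos (hh : h ∈ posMetrics n L) {p x : X} (hx : x ∈ patch n L p) :
    0 < (kahlerMatrix h p (chartAt (Fin n → ℂ) p x)).det.re :=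
  (Complex.pos_iff.1 (hh.2 p x hx).det_pos).1

theorem laplacian_eq (h : ∀ x, L x → L x → ℂ) (u : X → ℝ) (p x : X) : laplacian n h u p x =
    ((kahlerMatrix h p (chartAt (Fin n → ℂ) p x)).adjugate * chartHessian n u p x).trace.re /
      (kahlerMatrix h p (chartAt (Fin n → ℂ) p x)).det.re := by
  simp [laplacian, relLap]

theorem relVol_zero (hh : h ∈ posMetrics n L) (ψ : X → ℝ) (x : X) : relVol n h 0 ψ x x = 1 := by
  have := det_re_pos hh (mem_patch_self x)
  simp [relVol, this.ne']

theorem chartHessian_congr {u v : X → ℝ} {p x : X} (hx : x ∈ (chartAt (Fin n → ℂ) p).source)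
    (huv : u =ᶠ[nhds x] v) : chartHessian n u p x = chartHessian n v p x := by
  refine complexHessian_congr ?_
  filter_upwards [eventually_chart_symm_mem hx huv] with z hz
  have hz' : u _ = v _ := hz
  rw [hz']

theorem chartHessian_const (c : ℝ) (p x : X) : chartHessian n (fun _ => c) p x = 0 := by
  ext j k
  simp [chartHessian, complexHessian, wirtinger, wirtingerBar]

theorem laplacian_const (c : ℝ) (p x : X) : laplacian n h (fun _ => c) p x = 0 := by
  rw [laplacian_eq, chartHessian_const]
  simp

variable [IsManifold 𝓘(ℂ, Fin n → ℂ) ω X] [VectorBundle ℂ ℂ L]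

/-- This is `i∂∂̄u ∧ ω_t^(n-1) / (n-1)! = (Δ_t u) ω_t^n / n!`, with both sides divided by the volume
form of `h`. The left side makes sense for all real `t`; the Laplacian requires `ω_t` to be
positive. -/
theorem relLap_eq {ψ : X → ℝ} (hψ : ContMDiff 𝓘(ℝ, Fin n → ℂ) 𝓘(ℝ, ℝ) ∞ ψ)
    (hh : h ∈ posMetrics n L) {t : ℝ} (hk : rescale (fun x => t * ψ x) h ∈ posMetrics n L)
    (u : X → ℝ) {p x : X} (hx : x ∈ patch n L p) :
    relLap n h t ψ u p x = relVol n h t ψ p x *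
      laplacian n (rescale (fun x => t * ψ x) h) u p x := by
  have hs : ContMDiff 𝓘(ℝ, Fin n → ℂ) 𝓘(ℝ, ℝ) ∞ (fun x => t * ψ x) := contMDiff_const.mul hψ
  have e : chartHessian n (fun x => t * ψ x) p x = (t : ℂ) • chartHessian n ψ p x := by
    simp only [chartHessian, Complex.ofReal_mul]
    rw [complexHessian_const_mul]
  have h1 := det_re_pos hk hx
  have h2 := det_re_pos hh hx
  rw [laplacian_eq, relLap, relVol]
  rw [kahlerMatrix_rescale hs hh.1 hx, e] at h1 ⊢
  field_simp

theorem hasDerivAt_re_det_div {A : ℝ → Matrix (Fin n) (Fin n) ℂ} {A' : Matrix (Fin n) (Fin n) ℂ}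
    {t : ℝ} (hA : ∀ i k, HasDerivAt (fun x => A x i k) (A' i k) t) (c : ℝ) :
    HasDerivAt (fun x => (A x).det.re / c) (((A t).adjugate * A').trace.re / c) t :=
  (Complex.reCLM.hasFDerivAt.comp_hasDerivAt t (hasDerivAt_det hA)).div_const c

theorem hasDerivAt_relVol_path {a b : ℝ} {ψ : ℝ → X → ℝ} (hψ : SmoothPath n a b ψ) {s : ℝ}
    (hs : s ∈ Set.Ioo a b) (h : ∀ x, L x → L x → ℂ) (t : ℝ) (x : X) :
    HasDerivAt (fun r => relVol n h t (ψ r) x x)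
      (-(t * relLap n h t (ψ s) (pathDeriv ψ s) x x)) s := by
  have h1 := hasDerivAt_re_det_div (A := fun r => kahlerMatrix h x (chartAt (Fin n → ℂ) x x) -
    (t : ℂ) • chartHessian n (ψ r) x x) (A' := -((t : ℂ) • chartHessian n (pathDeriv ψ s) x x))
    (t := s) (fun i k => by
      simpa using ((hψ.hasDerivAt_chartHessian hs (mem_chart_source _ x) i k).const_mul
        (t : ℂ)).const_sub (kahlerMatrix h x (chartAt (Fin n → ℂ) x x) i k))
    (kahlerMatrix h x (chartAt (Fin n → ℂ) x x)).det.re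
  refine h1.congr_deriv ?_
  simp only [relLap, mul_neg, Matrix.mul_smul, Matrix.trace_neg, Matrix.trace_smul, smul_eq_mul,
    Complex.neg_re, Complex.re_ofReal_mul]
  ring

/-- Jacobi's formula for the determinant of a matrix that is affine in the parameter. Since `relVol`
is defined for every real parameter, no positivity of the metric along the way is needed. -/
theorem hasDerivAt_relVol (h : ∀ x, L x → L x → ℂ) (ψ : X → ℝ) (t : ℝ) (x : X) :
    HasDerivAt (fun r => relVol n h r ψ x x) (-relLap n h t ψ ψ x x) t := by
  have h1 := hasDerivAt_re_det_div (A := fun r : ℝ => kahlerMatrix h x (chartAt (Fin n → ℂ) x x) -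
    (r : ℂ) • chartHessian n ψ x x) (A' := -chartHessian n ψ x x)
    (t := t) (fun i k => by
      simpa using ((hasDerivAt_id t).ofReal_comp.mul_const (chartHessian n ψ x x i k)).const_sub
        (kahlerMatrix h x (chartAt (Fin n → ℂ) x x) i k))
    (kahlerMatrix h x (chartAt (Fin n → ℂ) x x)).det.re
  refine h1.congr_deriv ?_
  simp only [relLap, mul_neg, Matrix.trace_neg, Complex.neg_re]
  ring

theorem relLap_sum {ι : Type*} (S : Finset ι) {u : ι → X → ℝ} (h : ∀ x, L x → L x → ℂ)
    (hu : ∀ i, ContMDiff 𝓘(ℝ, Fin n → ℂ) 𝓘(ℝ, ℝ) ∞ (u i)) (t : ℝ) (ψ : X → ℝ) (x : X) :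
    relLap n h t ψ (fun y => ∑ i ∈ S, u i y) x x = ∑ i ∈ S, relLap n h t ψ (u i) x x := by
  have e : chartHessian n (fun y => ∑ i ∈ S, u i y) x x = ∑ i ∈ S, chartHessian n (u i) x x := by
    simp only [chartHessian, Complex.ofReal_sum]
    exact complexHessian_sum S fun i _ => contDiffAt_ofReal
      ((contDiffAt_chart (mem_chart_source _ x) (hu i x)).of_le two_le_infty)
  simp only [relLap, e, Matrix.mul_sum, Matrix.trace_sum, Complex.re_sum, Finset.sum_div]

variable [ContMDiffVectorBundle ω ℂ L 𝓘(ℂ, Fin n → ℂ)]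

theorem kahlerMatrix_sub_transition (hh : h ∈ posMetrics n L) {ψ : X → ℝ} {p q x : X}
    (hψ : ContMDiffAt 𝓘(ℝ, Fin n → ℂ) 𝓘(ℝ, ℝ) ∞ ψ x) (t : ℝ) (hp : x ∈ patch n L p)
    (hq : x ∈ patch n L q) :
    kahlerMatrix h p (chartAt (Fin n → ℂ) p x) - (t : ℂ) • chartHessian n ψ p x =
      (transitionMatrix n p q x).transpose * (kahlerMatrix h q (chartAt (Fin n → ℂ) q x) -
      (t : ℂ) • chartHessian n ψ q x) * (transitionMatrix n p q x).map conj := by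
  rw [kahlerMatrix_transition hh.1 hp hq, chartHessian_transition hψ hp.1 hq.1]
  simp only [Matrix.mul_sub, Matrix.sub_mul, Matrix.mul_smul, Matrix.smul_mul]

theorem relVol_transition (hh : h ∈ posMetrics n L) {ψ : X → ℝ} {p q x : X}
    (hψ : ContMDiffAt 𝓘(ℝ, Fin n → ℂ) 𝓘(ℝ, ℝ) ∞ ψ x) (t : ℝ) (hp : x ∈ patch n L p)
    (hq : x ∈ patch n L q) : relVol n h t ψ p x = relVol n h t ψ q x := by
  have hJ : Complex.normSq (transitionMatrix n p q x).det ≠ 0 :=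
    fun h0 => det_transitionMatrix_ne_zero hp.1 hq.1 (Complex.normSq_eq_zero.1 h0)
  rw [relVol, relVol, kahlerMatrix_sub_transition hh hψ t hp hq,
    kahlerMatrix_transition hh.1 hp hq, det_conj_mul, det_conj_mul, Complex.re_ofReal_mul,
    Complex.re_ofReal_mul, mul_div_mul_left _ _ hJ]

theorem relLap_transition (hh : h ∈ posMetrics n L) {ψ u : X → ℝ} {p q x : X}
    (hψ : ContMDiffAt 𝓘(ℝ, Fin n → ℂ) 𝓘(ℝ, ℝ) ∞ ψ x)
    (hu : ContMDiffAt 𝓘(ℝ, Fin n → ℂ) 𝓘(ℝ, ℝ) ∞ u x) (t : ℝ) (hp : x ∈ patch n L p)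
    (hq : x ∈ patch n L q) : relLap n h t ψ u p x = relLap n h t ψ u q x := by
  have hJ : Complex.normSq (transitionMatrix n p q x).det ≠ 0 :=
    fun h0 => det_transitionMatrix_ne_zero hp.1 hq.1 (Complex.normSq_eq_zero.1 h0)
  rw [relLap, relLap, kahlerMatrix_sub_transition hh hψ t hp hq, chartHessian_transition hu hp.1 hq.1,
    kahlerMatrix_transition hh.1 hp hq, det_conj_mul, trace_adjugate_mul_conj,
    Complex.re_ofReal_mul, Complex.re_ofReal_mul, mul_div_mul_left _ _ hJ]

theorem continuousAt_kahlerMatrix (hh : IsHermitianMetric n h) {p x : X} (hx : x ∈ patch n L p) :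
    ContinuousAt (fun y => kahlerMatrix h p (chartAt (Fin n → ℂ) p y)) x := by
  refine continuousAt_pi.2 fun j => continuousAt_pi.2 fun k => ?_
  exact ContinuousAt.comp (f := chartAt (Fin n → ℂ) p) (g := fun z => kahlerMatrix h p z j k)
    (contDiffAt_kahlerMatrix hh hx j k).continuousAt ((chartAt (Fin n → ℂ) p).continuousAt hx.1)

section Joint

variable {a b : ℝ} {ψ υ : ℝ → X → ℝ} (hψ : SmoothPath n a b ψ) (hυ : SmoothPath n a b υ) {s : ℝ}
  (hs : s ∈ Set.Ioo a b)

theorem continuousAt_relVol_joint (hh : h ∈ posMetrics n L) (hψ : SmoothPath n a b ψ)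
    (hs : s ∈ Set.Ioo a b) (t : ℝ) (x : X) :
    ContinuousAt (fun q : ℝ × ℝ × X => relVol n h q.2.1 (ψ q.1) q.2.2 q.2.2) (s, t, x) := by
  have hx := mem_patch_self (n := n) (L := L) x
  -- The density at each point is defined in the chart centred at that same point, which need not
  -- vary continuously. By invariance the chart may be frozen at `x` nearby.
  have hev : (fun q : ℝ × ℝ × X => relVol n h q.2.1 (ψ q.1) x q.2.2) =ᶠ[nhds (s, t, x)]
      fun q : ℝ × ℝ × X => relVol n h q.2.1 (ψ q.1) q.2.2 q.2.2 := by
    filter_upwards [prod_mem_nhds (isOpen_Ioo.mem_nhds hs) (prod_mem_nhds (Filter.univ_mem (f := nhds t))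
      ((patch_open (n := n) (L := L) x).mem_nhds hx))] with q hq
    exact relVol_transition hh (hψ.slice hq.1 _) _ hq.2.2 (mem_patch_self _)
  refine ContinuousAt.congr ?_ hev
  have hG : ContinuousAt (fun q : ℝ × ℝ × X => kahlerMatrix h x (chartAt (Fin n → ℂ) x q.2.2))
      (s, t, x) := ContinuousAt.comp (f := fun q : ℝ × ℝ × X => q.2.2) (x := (s, t, x))
    (continuousAt_kahlerMatrix hh.1 hx) (by fun_prop)
  have hU : ContinuousAt (fun q : ℝ × ℝ × X => chartHessian n (ψ q.1) x q.2.2) (s, t, x) :=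
    ContinuousAt.comp (f := fun q : ℝ × ℝ × X => (q.1, q.2.2)) (x := (s, t, x))
      (hψ.continuousAt_chartHessian hs hx.1) (by fun_prop)
  have ht : ContinuousAt (fun q : ℝ × ℝ × X => (q.2.1 : ℂ)) (s, t, x) := by fun_prop
  have hdet : Continuous fun A : Matrix (Fin n) (Fin n) ℂ => A.det.re :=
    Complex.continuous_re.comp continuous_id.matrix_det
  exact (hdet.continuousAt.comp (hG.sub (ht.smul hU))).div (hdet.continuousAt.comp hG)
    (det_re_pos hh hx).ne'

theorem continuousAt_relLap_joint (hh : h ∈ posMetrics n L) (hψ : SmoothPath n a b ψ)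
    (hυ : SmoothPath n a b υ) (hs : s ∈ Set.Ioo a b) (t : ℝ) (x : X) :
    ContinuousAt (fun q : ℝ × ℝ × X => relLap n h q.2.1 (ψ q.1) (υ q.1) q.2.2 q.2.2)
      (s, t, x) := by
  have hx := mem_patch_self (n := n) (L := L) x
  have hev : (fun q : ℝ × ℝ × X => relLap n h q.2.1 (ψ q.1) (υ q.1) x q.2.2) =ᶠ[nhds (s, t, x)]
      fun q : ℝ × ℝ × X => relLap n h q.2.1 (ψ q.1) (υ q.1) q.2.2 q.2.2 := by
    filter_upwards [prod_mem_nhds (isOpen_Ioo.mem_nhds hs) (prod_mem_nhds (Filter.univ_mem (f := nhds t))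
      ((patch_open (n := n) (L := L) x).mem_nhds hx))] with q hq
    exact relLap_transition hh (hψ.slice hq.1 _) (hυ.slice hq.1 _) _ hq.2.2 (mem_patch_self _)
  refine ContinuousAt.congr ?_ hev
  have hG : ContinuousAt (fun q : ℝ × ℝ × X => kahlerMatrix h x (chartAt (Fin n → ℂ) x q.2.2))
      (s, t, x) := ContinuousAt.comp (f := fun q : ℝ × ℝ × X => q.2.2) (x := (s, t, x))
    (continuousAt_kahlerMatrix hh.1 hx) (by fun_prop)
  have hU : ContinuousAt (fun q : ℝ × ℝ × X => chartHessian n (ψ q.1) x q.2.2) (s, t, x) :=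
    ContinuousAt.comp (f := fun q : ℝ × ℝ × X => (q.1, q.2.2)) (x := (s, t, x))
      (hψ.continuousAt_chartHessian hs hx.1) (by fun_prop)
  have hV : ContinuousAt (fun q : ℝ × ℝ × X => chartHessian n (υ q.1) x q.2.2) (s, t, x) :=
    ContinuousAt.comp (f := fun q : ℝ × ℝ × X => (q.1, q.2.2)) (x := (s, t, x))
      (hυ.continuousAt_chartHessian hs hx.1) (by fun_prop)
  have ht : ContinuousAt (fun q : ℝ × ℝ × X => (q.2.1 : ℂ)) (s, t, x) := by fun_prop
  have hdet : Continuous fun A : Matrix (Fin n) (Fin n) ℂ => A.det.re :=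
    Complex.continuous_re.comp continuous_id.matrix_det
  have htr : Continuous fun A : Matrix (Fin n) (Fin n) ℂ × Matrix (Fin n) (Fin n) ℂ =>
      (A.1.adjugate * A.2).trace.re :=
    Complex.continuous_re.comp ((continuous_fst.matrix_adjugate.matrix_mul
      continuous_snd).matrix_trace)
  exact (htr.continuousAt.comp ((hG.sub (ht.smul hU)).prodMk hV)).div (hdet.continuousAt.comp hG)
    (det_re_pos hh hx).ne'

end Joint

theorem continuous_relVol_param (hh : h ∈ posMetrics n L) {ψ : X → ℝ}
    (hψ : ContMDiff 𝓘(ℝ, Fin n → ℂ) 𝓘(ℝ, ℝ) ∞ ψ) :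
    Continuous fun q : ℝ × X => relVol n h q.1 ψ q.2 q.2 :=
  -- The fixed function `ψ` is treated as a constant path on `(-1, 1)`, evaluated at time 0.
  continuous_iff_continuousAt.2 fun q => ContinuousAt.comp (f := fun q : ℝ × X => ((0 : ℝ), q.1, q.2))
    (continuousAt_relVol_joint hh (smoothPath_const (a := -1) (b := 1) hψ) (by simp) q.1 q.2)
    (by fun_prop)

theorem continuous_relLap_param (hh : h ∈ posMetrics n L) {ψ u : X → ℝ}
    (hψ : ContMDiff 𝓘(ℝ, Fin n → ℂ) 𝓘(ℝ, ℝ) ∞ ψ) (hu : ContMDiff 𝓘(ℝ, Fin n → ℂ) 𝓘(ℝ, ℝ) ∞ u) :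
    Continuous fun q : ℝ × X => relLap n h q.1 ψ u q.2 q.2 :=
  continuous_iff_continuousAt.2 fun q => ContinuousAt.comp (f := fun q : ℝ × X => ((0 : ℝ), q.1, q.2))
    (continuousAt_relLap_joint hh (smoothPath_const (a := -1) (b := 1) hψ)
      (smoothPath_const (a := -1) (b := 1) hu) (by simp) q.1 q.2)
    (by fun_prop)

theorem continuous_relVol (hh : h ∈ posMetrics n L) {ψ : X → ℝ}
    (hψ : ContMDiff 𝓘(ℝ, Fin n → ℂ) 𝓘(ℝ, ℝ) ∞ ψ) (t : ℝ) :
    Continuous fun x => relVol n h t ψ x x :=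
  Continuous.comp (g := fun q : ℝ × X => relVol n h q.1 ψ q.2 q.2) (f := fun x => (t, x))
    (continuous_relVol_param hh hψ) (by fun_prop)

theorem continuous_laplacian (hh : h ∈ posMetrics n L) {u : X → ℝ}
    (hu : ContMDiff 𝓘(ℝ, Fin n → ℂ) 𝓘(ℝ, ℝ) ∞ u) :
    Continuous fun x => laplacian n h u x x :=
  Continuous.comp (g := fun q : ℝ × X => relLap n h q.1 (fun _ => 0) u q.2 q.2)
    (f := fun x => (0, x)) (continuous_relLap_param hh contMDiff_const hu) (by fun_prop)

end RelativeVolume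

/-! ### Green's formula and the sign of the Laplacian on `X` -/

section Green

variable {n : ℕ} {X : Type*} [TopologicalSpace X] [CompactSpace X] [T2Space X] [Nonempty X]
  [ChartedSpace (Fin n → ℂ) X]
  [IsManifold 𝓘(ℂ, Fin n → ℂ) ω X] [MeasurableSpace X] [BorelSpace X]
  {L : X → Type*} [∀ x, AddCommGroup (L x)] [∀ x, Module ℂ (L x)]
  [∀ x, TopologicalSpace (L x)] [TopologicalSpace (Bundle.TotalSpace ℂ L)]
  [FiberBundle ℂ L] [VectorBundle ℂ ℂ L] [ContMDiffVectorBundle ω ℂ L 𝓘(ℂ, Fin n → ℂ)]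
  {h : ∀ x, L x → L x → ℂ}

theorem exists_partition (n : ℕ) [ChartedSpace (Fin n → ℂ) X] [IsManifold 𝓘(ℂ, Fin n → ℂ) ω X]
    (L : X → Type*) [∀ x, AddCommGroup (L x)] [∀ x, Module ℂ (L x)]
    [∀ x, TopologicalSpace (L x)] [TopologicalSpace (Bundle.TotalSpace ℂ L)] [FiberBundle ℂ L] :
    ∃ (S : Finset X) (ρ : X → X → ℝ), (∀ p, ContMDiff 𝓘(ℝ, Fin n → ℂ) 𝓘(ℝ, ℝ) ∞ (ρ p)) ∧
      (∀ p, tsupport (ρ p) ⊆ patch n L p) ∧ ∀ x, ∑ p ∈ S, ρ p x = 1 := by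
  have : IsManifold 𝓘(ℝ, Fin n → ℂ) ∞ X := isManifold_real
  obtain ⟨f, hf⟩ := SmoothPartitionOfUnity.exists_isSubordinate 𝓘(ℝ, Fin n → ℂ)
    (isClosed_univ (X := X)) (fun p => patch n L p) patch_open
    (fun x _ => Set.mem_iUnion.2 ⟨x, mem_patch_self x⟩)
  have hfin := f.locallyFinite.finite_nonempty_of_compact
  refine ⟨hfin.toFinset, fun p => f p, fun p => (f p).contMDiff, hf, fun x => ?_⟩
  rw [← f.sum_eq_one (Set.mem_univ x), finsum_eq_sum_of_support_subset]
  intro p hp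
  simp only [Set.Finite.coe_toFinset]
  exact ⟨x, hp⟩

theorem integrable_volumeMeasure (hh : h ∈ posMetrics n L) {f : X → ℝ} (hf : Continuous f) :
    Integrable f (volumeMeasure n h) :=
  have := isFiniteMeasure_volumeMeasure hh
  hf.integrable_of_hasCompactSupport (HasCompactSupport.of_compactSpace _)

theorem integral_eq_sum_partition (hh : h ∈ posMetrics n L) {S : Finset X} {ρ : X → X → ℝ}
    (hρ : ∀ p, ContMDiff 𝓘(ℝ, Fin n → ℂ) 𝓘(ℝ, ℝ) ∞ (ρ p)) (h1 : ∀ x, ∑ p ∈ S, ρ p x = 1)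
    {f : X → ℝ} (hf : Continuous f) :
    ∫ x, f x ∂(volumeMeasure n h) = ∑ p ∈ S, ∫ x, ρ p x * f x ∂(volumeMeasure n h) := by
  rw [← integral_finsetSum _ fun p _ => integrable_volumeMeasure hh ((hρ p).continuous.fun_mul hf)]
  refine integral_congr_ae (Filter.Eventually.of_forall fun x => ?_)
  simp only
  rw [← Finset.sum_mul, h1, one_mul]

/-- `relVol` is the density of one volume measure with respect to the other. A partition of unity
reduces this to a single patch, where it is a quotient of determinants. -/
theorem integral_rescale (hh : h ∈ posMetrics n L) {ψ : X → ℝ} {t : ℝ}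
    (hψ : ContMDiff 𝓘(ℝ, Fin n → ℂ) 𝓘(ℝ, ℝ) ∞ ψ)
    (hk : rescale (fun x => t * ψ x) h ∈ posMetrics n L) {f : X → ℝ} (hf : Continuous f) :
    ∫ x, f x ∂(volumeMeasure n (rescale (fun x => t * ψ x) h)) =
      ∫ x, f x * relVol n h t ψ x x ∂(volumeMeasure n h) := by
  obtain ⟨S, ρ, hρ, hsupp, h1⟩ := exists_partition (X := X) n L
  have hs : ContMDiff 𝓘(ℝ, Fin n → ℂ) 𝓘(ℝ, ℝ) ∞ (fun x => t * ψ x) := contMDiff_const.mul hψ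
  rw [integral_eq_sum_partition hk hρ h1 hf, integral_eq_sum_partition hh hρ h1
    (hf.fun_mul (continuous_relVol hh hψ t))]
  refine Finset.sum_congr rfl fun p _ => ?_
  have h0 : ∀ x ∉ patch n L p, ρ p x = 0 := fun x hx =>
    image_eq_zero_of_notMem_tsupport fun hx' => hx (hsupp p hx')
  rw [integral_eq_of_support hk (p := p) ((hρ p).continuous.fun_mul hf) fun x hx => by simp [h0 x hx],
    integral_eq_of_support hh (p := p) ((hρ p).continuous.fun_mul (hf.fun_mul (continuous_relVol hh hψ t)))
      fun x hx => by simp [h0 x hx]]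
  refine setIntegral_congr_fun (chart_image_patch_open p).measurableSet ?_
  rintro _ ⟨x, hx, rfl⟩
  simp only
  have e : chartHessian n (fun x => t * ψ x) p x = (t : ℂ) • chartHessian n ψ p x := by
    simp only [chartHessian, Complex.ofReal_mul]
    rw [complexHessian_const_mul]
  have hd := det_re_pos hh hx
  rw [(chartAt (Fin n → ℂ) p).left_inv hx.1, kahlerMatrix_rescale hs hh.1 hx, e,
    relVol_transition hh (hψ x) t (mem_patch_self x) hx, relVol]
  field_simp

/-- Only one of the two functions has to be supported in a patch: the Green field and its divergence
vanish wherever `f` vanishes locally. The determinant in the volume density cancels the denominator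
of the Laplacian and leaves the Euclidean integrand. -/
theorem integral_green_of_tsupport (hh : h ∈ posMetrics n L) {f u : X → ℝ}
    (hf : ContMDiff 𝓘(ℝ, Fin n → ℂ) 𝓘(ℝ, ℝ) ∞ f) (hu : ContMDiff 𝓘(ℝ, Fin n → ℂ) 𝓘(ℝ, ℝ) ∞ u)
    {p : X} (hp : tsupport f ⊆ patch n L p) :
    ∫ x, (f x * laplacian n h u x x - u x * laplacian n h f x x) ∂(volumeMeasure n h) = 0 := by
  have hc : Continuous fun x => f x * laplacian n h u x x - u x * laplacian n h f x x :=
    (hf.continuous.fun_mul (continuous_laplacian hh hu)).sub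
      (hu.continuous.fun_mul (continuous_laplacian hh hf))
  have h0 : ∀ x ∉ tsupport f, f x = 0 ∧ laplacian n h f x x = 0 := by
    intro x hx
    refine ⟨image_eq_zero_of_notMem_tsupport hx, ?_⟩
    have hev : f =ᶠ[nhds x] fun _ => 0 := notMem_tsupport_iff_eventuallyEq.1 hx
    rw [laplacian_eq, chartHessian_congr (mem_chart_source _ x) hev, chartHessian_const]
    simp
  rw [integral_eq_of_support hh (p := p) hc fun x hx => by
    obtain ⟨h1, h2⟩ := h0 x fun h => hx (hp h)
    simp [h1, h2]]
  have hK : IsCompact (chartAt (Fin n → ℂ) p '' tsupport f) :=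
    (isClosed_tsupport f).isCompact.image_of_continuousOn
      ((chartAt (Fin n → ℂ) p).continuousOn.mono fun x hx => (hp hx).1)
  have hmain := setIntegral_green (chart_image_patch_open (n := n) (L := L) p) hK (Set.image_mono hp)
    (ψ := logNormSq h p) (f := fun z => f ((chartAt (Fin n → ℂ) p).symm z))
    (u := fun z => u ((chartAt (Fin n → ℂ) p).symm z)) ?_ ?_ ?_ ?_ ?_
  rotate_left
  · rintro _ ⟨x, hx, rfl⟩
    exact (contDiffAt_logNormSq hh.1 hx).of_le three_le_infty
  · rintro _ ⟨x, hx, rfl⟩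
    exact hh.2 p x hx
  · rintro _ ⟨x, hx, rfl⟩
    exact (contDiffAt_chart hx.1 (hf x)).of_le two_le_infty
  · rintro _ ⟨x, hx, rfl⟩
    exact (contDiffAt_chart hx.1 (hu x)).of_le two_le_infty
  · rintro _ ⟨x, hx, rfl⟩ hx'
    rw [(chartAt (Fin n → ℂ) p).left_inv hx.1]
    exact (h0 x fun h => hx' ⟨x, h, rfl⟩).1
  -- The factor `2 ^ n` comes from `i dz ∧ dz̄ = 2 dx ∧ dy` in each coordinate.
  have := congrArg (fun r => (2 : ℝ) ^ n * r) hmain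
  simp only [mul_zero] at this
  rw [← integral_const_mul] at this
  rw [← this]
  refine setIntegral_congr_fun (chart_image_patch_open p).measurableSet ?_
  rintro _ ⟨x, hx, rfl⟩
  simp only
  have hd := det_re_pos hh hx
  have e : ∀ v : X → ℝ, ContMDiff 𝓘(ℝ, Fin n → ℂ) 𝓘(ℝ, ℝ) ∞ v → laplacian n h v x x =
      ((kahlerMatrix h p (chartAt (Fin n → ℂ) p x)).adjugate * chartHessian n v p x).trace.re /
      (kahlerMatrix h p (chartAt (Fin n → ℂ) p x)).det.re := fun v hv => by
    rw [← laplacian_eq]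
    exact relLap_transition hh contMDiffAt_const (hv x) 0 (mem_patch_self x) hx
  rw [(chartAt (Fin n → ℂ) p).left_inv hx.1, e u hu, e f hf]
  change _ = 2 ^ n * (((kahlerMatrix h p (chartAt (Fin n → ℂ) p x)).adjugate *
    chartHessian n u p x).trace.re * f x - ((kahlerMatrix h p (chartAt (Fin n → ℂ) p x)).adjugate *
    chartHessian n f p x).trace.re * u x)
  field_simp

/-- The identity is linear in `f`, so `f` alone is cut up by a partition of unity, with `u` left
global. -/
theorem integral_green (hh : h ∈ posMetrics n L) {f u : X → ℝ}
    (hf : ContMDiff 𝓘(ℝ, Fin n → ℂ) 𝓘(ℝ, ℝ) ∞ f) (hu : ContMDiff 𝓘(ℝ, Fin n → ℂ) 𝓘(ℝ, ℝ) ∞ u) :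
    ∫ x, f x * laplacian n h u x x ∂(volumeMeasure n h) =
      ∫ x, u x * laplacian n h f x x ∂(volumeMeasure n h) := by
  obtain ⟨S, ρ, hρ, hsupp, h1⟩ := exists_partition (X := X) n L
  have hρf : ∀ p, ContMDiff 𝓘(ℝ, Fin n → ℂ) 𝓘(ℝ, ℝ) ∞ fun x => ρ p x * f x := fun p => (hρ p).mul hf
  rw [← sub_eq_zero, ← integral_sub
    (integrable_volumeMeasure hh (hf.continuous.fun_mul (continuous_laplacian hh hu)))
    (integrable_volumeMeasure hh (hu.continuous.fun_mul (continuous_laplacian hh hf)))]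
  have e : ∀ x, f x * laplacian n h u x x - u x * laplacian n h f x x =
      ∑ p ∈ S, (ρ p x * f x * laplacian n h u x x -
        u x * laplacian n h (fun y => ρ p y * f y) x x) := by
    intro x
    have e1 : f = fun y => ∑ p ∈ S, ρ p y * f y := by
      ext y; rw [← Finset.sum_mul, h1, one_mul]
    have e2 : laplacian n h f x x = ∑ p ∈ S, laplacian n h (fun y => ρ p y * f y) x x := by
      conv_lhs => rw [e1]
      exact relLap_sum S h hρf _ _ x
    rw [Finset.sum_sub_distrib, ← Finset.mul_sum, ← e2, ← Finset.sum_mul, ← Finset.sum_mul, h1,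
      one_mul]
  simp only [e]
  rw [integral_finsetSum]
  · refine Finset.sum_eq_zero fun p _ => integral_green_of_tsupport hh (hρf p) hu (p := p) ?_
    exact (tsupport_mul_subset_left (f := ρ p) (g := f)).trans (hsupp p)
  · intro p _
    exact integrable_volumeMeasure hh (((hρf p).continuous.fun_mul (continuous_laplacian hh hu)).sub
      (hu.continuous.fun_mul (continuous_laplacian hh (hρf p))))

theorem integral_laplacian (hh : h ∈ posMetrics n L) {u : X → ℝ}
    (hu : ContMDiff 𝓘(ℝ, Fin n → ℂ) 𝓘(ℝ, ℝ) ∞ u) :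
    ∫ x, laplacian n h u x x ∂(volumeMeasure n h) = 0 := by
  have := integral_green hh (f := fun _ => 1) contMDiff_const hu
  simpa [laplacian_const] using this

theorem posSemidef_adjugate {G : Matrix (Fin n) (Fin n) ℂ} (hG : G.PosDef) :
    G.adjugate.PosSemidef := by
  have h1 : G.adjugate = G.det • G⁻¹ := by
    rw [Matrix.inv_def, smul_smul, Ring.mul_inverse_cancel _ (isUnit_iff_ne_zero.2 hG.det_pos.ne'),
      one_smul]
  have h2 : G.det = (G.det.re : ℂ) := by
    have := (Complex.pos_iff.1 hG.det_pos).2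
    exact Complex.ext rfl (by simpa using this.symm)
  rw [h1, h2]
  have h3 := hG.inv.posSemidef.smul (Complex.pos_iff.1 hG.det_pos).1.le
  have e : (G.det.re : ℂ) • G⁻¹ = G.det.re • G⁻¹ := by ext i k; simp
  rwa [e]

/-- By the product rule `Δ(f²) - 2 f Δf` is twice the squared length of `∂f`, a Hermitian form in
the adjugate of the Kähler matrix, which is positive semidefinite. -/
theorem two_mul_laplacian_le (hh : h ∈ posMetrics n L) {f : X → ℝ}
    (hf : ContMDiff 𝓘(ℝ, Fin n → ℂ) 𝓘(ℝ, ℝ) ∞ f) (x : X) :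
    2 * (f x * laplacian n h f x x) ≤ laplacian n h (fun y => f y * f y) x x := by
  have hx := mem_patch_self (n := n) (L := L) x
  have hd := det_re_pos hh hx
  have hc := (contDiffAt_chart hx.1 (hf x)).of_le two_le_infty
  have hc' := contDiffAt_ofReal hc
  set G := kahlerMatrix h x (chartAt (Fin n → ℂ) x x) with hG
  set F : (Fin n → ℂ) → ℂ := fun z => (f ((chartAt (Fin n → ℂ) x).symm z) : ℂ) with hF
  set z := chartAt (Fin n → ℂ) x x with hz
  have hFz : F z = (f x : ℂ) := by rw [hF, hz]; simp only; rw [(chartAt (Fin n → ℂ) x).left_inv hx.1]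
  have e : ∀ j k, chartHessian n (fun y => f y * f y) x x j k =
      2 * f x * chartHessian n f x x j k +
        2 * (wirtinger j F z * conj (wirtinger k F z)) := by
    intro j k
    have h1 : chartHessian n (fun y => f y * f y) x x = complexHessian (fun w => F w * F w) z := by
      simp only [chartHessian, Complex.ofReal_mul]
      rfl
    rw [h1, complexHessian_mul hc' hc', hFz,
      ← conj_wirtinger_ofReal k (hc.differentiableAt (by simp))]
    change _ = 2 * f x * complexHessian F z j k + _
    ring
  have e2 : (G.adjugate * chartHessian n (fun y => f y * f y) x x).trace =
      2 * f x * (G.adjugate * chartHessian n f x x).trace +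
        2 * dotProduct (star fun k => wirtinger k F z)
          (G.adjugate.mulVec fun k => wirtinger k F z) := by
    simp only [trace_mul_eq_sum, e, dotProduct, Matrix.mulVec, Finset.mul_sum]
    rw [Finset.sum_comm (s := Finset.univ (α := Fin n)) (t := Finset.univ) (f := fun k j =>
      2 * (star (fun k => wirtinger k F z) k * (G.adjugate k j * wirtinger j F z)))]
    rw [← Finset.sum_add_distrib]
    refine Finset.sum_congr rfl fun j _ => ?_
    rw [← Finset.sum_add_distrib]
    refine Finset.sum_congr rfl fun k _ => ?_
    simp only [Pi.star_apply, RCLike.star_def]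
    ring
  have hpos := (posSemidef_adjugate (hh.2 x x hx)).re_dotProduct_nonneg fun k => wirtinger k F z
  rw [laplacian_eq, laplacian_eq, ← hz, ← hG, e2, ← mul_div_assoc, ← mul_div_assoc]
  refine div_le_div_of_nonneg_right ?_ hd.le
  have e3 : (2 * (f x : ℂ) * (G.adjugate * chartHessian n f x x).trace).re =
      2 * (f x * (G.adjugate * chartHessian n f x x).trace.re) := by
    rw [mul_assoc, Complex.mul_re]; simp
  rw [Complex.add_re, e3]
  have e4 : ∀ c : ℂ, (2 * c).re = 2 * c.re := fun c => by simp
  rw [e4]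
  simp only [RCLike.re_eq_complex_re] at hpos
  linarith

/-- Integrate the pointwise bound for `Δ(f²)`: its left side is `2 f Δf` and its right side has
integral zero. No integral of a gradient needs to be formed. -/
theorem integral_mul_laplacian_nonpos (hh : h ∈ posMetrics n L) {f : X → ℝ}
    (hf : ContMDiff 𝓘(ℝ, Fin n → ℂ) 𝓘(ℝ, ℝ) ∞ f) :
    ∫ x, f x * laplacian n h f x x ∂(volumeMeasure n h) ≤ 0 := by
  have h1 := integral_mono
    ((integrable_volumeMeasure hh (hf.continuous.fun_mul (continuous_laplacian hh hf))).const_mul 2)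
    (integrable_volumeMeasure hh (continuous_laplacian hh (hf.mul hf)))
    (two_mul_laplacian_le hh hf)
  have h2 := integral_laplacian hh (hf.mul hf)
  rw [integral_const_mul] at h1
  change _ ≤ ∫ x, laplacian n h (f * f) x x ∂(volumeMeasure n h) at h1
  rw [h2] at h1
  linarith

end Green

end BalancedMetrics

namespace BalancedMetrics

open MeasureTheory

/-! ### Constancy of the volume; convexity and existence of the energy -/

section Energy

variable {n : ℕ} {X : Type*} [TopologicalSpace X] [CompactSpace X] [T2Space X] [Nonempty X]
  [ChartedSpace (Fin n → ℂ) X]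
  [IsManifold 𝓘(ℂ, Fin n → ℂ) ω X] [MeasurableSpace X] [BorelSpace X]
  {L : X → Type*} [∀ x, AddCommGroup (L x)] [∀ x, Module ℂ (L x)]
  [∀ x, TopologicalSpace (L x)] [TopologicalSpace (Bundle.TotalSpace ℂ L)]
  [FiberBundle ℂ L] [VectorBundle ℂ ℂ L] [ContMDiffVectorBundle ω ℂ L 𝓘(ℂ, Fin n → ℂ)]
  {h : ∀ x, L x → L x → ℂ}

theorem integral_relLap (hh : h ∈ posMetrics n L) {ψ u : X → ℝ} {t : ℝ}
    (hψ : ContMDiff 𝓘(ℝ, Fin n → ℂ) 𝓘(ℝ, ℝ) ∞ ψ) (hu : ContMDiff 𝓘(ℝ, Fin n → ℂ) 𝓘(ℝ, ℝ) ∞ u)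
    (hk : rescale (fun x => t * ψ x) h ∈ posMetrics n L) {f : X → ℝ} (hf : Continuous f) :
    ∫ x, f x * relLap n h t ψ u x x ∂(volumeMeasure n h) =
      ∫ x, f x * laplacian n (rescale (fun x => t * ψ x) h) u x x
        ∂(volumeMeasure n (rescale (fun x => t * ψ x) h)) := by
  rw [integral_rescale hh hψ hk (hf.fun_mul (continuous_laplacian hk hu))]
  refine integral_congr_ae (Filter.Eventually.of_forall fun x => ?_)
  simp only
  rw [relLap_eq hψ hh hk u (mem_patch_self x)]
  ring

theorem continuous_mul_relLap_param (hh : h ∈ posMetrics n L) {ψ u f : X → ℝ}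
    (hψ : ContMDiff 𝓘(ℝ, Fin n → ℂ) 𝓘(ℝ, ℝ) ∞ ψ) (hu : ContMDiff 𝓘(ℝ, Fin n → ℂ) 𝓘(ℝ, ℝ) ∞ u)
    (hf : Continuous f) : Continuous fun q : ℝ × X => f q.2 * relLap n h q.1 ψ u q.2 q.2 :=
  (hf.comp continuous_snd).fun_mul (continuous_relLap_param hh hψ hu)

theorem hasDerivAt_integral_relVol (hh : h ∈ posMetrics n L) {ψ : X → ℝ}
    (hψ : ContMDiff 𝓘(ℝ, Fin n → ℂ) 𝓘(ℝ, ℝ) ∞ ψ) {f : X → ℝ} (hf : Continuous f) (t : ℝ) :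
    HasDerivAt (fun r => ∫ x, f x * relVol n h r ψ x x ∂(volumeMeasure n h))
      (-∫ x, f x * relLap n h t ψ ψ x x ∂(volumeMeasure n h)) t := by
  have := isFiniteMeasure_volumeMeasure hh
  have : SecondCountableTopology X := ChartedSpace.secondCountable_of_sigmaCompact (Fin n → ℂ) X
  have h1 : Continuous fun q : ℝ × X => f q.2 * relVol n h q.1 ψ q.2 q.2 :=
    (hf.comp continuous_snd).fun_mul (continuous_relVol_param hh hψ)
  rw [← integral_neg]
  refine hasDerivAt_integral_of_continuousOn (a := t - 1) (b := t + 1)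
    (F := fun r x => f x * relVol n h r ψ x x) (F' := fun r x => -(f x * relLap n h r ψ ψ x x))
    h1.continuousOn (continuous_mul_relLap_param hh hψ hψ hf).neg.continuousOn ?_ (by simp)
  intro s _ x
  simpa using (hasDerivAt_relVol h ψ s x).const_mul (f x)

theorem integral_rescale_one (hh : h ∈ posMetrics n L) {ψ : X → ℝ}
    (hψ : ContMDiff 𝓘(ℝ, Fin n → ℂ) 𝓘(ℝ, ℝ) ∞ ψ) (hk : rescale ψ h ∈ posMetrics n L)
    {f : X → ℝ} (hf : Continuous f) : ∫ x, f x ∂(volumeMeasure n (rescale ψ h)) =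
      ∫ x, f x * relVol n h 1 ψ x x ∂(volumeMeasure n h) := by
  have e : ψ = fun x => 1 * ψ x := by simp
  rw [e] at hk
  conv_lhs => rw [e]
  exact integral_rescale hh hψ hk hf

theorem vol_eq_integral (h : ∀ x, L x → L x → ℂ) :
    vol n h = ∫ _, (1 : ℝ) ∂(volumeMeasure n h) := by
  simp [vol]

/-- Along the segment `e^(tψ) h` the volume has derivative `-∫ Δ_t ψ dμ_t`, which is zero by Green's
formula against the constant 1. -/
theorem vol_rescale (hh : h ∈ posMetrics n L) {ψ : X → ℝ}
    (hψ : ContMDiff 𝓘(ℝ, Fin n → ℂ) 𝓘(ℝ, ℝ) ∞ ψ) (hk : rescale ψ h ∈ posMetrics n L) :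
    vol n (rescale ψ h) = vol n h := by
  have hd := hasDerivAt_integral_relVol hh hψ (continuous_const (y := (1 : ℝ)))
  have h0 : ∀ t ∈ Set.Icc (0 : ℝ) 1,
      ∫ x, 1 * relLap n h t ψ ψ x x ∂(volumeMeasure n h) = 0 := by
    intro t ht
    have hkt := rescale_mem_posMetrics_of_convex hψ hh hk ht
    rw [integral_relLap hh hψ hψ hkt continuous_const]
    simpa using integral_laplacian hkt hψ
  have hc := constant_of_has_deriv_right_zero (a := 0) (b := 1)
    (f := fun r => ∫ x, 1 * relVol n h r ψ x x ∂(volumeMeasure n h))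
    (fun t _ => (hd t).continuousAt.continuousWithinAt)
    (fun t ht => by
      have := hd t
      rw [h0 t ⟨ht.1, ht.2.le⟩, neg_zero] at this
      exact this.hasDerivWithinAt) 1 (by simp)
  rw [vol_eq_integral, vol_eq_integral, integral_rescale_one hh hψ hk continuous_const, hc]
  simp only [relVol_zero hh, mul_one]

theorem vol_eq_vol {k : ∀ x, L x → L x → ℂ} (hh : h ∈ posMetrics n L) (hk : k ∈ posMetrics n L) :
    vol n k = vol n h := by
  obtain ⟨ψ, hψ, rfl⟩ := exists_rescale_eq hh.1 hk.1
  exact vol_rescale hh hψ hk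

theorem vol_pos (hh : h ∈ posMetrics n L) : 0 < vol n h := by
  have := isFiniteMeasure_volumeMeasure hh
  have := isOpenPosMeasure_volumeMeasure hh
  exact ENNReal.toReal_pos (isOpen_univ.measure_pos _ Set.univ_nonempty).ne' (measure_ne_top _ _)

/-- The derivative of `t ↦ ∫ ψ dμ_t` is `-∫ ψ Δ_t ψ dμ_t ≥ 0`. As `∫ ψ dμ_t` is the derivative of
the energy along the segment, this is convexity of the energy. -/
theorem integral_le_integral_rescale (hh : h ∈ posMetrics n L) {ψ : X → ℝ}
    (hψ : ContMDiff 𝓘(ℝ, Fin n → ℂ) 𝓘(ℝ, ℝ) ∞ ψ) (hk : rescale ψ h ∈ posMetrics n L) {t : ℝ}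
    (ht : t ∈ Set.Icc (0 : ℝ) 1) :
    ∫ x, ψ x ∂(volumeMeasure n h) ≤
      ∫ x, ψ x ∂(volumeMeasure n (rescale (fun x => t * ψ x) h)) := by
  have hd := hasDerivAt_integral_relVol hh hψ hψ.continuous
  have hm : MonotoneOn (fun r => ∫ x, ψ x * relVol n h r ψ x x ∂(volumeMeasure n h))
      (Set.Icc 0 1) := by
    refine monotoneOn_of_deriv_nonneg (convex_Icc 0 1)
      (fun t _ => (hd t).continuousAt.continuousWithinAt)
      (fun t _ => (hd t).differentiableAt.differentiableWithinAt) fun t ht => ?_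
    have hkt := rescale_mem_posMetrics_of_convex hψ hh hk (interior_subset ht)
    rw [(hd t).deriv, integral_relLap hh hψ hψ hkt hψ.continuous]
    exact neg_nonneg.2 (integral_mul_laplacian_nonpos hkt hψ)
  have h1 := hm (Set.left_mem_Icc.2 zero_le_one) ht ht.1
  simp only [relVol_zero hh, mul_one] at h1
  rwa [integral_rescale hh hψ (rescale_mem_posMetrics_of_convex hψ hh hk ht) hψ.continuous]

/-- A convex function lies above its tangent at the initial point. The segment is reparametrized by
a smooth step function `σ` with values in `[0, 1]`: an energy may be differentiated only along paths
of positive metrics over an open interval, whereas positivity of `e^(tψ) h` is known only for `t` in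
`[0, 1]`. The speed `σ'` is nonnegative, so the comparison of integrals survives. -/
theorem IsEnergy.add_integral_le {I : (∀ x, L x → L x → ℂ) → ℝ} (hI : IsEnergy n I)
    (hh : h ∈ posMetrics n L) {ψ : X → ℝ} (hψ : ContMDiff 𝓘(ℝ, Fin n → ℂ) 𝓘(ℝ, ℝ) ∞ ψ)
    (hk : rescale ψ h ∈ posMetrics n L) :
    I h + ∫ x, ψ x ∂(volumeMeasure n h) ≤ I (rescale ψ h) := by
  have hσ : ContDiff ℝ ∞ Real.smoothTransition := Real.smoothTransition.contDiff (n := ⊤)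
  have hσd := fun t => (hσ.differentiable (by simp) t).hasDerivAt
  have hσI : ∀ t, Real.smoothTransition t ∈ Set.Icc (0 : ℝ) 1 := fun t =>
    ⟨Real.smoothTransition.nonneg t, Real.smoothTransition.le_one t⟩
  set C := ∫ x, ψ x ∂(volumeMeasure n h) with hC
  -- Any open interval containing `[0, 1]` would serve in place of `(-1, 2)`.
  have hd := hI h hh (-1) 2 (fun t x => Real.smoothTransition t * ψ x) (smoothPath_mul hσ hψ)
    fun t _ => rescale_mem_posMetrics_of_convex hψ hh hk (hσI t)
  have hd' : ∀ t ∈ Set.Icc (0 : ℝ) 1, HasDerivAt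
      (fun s => I (rescale (fun x => Real.smoothTransition s * ψ x) h) -
        Real.smoothTransition s * C)
      (deriv Real.smoothTransition t * ∫ x, ψ x
        ∂(volumeMeasure n (rescale (fun x => Real.smoothTransition t * ψ x) h)) -
        deriv Real.smoothTransition t * C) t := by
    intro t ht
    have h1 := hd t ⟨by linarith [ht.1], by linarith [ht.2]⟩
    have e : ∀ x, deriv (fun s => Real.smoothTransition s * ψ x) t =
        deriv Real.smoothTransition t * ψ x := fun x => ((hσd t).mul_const (ψ x)).deriv
    simp only [e, integral_const_mul] at h1
    exact h1.sub ((hσd t).mul_const C)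
  have hm := monotoneOn_of_deriv_nonneg (convex_Icc (0 : ℝ) 1)
    (fun t ht => (hd' t ht).continuousAt.continuousWithinAt)
    (fun t ht => (hd' t (interior_subset ht)).differentiableAt.differentiableWithinAt)
    (fun t ht => by
      rw [(hd' t (interior_subset ht)).deriv, ← mul_sub]
      exact mul_nonneg Real.smoothTransition.monotone.deriv_nonneg
        (sub_nonneg.2 (integral_le_integral_rescale hh hψ hk (hσI t))))
  have h1 := hm (Set.left_mem_Icc.2 zero_le_one) (Set.right_mem_Icc.2 zero_le_one) zero_le_one
  simp only [Real.smoothTransition.zero, Real.smoothTransition.one, zero_mul, one_mul,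
    rescale_zero, sub_zero] at h1
  linarith

/-- The energy of `e^ψ h` relative to `h`. -/
noncomputable def relEnergy (n : ℕ) {X : Type*} [TopologicalSpace X] [MeasurableSpace X]
    [ChartedSpace (Fin n → ℂ) X] {L : X → Type*} [∀ x, AddCommGroup (L x)]
    [∀ x, Module ℂ (L x)] [∀ x, TopologicalSpace (L x)]
    [TopologicalSpace (Bundle.TotalSpace ℂ L)] [FiberBundle ℂ L]
    (h : ∀ x, L x → L x → ℂ) (ψ : X → ℝ) : ℝ :=
  ∫ q : unitInterval × X, ψ q.2 * relVol n h q.1 ψ q.2 q.2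
    ∂((volume : Measure unitInterval).prod (volumeMeasure n h))

theorem integral_unitInterval_eq_sub {M M' : ℝ → ℝ} (hM : ∀ t, HasDerivAt M (M' t) t)
    (hM' : Continuous M') : ∫ t : unitInterval, M' t = M 1 - M 0 := by
  have h1 : ∫ t : unitInterval, M' t = ∫ t in Set.Icc (0 : ℝ) 1, M' t :=
    integral_subtype measurableSet_Icc M'
  rw [h1, integral_Icc_eq_integral_Ioc, ← intervalIntegral.integral_of_le zero_le_one]
  exact intervalIntegral.integral_eq_sub_of_hasDerivAt (fun t _ => hM t)
    (hM'.intervalIntegrable 0 1)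

/-- Let `υ` be the velocity of the path at time `s`, write `ψ` for `ψ s`, and let `B(t) = ∫ υ dμ_t`
along the segment from `h` to `e^ψ h`. Differentiating `∫ ψ dμ_t` in the direction `υ` gives `B(t) -
t ∫ ψ Δ_t υ dμ_t`. By Green's formula the second term is `t B'(t)`, so the sum is the derivative of
`t B(t)`, and integration over `[0, 1]` leaves `B(1)`. -/
theorem hasDerivAt_relEnergy (hh : h ∈ posMetrics n L) {a b : ℝ} {ψ : ℝ → X → ℝ}
    (hψ : SmoothPath n a b ψ) (hk : ∀ s ∈ Set.Ioo a b, rescale (ψ s) h ∈ posMetrics n L) {s : ℝ}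
    (hs : s ∈ Set.Ioo a b) :
    HasDerivAt (fun r => relEnergy n h (ψ r))
      (∫ x, pathDeriv ψ s x ∂(volumeMeasure n (rescale (ψ s) h))) s := by
  have hfin := isFiniteMeasure_volumeMeasure hh
  have : SecondCountableTopology X := ChartedSpace.secondCountable_of_sigmaCompact (Fin n → ℂ) X
  have hψs := hψ.slice hs
  have hυs := hψ.pathDeriv.slice hs
  have hcpsi : ∀ {υ : ℝ → X → ℝ}, SmoothPath n a b υ → ∀ q ∈ Set.Ioo a b ×ˢ
      (Set.univ : Set (unitInterval × X)), ContinuousAt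
      (fun q : ℝ × unitInterval × X => υ q.1 q.2.2) q := fun hυ q hq =>
    ContinuousAt.comp (f := fun q : ℝ × unitInterval × X => (q.1, q.2.2)) (x := q)
      (hυ.continuousAt hq.1 q.2.2) (by fun_prop)
  have hcvol : ∀ q ∈ Set.Ioo a b ×ˢ (Set.univ : Set (unitInterval × X)), ContinuousAt
      (fun q : ℝ × unitInterval × X => relVol n h q.2.1 (ψ q.1) q.2.2 q.2.2) q := fun q hq =>
    ContinuousAt.comp (f := fun q : ℝ × unitInterval × X => (q.1, (q.2.1 : ℝ), q.2.2)) (x := q)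
      (continuousAt_relVol_joint hh hψ hq.1 q.2.1 q.2.2) (by fun_prop)
  have hclap : ∀ q ∈ Set.Ioo a b ×ˢ (Set.univ : Set (unitInterval × X)), ContinuousAt
      (fun q : ℝ × unitInterval × X => relLap n h q.2.1 (ψ q.1) (pathDeriv ψ q.1) q.2.2 q.2.2) q :=
    fun q hq =>
    ContinuousAt.comp (f := fun q : ℝ × unitInterval × X => (q.1, (q.2.1 : ℝ), q.2.2)) (x := q)
      (continuousAt_relLap_joint hh hψ hψ.pathDeriv hq.1 q.2.1 q.2.2) (by fun_prop)
  have hcF' : ContinuousOn (fun q : ℝ × unitInterval × X =>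
      pathDeriv ψ q.1 q.2.2 * relVol n h q.2.1 (ψ q.1) q.2.2 q.2.2 +
        ψ q.1 q.2.2 * -(q.2.1 * relLap n h q.2.1 (ψ q.1) (pathDeriv ψ q.1) q.2.2 q.2.2))
      (Set.Ioo a b ×ˢ Set.univ) := by
    intro q hq
    have ht : ContinuousAt (fun q : ℝ × unitInterval × X => (q.2.1 : ℝ)) q := by fun_prop
    exact (((hcpsi hψ.pathDeriv q hq).mul (hcvol q hq)).add ((hcpsi hψ q hq).mul
      (ht.mul (hclap q hq)).neg)).continuousWithinAt
  have hder := hasDerivAt_integral_of_continuousOn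
    (ν := (volume : Measure unitInterval).prod (volumeMeasure n h)) (a := a) (b := b)
    (F := fun r q => ψ r q.2 * relVol n h q.1 (ψ r) q.2 q.2)
    (F' := fun r q => pathDeriv ψ r q.2 * relVol n h q.1 (ψ r) q.2 q.2 +
      ψ r q.2 * -(q.1 * relLap n h q.1 (ψ r) (pathDeriv ψ r) q.2 q.2))
    (fun q hq => ((hcpsi hψ q hq).mul (hcvol q hq)).continuousWithinAt) hcF'
    (fun r hr q => (hψ.hasDerivAt hr q.2).mul (hasDerivAt_relVol_path hψ hr h q.1 q.2)) hs
  refine hder.congr_deriv ?_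
  have hcs : Continuous fun q : unitInterval × X =>
      pathDeriv ψ s q.2 * relVol n h q.1 (ψ s) q.2 q.2 +
        ψ s q.2 * -(q.1 * relLap n h q.1 (ψ s) (pathDeriv ψ s) q.2 q.2) :=
    hcF'.comp_continuous (Continuous.prodMk_right s) fun q => ⟨hs, trivial⟩
  rw [integral_prod _ (hcs.integrable_of_hasCompactSupport (HasCompactSupport.of_compactSpace _))]
  have hinner : ∀ t : unitInterval,
      ∫ x, (pathDeriv ψ s x * relVol n h t (ψ s) x x +
        ψ s x * -(t * relLap n h t (ψ s) (pathDeriv ψ s) x x)) ∂(volumeMeasure n h) =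
      1 * ∫ x, pathDeriv ψ s x * relVol n h t (ψ s) x x ∂(volumeMeasure n h) +
        t * -∫ x, pathDeriv ψ s x * relLap n h t (ψ s) (ψ s) x x ∂(volumeMeasure n h) := by
    intro t
    have hkt := rescale_mem_posMetrics_of_convex hψs hh (hk s hs) t.2
    have hcl : Continuous fun x => ψ s x * relLap n h t (ψ s) (pathDeriv ψ s) x x :=
      Continuous.comp (g := fun q : ℝ × X => ψ s q.2 * relLap n h q.1 (ψ s) (pathDeriv ψ s) q.2 q.2)
        (f := fun x => ((t : ℝ), x))
        (continuous_mul_relLap_param hh hψs hυs hψs.continuous) (by fun_prop)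
    -- Green's formula for the intermediate metric `e^(tψ) h`, which is positive because `t` lies in
    -- `[0, 1]`.
    have hsymm : ∫ x, ψ s x * relLap n h t (ψ s) (pathDeriv ψ s) x x ∂(volumeMeasure n h) =
        ∫ x, pathDeriv ψ s x * relLap n h t (ψ s) (ψ s) x x ∂(volumeMeasure n h) := by
      rw [integral_relLap hh hψs hυs hkt hψs.continuous,
        integral_relLap hh hψs hψs hkt hυs.continuous, integral_green hkt hψs hυs]
    have e : ∀ x, ψ s x * -(t * relLap n h t (ψ s) (pathDeriv ψ s) x x) =
        (-t : ℝ) * (ψ s x * relLap n h t (ψ s) (pathDeriv ψ s) x x) := fun x => by ring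
    simp only [e]
    rw [integral_add (integrable_volumeMeasure hh
      (hυs.continuous.fun_mul (continuous_relVol hh hψs t)))
      ((integrable_volumeMeasure hh hcl).const_mul _), integral_const_mul, hsymm]
    ring
  simp only [hinner]
  have hB := hasDerivAt_integral_relVol hh hψs hυs.continuous
  have hBc : Continuous fun t => ∫ x, pathDeriv ψ s x * relVol n h t (ψ s) x x
      ∂(volumeMeasure n h) :=
    continuous_iff_continuousAt.2 fun t => (hB t).continuousAt
  have hLc : Continuous fun t => ∫ x, pathDeriv ψ s x * relLap n h t (ψ s) (ψ s) x x
      ∂(volumeMeasure n h) := by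
    have := continuous_parametric_integral_of_continuous (μ := volumeMeasure n h)
      (f := fun t x => pathDeriv ψ s x * relLap n h t (ψ s) (ψ s) x x)
      (continuous_mul_relLap_param hh hψs hψs hυs.continuous) isCompact_univ
    simpa only [Measure.restrict_univ] using this
  -- The primitive is `t B(t)`: it vanishes at 0, and at 1 it is the integral against the volume of
  -- the endpoint metric.
  rw [integral_unitInterval_eq_sub (M := fun t => t * ∫ x, pathDeriv ψ s x * relVol n h t (ψ s) x x
      ∂(volumeMeasure n h)) (M' := fun t =>
      1 * ∫ x, pathDeriv ψ s x * relVol n h t (ψ s) x x ∂(volumeMeasure n h) +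
        t * -∫ x, pathDeriv ψ s x * relLap n h t (ψ s) (ψ s) x x ∂(volumeMeasure n h))
      (fun t => (hasDerivAt_id t).mul (hB t))
      ((continuous_const.mul hBc).add (continuous_id.mul hLc.neg)),
    integral_rescale_one hh hψs (hk s hs) hυs.continuous]
  simp

theorem exists_isEnergy (hh : h ∈ posMetrics n L) :
    ∃ I : (∀ x, L x → L x → ℂ) → ℝ, IsEnergy n I := by
  have hlog : ∀ φ : X → ℝ, (fun x => Real.log (frameSq (rescale φ h) x x / frameSq h x x)) = φ := by
    intro φ
    ext x
    have hx := hh.1.frameSq_pos (FiberBundle.mem_baseSet_trivializationAt ℂ L x)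
    rw [frameSq_rescale, mul_div_cancel_right₀ _ hx.ne', Real.log_exp]
  -- The energy of `k = e^ψ h` is the energy relative to the base metric `h`, with `ψ` recovered as
  -- the logarithm of the ratio of norms. Values at other `k` are irrelevant.
  refine ⟨fun k => relEnergy n h fun x => Real.log (frameSq k x x / frameSq h x x), ?_⟩
  intro h₀ hh₀ a b φ hφ hK t ht
  -- A path starting from another metric is a path from `h` shifted by the constant-in-time function
  -- `ψ₀`, which does not change the velocity.
  obtain ⟨ψ₀, hψ₀, rfl⟩ := exists_rescale_eq hh.1 hh₀.1
  simp only [rescale_rescale] at hK ⊢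
  simp only [hlog]
  have hpath : SmoothPath n a b fun s x => φ s x + ψ₀ x :=
    ContMDiffOn.add hφ (hψ₀.comp contMDiff_snd).contMDiffOn
  have h1 := hasDerivAt_relEnergy hh hpath hK ht
  refine h1.congr_deriv ?_
  congr 1
  ext x
  simp only [pathDeriv, deriv_add_const]

end Energy

end BalancedMetrics

namespace BalancedMetrics

open MeasureTheory

/-! ### Positivity of `i∂∂̄ log ∑ |f_α|²` -/

section LogSum

variable {n : ℕ}

theorem complexHessian_log {S : (Fin n → ℂ) → ℝ} {z : Fin n → ℂ} (hS : ContDiffAt ℝ 2 S z)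
    (h0 : S z ≠ 0) (j k : Fin n) :
    complexHessian (fun w => ((Real.log (S w) : ℝ) : ℂ)) z j k =
      complexHessian (fun w => (S w : ℂ)) z j k / (S z : ℂ) -
        wirtinger j (fun w => (S w : ℂ)) z * wirtingerBar k (fun w => (S w : ℂ)) z /
          (S z : ℂ) ^ 2 := by
  have hc : ContDiffAt ℝ 2 (fun w => (S w : ℂ)) z := contDiffAt_ofReal hS
  have hd := hS.differentiableAt (by simp)
  have hdc := hc.differentiableAt (by simp)
  have h0c : (S z : ℂ) ≠ 0 := Complex.ofReal_ne_zero.2 h0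
  have hev : (fun w => wirtingerBar k (fun y => ((Real.log (S y) : ℝ) : ℂ)) w) =ᶠ[nhds z]
      fun w => wirtingerBar k (fun y => (S y : ℂ)) w * ((S w : ℂ))⁻¹ := by
    filter_upwards [hS.eventually (by simp), hd.continuousAt.eventually_ne h0] with w h1 h2
    rw [wirtingerBar_log k (h1.differentiableAt (by simp)) h2, div_eq_mul_inv]
  simp only [complexHessian, Matrix.of_apply]
  rw [wirtinger_congr hev, wirtinger_mul j (differentiableAt_wirtingerBar hc k)
    (hdc.fun_inv h0c), wirtinger_inv j hdc h0c]
  field_simp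
  ring

variable {ι : Type*} [Fintype ι]

theorem ofReal_sum_norm_sq (v : ι → ℂ) :
    ((∑ α, ‖v α‖ ^ 2 : ℝ) : ℂ) = ∑ α, v α * conj (v α) := by
  rw [Complex.ofReal_sum]
  exact Finset.sum_congr rfl fun α _ => by rw [Complex.mul_conj, Complex.normSq_eq_norm_sq]

variable {f : ι → (Fin n → ℂ) → ℂ} {z : Fin n → ℂ}

theorem wirtingerBar_sum_norm_sq (hf : ∀ α, DifferentiableAt ℂ (f α) z) (k : Fin n) :
    wirtingerBar k (fun w => ((∑ α, ‖f α w‖ ^ 2 : ℝ) : ℂ)) z =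
      ∑ α, f α z * conj (fderiv ℂ (f α) z (Pi.single k 1)) := by
  have hr := fun α => (hf α).restrictScalars ℝ
  have hc : ∀ α, DifferentiableAt ℝ (fun w => conj (f α w)) z := fun α =>
    Complex.conjCLE.differentiableAt.comp z (hr α)
  simp only [ofReal_sum_norm_sq]
  rw [wirtingerBar_sum k _ fun α _ => (hr α).fun_mul (hc α)]
  refine Finset.sum_congr rfl fun α _ => ?_
  rw [wirtingerBar_mul k (hr α) (hc α), wirtingerBar_conj k (hr α),
    wirtingerBar_holomorphic k (hf α), wirtinger_holomorphic k (hf α), zero_mul, add_zero]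

theorem wirtinger_sum_norm_sq (hf : ∀ α, DifferentiableAt ℂ (f α) z) (k : Fin n) :
    wirtinger k (fun w => ((∑ α, ‖f α w‖ ^ 2 : ℝ) : ℂ)) z =
      ∑ α, fderiv ℂ (f α) z (Pi.single k 1) * conj (f α z) := by
  have hr := fun α => (hf α).restrictScalars ℝ
  have hc : ∀ α, DifferentiableAt ℝ (fun w => conj (f α w)) z := fun α =>
    Complex.conjCLE.differentiableAt.comp z (hr α)
  simp only [ofReal_sum_norm_sq]
  rw [wirtinger_sum k _ fun α _ => (hr α).fun_mul (hc α)]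
  refine Finset.sum_congr rfl fun α _ => ?_
  rw [wirtinger_mul k (hr α) (hc α), wirtinger_conj k (hr α),
    wirtingerBar_holomorphic k (hf α), wirtinger_holomorphic k (hf α), map_zero, mul_zero, zero_add]

theorem complexHessian_sum_norm_sq (hf : ∀ α, ContDiffAt ℂ 2 (f α) z) (j k : Fin n) :
    complexHessian (fun w => ((∑ α, ‖f α w‖ ^ 2 : ℝ) : ℂ)) z j k =
      ∑ α, fderiv ℂ (f α) z (Pi.single j 1) * conj (fderiv ℂ (f α) z (Pi.single k 1)) := by
  have hd := fun α => (hf α).differentiableAt (by simp)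
  have hev : (fun w => wirtingerBar k (fun w => ((∑ α, ‖f α w‖ ^ 2 : ℝ) : ℂ)) w) =ᶠ[nhds z]
      fun w => ∑ α, f α w * conj (fderiv ℂ (f α) w (Pi.single k 1)) := by
    filter_upwards [Filter.eventually_all.2 fun α => (hf α).eventually (by simp)] with w h1
    exact wirtingerBar_sum_norm_sq (fun α => (h1 α).differentiableAt (by simp)) k
  have h2 : ∀ α, DifferentiableAt ℂ (fun w => fderiv ℂ (f α) w (Pi.single k 1)) z := fun α =>
    (((hf α).fderiv_right (m := 1) (by norm_num)).differentiableAt (by simp)).clm_apply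
      (differentiableAt_const _)
  have hc : ∀ α, DifferentiableAt ℝ (fun w => conj (fderiv ℂ (f α) w (Pi.single k 1))) z :=
    fun α => Complex.conjCLE.differentiableAt.comp z ((h2 α).restrictScalars ℝ)
  simp only [complexHessian, Matrix.of_apply]
  rw [wirtinger_congr hev, wirtinger_sum j _ fun α _ =>
    ((hd α).restrictScalars ℝ).fun_mul (hc α)]
  refine Finset.sum_congr rfl fun α _ => ?_
  rw [wirtinger_mul j ((hd α).restrictScalars ℝ) (hc α), wirtinger_conj j
    ((h2 α).restrictScalars ℝ), wirtingerBar_holomorphic j (h2 α), map_zero, mul_zero, zero_add,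
    wirtinger_holomorphic j (hd α)]

/-- The Fubini-Study form of an immersion into projective space is positive. -/
theorem posDef_complexHessian_log_sum (hf : ∀ α, ContDiffAt ℂ 2 (f α) z)
    (h0 : ∃ α, f α z ≠ 0)
    (him : ∀ (w : Fin n → ℂ) (c : ℂ), (∀ α, fderiv ℂ (f α) z w = c * f α z) → w = 0) :
    (complexHessian (fun w => ((Real.log (∑ α, ‖f α w‖ ^ 2) : ℝ) : ℂ)) z).PosDef := by
  have hd := fun α => (hf α).differentiableAt (by simp)
  have hS : ContDiffAt ℝ 2 (fun w => ∑ α, ‖f α w‖ ^ 2) z :=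
    ContDiffAt.sum fun α _ => ((hf α).restrict_scalars ℝ).norm_sq ℝ
  have hpos : 0 < ∑ α, ‖f α z‖ ^ 2 := by
    obtain ⟨α, hα⟩ := h0
    exact Finset.sum_pos' (fun _ _ => by positivity) ⟨α, Finset.mem_univ _, by positivity⟩
  set S : ℂ := ((∑ α, ‖f α z‖ ^ 2 : ℝ) : ℂ) with hSdef
  have hSsum : ∑ α, f α z * conj (f α z) = S := (ofReal_sum_norm_sq _).symm
  have hS0 : S ≠ 0 := Complex.ofReal_ne_zero.2 hpos.ne'
  have hSc : conj S = S := Complex.conj_ofReal _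
  set D : Fin n → ι → ℂ := fun j α => fderiv ℂ (f α) z (Pi.single j 1) with hD
  set a : Fin n → ℂ := fun j => ∑ α, D j α * conj (f α z) with ha
  -- The rows of `Q` are the partial derivatives of the vector `(f_α)` with their components along
  -- `(f_α)` itself projected away. The Hessian is `S⁻¹` times their Gram matrix.
  set Q : Matrix (Fin n) ι ℂ := Matrix.of fun j α => D j α - a j / S * f α z with hQ
  have hac : ∀ k, conj (a k) = ∑ α, f α z * conj (D k α) := fun k => by
    simp only [ha, map_sum, map_mul, Complex.conj_conj, mul_comm]
  have key : complexHessian (fun w => ((Real.log (∑ α, ‖f α w‖ ^ 2) : ℝ) : ℂ)) z =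
      (∑ α, ‖f α z‖ ^ 2 : ℝ)⁻¹ • (Q * Q.conjTranspose) := by
    ext j k
    rw [complexHessian_log hS hpos.ne', complexHessian_sum_norm_sq hf,
      wirtinger_sum_norm_sq hd, wirtingerBar_sum_norm_sq hd, ← hSdef, Matrix.smul_apply,
      Matrix.mul_apply]
    have e : ∀ α, Q j α * Q.conjTranspose α k = D j α * conj (D k α)
        - conj (a k) / S * (D j α * conj (f α z)) - a j / S * (f α z * conj (D k α))
        + a j * conj (a k) / S ^ 2 * (f α z * conj (f α z)) := fun α => by
      simp only [hQ, Matrix.conjTranspose_apply, Matrix.of_apply, RCLike.star_def, map_sub, map_mul,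
        map_div₀, hSc]
      ring
    simp only [e, Finset.sum_add_distrib, Finset.sum_sub_distrib, ← Finset.mul_sum, hSsum]
    rw [← hac, Complex.real_smul, Complex.ofReal_inv, ← hSdef]
    change _ / S - a j * _ / S ^ 2 = S⁻¹ * (_ - _ * a j - _ + _)
    field_simp
    ring
  rw [key]
  refine Matrix.PosDef.smul (Matrix.PosDef.mul_conjTranspose_self Q ?_) (inv_pos.2 hpos)
  -- A kernel vector `w` is a direction in which the derivative of `(f_α)` is a multiple of `(f_α)`;
  -- the witness is the coefficient of the projection along `w`.
  refine (injective_iff_map_eq_zero (Matrix.vecMulLinear Q)).2 fun w hw => him w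
    ((∑ j, w j * a j) / S) fun α => ?_
  have h1 := congrFun hw α
  simp only [Matrix.vecMulLinear_apply, Matrix.vecMul, dotProduct, hQ, Matrix.of_apply, mul_sub,
    Finset.sum_sub_distrib, Pi.zero_apply, sub_eq_zero] at h1
  have h2 : fderiv ℂ (f α) z w = ∑ j, w j * D j α := by
    conv_lhs => rw [pi_eq_sum_univ' w]
    simp only [map_sum, map_smul, smul_eq_mul, hD]
  rw [h2, h1, Finset.sum_div, Finset.sum_mul]
  exact Finset.sum_congr rfl fun j _ => by ring

end LogSum

/-! ### Holomorphic sections in local trivializations -/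

section Sections

variable {n : ℕ} {X : Type*} [TopologicalSpace X] [ChartedSpace (Fin n → ℂ) X]
  [IsManifold 𝓘(ℂ, Fin n → ℂ) ω X]
  {L : X → Type*} [∀ x, AddCommGroup (L x)] [∀ x, Module ℂ (L x)]
  [∀ x, TopologicalSpace (L x)] [TopologicalSpace (Bundle.TotalSpace ℂ L)]
  [FiberBundle ℂ L] [VectorBundle ℂ ℂ L] [ContMDiffVectorBundle ω ℂ L 𝓘(ℂ, Fin n → ℂ)]
  {p x : X}

theorem contMDiffAt_coord_section (s : Cₛ^ω⟮𝓘(ℂ, Fin n → ℂ); ℂ, L⟯)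
    (hx : x ∈ (trivializationAt ℂ L p).baseSet) :
    ContMDiffAt 𝓘(ℂ, Fin n → ℂ) 𝓘(ℂ, ℂ) ω (fun y => coord p y (s y)) x :=
  ((trivializationAt ℂ L p).contMDiffAt_section_iff hx).1 (s.contMDiff x)

theorem coord_eq_coord_frame_mul {q : X} (hp : x ∈ (trivializationAt ℂ L p).baseSet)
    (hq : x ∈ (trivializationAt ℂ L q).baseSet) (v : L x) :
    coord q x v = coord q x (frame p x : L x) * coord p x v := by
  conv_lhs => rw [eq_coord_smul_frame hp v]
  rw [coord_smul hq, mul_comm]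

theorem IsHermitianMetric.continuous_section {h : ∀ x, L x → L x → ℂ} (hh : IsHermitianMetric n h)
    (s t : Cₛ^ω⟮𝓘(ℂ, Fin n → ℂ); ℂ, L⟯) : Continuous fun x => h x (s x) (t x) := by
  refine continuous_iff_continuousAt.2 fun x => ?_
  have hx := FiberBundle.mem_baseSet_trivializationAt ℂ L x
  have h1 : ContinuousAt (fun y => conj (coord x y (s y)) * coord x y (t y) *
      (frameSq h x y : ℂ)) x :=
    ((Complex.continuous_conj.continuousAt.comp
      (contMDiffAt_coord_section s hx).continuousAt).mul
      (contMDiffAt_coord_section t hx).continuousAt).mul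
      (Complex.continuous_ofReal.continuousAt.comp (hh.contMDiffAt_frameSq hx).continuousAt)
  refine h1.congr ?_
  filter_upwards [(trivializationAt ℂ L x).open_baseSet.mem_nhds hx] with y hy
  exact (hh.apply_eq hy _ _).symm

variable {E : Submodule ℂ Cₛ^ω⟮𝓘(ℂ, Fin n → ℂ); ℂ, L⟯}

/-- The function `∑ |s_α|²` for a basis `(s_α)` of `E`, computed in the trivialization at `p`. -/
noncomputable def basisSq {ι : Type*} [Fintype ι] (e : Module.Basis ι ℂ E) (p x : X) : ℝ :=
  ∑ α, ‖coord p x ((e α).1 x)‖ ^ 2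

variable {ι : Type*} [Fintype ι] (e : Module.Basis ι ℂ E)

/-- Evaluation of sections of `E` at `x`, in the trivialization at `p`. -/
noncomputable def evalCoord (E : Submodule ℂ Cₛ^ω⟮𝓘(ℂ, Fin n → ℂ); ℂ, L⟯) {p x : X}
    (hx : x ∈ (trivializationAt ℂ L p).baseSet) : E →ₗ[ℂ] ℂ where
  toFun s := coord p x (s.1 x)
  map_add' _ _ := coord_add hx _ _
  map_smul' _ _ := coord_smul hx _ _

theorem exists_basis_coord_ne_zero (hE : GivesEmbedding E)
    (hx : x ∈ (trivializationAt ℂ L p).baseSet) : ∃ α, coord p x ((e α).1 x) ≠ 0 := by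
  by_contra! hc
  obtain ⟨s, hs, hsx⟩ := hE.basePointFree x
  have : evalCoord E hx = 0 := e.ext fun α => hc α
  exact coord_ne_zero hx hsx (LinearMap.congr_fun this ⟨s, hs⟩)

theorem basisSq_pos (hE : GivesEmbedding E) (hx : x ∈ (trivializationAt ℂ L p).baseSet) :
    0 < basisSq e p x := by
  obtain ⟨α, hα⟩ := exists_basis_coord_ne_zero e hE hx
  exact Finset.sum_pos' (fun _ _ => by positivity) ⟨α, Finset.mem_univ _, by positivity⟩

theorem basisSq_transition {q : X} (hp : x ∈ (trivializationAt ℂ L p).baseSet)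
    (hq : x ∈ (trivializationAt ℂ L q).baseSet) :
    basisSq e q x = ‖coord q x (frame p x : L x)‖ ^ 2 * basisSq e p x := by
  simp only [basisSq, Finset.mul_sum]
  exact Finset.sum_congr rfl fun α _ => by
    rw [coord_eq_coord_frame_mul hp hq, norm_mul, mul_pow]

theorem contMDiffAt_basisSq (hx : x ∈ (trivializationAt ℂ L p).baseSet) :
    ContMDiffAt 𝓘(ℝ, Fin n → ℂ) 𝓘(ℝ, ℝ) ∞ (basisSq e p) x := by
  have h1 : ∀ α, ContMDiffAt 𝓘(ℝ, Fin n → ℂ) 𝓘(ℝ, ℝ) ∞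
      (fun y => ‖coord p y ((e α).1 y)‖ ^ 2) x := fun α =>
    (contDiff_norm_sq ℝ (E := ℂ)).contMDiff.contMDiffAt.comp x
      (contMDiffAt_real_of_complex (contMDiffAt_coord_section (e α).1 hx))
  exact contMDiffAt_finsetSum fun α _ => h1 α

/-- The derivative at `x`, in the direction `w`, of sections of `E` in the chart and the
trivialization at `x`. -/
theorem exists_derivCoord (E : Submodule ℂ Cₛ^ω⟮𝓘(ℂ, Fin n → ℂ); ℂ, L⟯) (x : X)
    (w : Fin n → ℂ) : ∃ D : E →ₗ[ℂ] ℂ, ∀ s, D s =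
      fderiv ℂ (fun z => coord x ((chartAt (Fin n → ℂ) x).symm z)
        (s.1 ((chartAt (Fin n → ℂ) x).symm z))) (chartAt (Fin n → ℂ) x x) w := by
  have hx := FiberBundle.mem_baseSet_trivializationAt ℂ L x
  have hd : ∀ s : E, DifferentiableAt ℂ (fun z => coord x ((chartAt (Fin n → ℂ) x).symm z)
      (s.1 ((chartAt (Fin n → ℂ) x).symm z))) (chartAt (Fin n → ℂ) x x) := fun s =>
    (contDiffAt_comp_chart_symm (mem_chart_source _ x)
      (contMDiffAt_coord_section s.1 hx)).differentiableAt (by simp)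
  have hev := eventually_chart_symm_mem (mem_chart_source (Fin n → ℂ) x)
    ((trivializationAt ℂ L x).open_baseSet.mem_nhds hx)
  refine ⟨⟨⟨fun s => fderiv ℂ (fun z => coord x ((chartAt (Fin n → ℂ) x).symm z)
    (s.1 ((chartAt (Fin n → ℂ) x).symm z))) (chartAt (Fin n → ℂ) x x) w, fun s t => ?_⟩,
    fun c s => ?_⟩, fun s => rfl⟩
  · rw [← add_apply, ← fderiv_fun_add (hd s) (hd t)]
    congr 1
    refine Filter.EventuallyEq.fderiv_eq ?_
    filter_upwards [hev] with z hz using coord_add hz _ _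
  · simp only [RingHom.id_apply]
    rw [← smul_apply, ← fderiv_fun_const_smul (hd s)]
    congr 1
    refine Filter.EventuallyEq.fderiv_eq ?_
    filter_upwards [hev] with z hz using coord_smul hz _ _

theorem mfderiv_section (s : Cₛ^ω⟮𝓘(ℂ, Fin n → ℂ); ℂ, L⟯) (x : X) (w : Fin n → ℂ) :
    mfderiv 𝓘(ℂ, Fin n → ℂ) 𝓘(ℂ, ℂ) (fun y => coord x y (s y)) x w =
      fderiv ℂ (fun z => coord x ((chartAt (Fin n → ℂ) x).symm z)
        (s ((chartAt (Fin n → ℂ) x).symm z))) (chartAt (Fin n → ℂ) x x) w := by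
  have hm := (contMDiffAt_coord_section s
    (FiberBundle.mem_baseSet_trivializationAt ℂ L x)).mdifferentiableAt (by simp)
  rw [hm.mfderiv]
  simp [writtenInExtChartAt, Function.comp_def, fderivWithin_univ]
  rfl

end Sections

end BalancedMetrics

namespace BalancedMetrics

open MeasureTheory

/-! ### The Fubini-Study metric -/

section FubiniStudy

variable {n : ℕ} {X : Type*} [TopologicalSpace X] [ChartedSpace (Fin n → ℂ) X]
  [IsManifold 𝓘(ℂ, Fin n → ℂ) ω X]
  {L : X → Type*} [∀ x, AddCommGroup (L x)] [∀ x, Module ℂ (L x)]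
  [∀ x, TopologicalSpace (L x)] [TopologicalSpace (Bundle.TotalSpace ℂ L)]
  [FiberBundle ℂ L] [VectorBundle ℂ ℂ L] [ContMDiffVectorBundle ω ℂ L 𝓘(ℂ, Fin n → ℂ)]
  {E : Submodule ℂ Cₛ^ω⟮𝓘(ℂ, Fin n → ℂ); ℂ, L⟯} [FiniteDimensional ℂ E]

theorem fubiniStudy_self_re (H : HermitianForms E) (x : X) (v : L x) :
    (fubiniStudy E H x v v).re = ‖coord x x v‖ ^ 2 / basisSq (orthonormalBasis H) x x := by
  rw [fubiniStudy, ← Complex.normSq_eq_conj_mul_self, Complex.normSq_eq_norm_sq,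
    ← Complex.ofReal_div, Complex.ofReal_re, basisSq]

/-- The metric is defined at `x` through the trivialization centred at `x`, which moves with the
point. Both `|v|²` and `∑ |s_α|²` scale by the same transition factor, so a fixed trivialization may
be used instead. -/
theorem frameSq_fubiniStudy (H : HermitianForms E) {p x : X}
    (hx : x ∈ (trivializationAt ℂ L p).baseSet) :
    frameSq (fubiniStudy E H) p x = (basisSq (orthonormalBasis H) p x)⁻¹ := by
  have hxx := FiberBundle.mem_baseSet_trivializationAt ℂ L x
  have h0 : ‖coord x x (frame p x : L x)‖ ^ 2 ≠ 0 :=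
    pow_ne_zero 2 (norm_ne_zero_iff.2 (coord_ne_zero hxx (frame_ne_zero hx)))
  rw [frameSq, fubiniStudy_self_re, basisSq_transition _ hx hxx, div_mul_eq_div_div, div_self h0,
    one_div]

theorem isHermitianMetric_fubiniStudy (hE : GivesEmbedding E) (H : HermitianForms E) :
    IsHermitianMetric n (fubiniStudy E H) where
  add_right x u v w := by
    simp only [fubiniStudy, coord_add (FiberBundle.mem_baseSet_trivializationAt ℂ L x)]
    ring
  smul_right x c u v := by
    simp only [fubiniStudy, coord_smul (FiberBundle.mem_baseSet_trivializationAt ℂ L x)]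
    ring
  conj_symm x u v := by
    simp only [fubiniStudy, map_div₀, map_mul, Complex.conj_conj, Complex.conj_ofReal]
    ring
  pos x v hv := by
    have hx := FiberBundle.mem_baseSet_trivializationAt ℂ L x
    rw [fubiniStudy_self_re]
    have := norm_pos_iff.2 (coord_ne_zero hx hv)
    have := basisSq_pos (orthonormalBasis H) hE hx
    positivity
  smooth p x hx := by
    refine ContMDiffAt.contMDiffWithinAt ?_
    refine ((contMDiffAt_basisSq (orthonormalBasis H) hx).inv₀
      (basisSq_pos (orthonormalBasis H) hE hx).ne').congr_of_eventuallyEq ?_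
    filter_upwards [(trivializationAt ℂ L p).open_baseSet.mem_nhds hx] with y hy
      using frameSq_fubiniStudy H hy

/-- In a local frame `log |e|² = -log ∑ |s_α|²`, so the Kähler matrix is the Hessian of `log ∑
|s_α|²`. It is positive because `E` has no base points and separates tangent directions. -/
theorem fubiniStudy_mem_posMetrics (hE : GivesEmbedding E) (H : HermitianForms E) :
    fubiniStudy E H ∈ posMetrics n L := by
  refine mem_posMetrics_of_posDef_self (isHermitianMetric_fubiniStudy hE H) fun x => ?_
  have hx := FiberBundle.mem_baseSet_trivializationAt ℂ L x
  set e := orthonormalBasis H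
  set f : Fin (Module.finrank ℂ E) → (Fin n → ℂ) → ℂ := fun α z =>
    coord x ((chartAt (Fin n → ℂ) x).symm z) ((e α).1 ((chartAt (Fin n → ℂ) x).symm z)) with hf
  have hfx : ∀ α, f α (chartAt (Fin n → ℂ) x x) = evalCoord E hx (e α) := fun α => by
    simp only [hf]
    rw [(chartAt (Fin n → ℂ) x).left_inv (mem_chart_source _ x)]
    rfl
  have hev : logNormSq (fubiniStudy E H) x =ᶠ[nhds (chartAt (Fin n → ℂ) x x)]
      fun z => (-1 : ℂ) * ((Real.log (∑ α, ‖f α z‖ ^ 2) : ℝ) : ℂ) := by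
    filter_upwards [eventually_chart_symm_mem (mem_chart_source (Fin n → ℂ) x)
      ((trivializationAt ℂ L x).open_baseSet.mem_nhds hx)] with z hz
    simp only [logNormSq_def]
    rw [frameSq_fubiniStudy H hz, Real.log_inv, Complex.ofReal_neg, neg_one_mul]
    rfl
  rw [kahlerMatrix, complexHessian_congr hev, complexHessian_const_mul, neg_one_smul, neg_neg]
  refine posDef_complexHessian_log_sum (fun α => ?_) ?_ fun w c hc => ?_
  · exact (contDiffAt_comp_chart_symm (mem_chart_source _ x)
      (contMDiffAt_coord_section (e α).1 hx)).of_le le_top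
  · obtain ⟨α, hα⟩ := exists_basis_coord_ne_zero e hE hx
    exact ⟨α, by rw [hfx]; exact hα⟩
  -- If differentiation along `w` is `c` times evaluation on a basis, it is so on all of `E`. Then
  -- every section vanishing at `x` has zero derivative along `w`, against immersivity.
  · by_contra hw
    obtain ⟨s, hs, hsx, hsw⟩ := hE.immersive x w hw
    obtain ⟨D, hD⟩ := exists_derivCoord E x w
    have h1 : D = c • evalCoord E hx := e.ext fun α => by
      rw [hD, LinearMap.smul_apply, ← hfx, smul_eq_mul]
      exact hc α
    apply hsw
    have h2 := LinearMap.congr_fun h1 ⟨s, hs⟩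
    rw [mfderiv_section, ← hD ⟨s, hs⟩, h2, LinearMap.smul_apply]
    have h3 : evalCoord E hx ⟨s, hs⟩ = 0 := by
      change coord x x (s x) = 0
      rw [hsx, coord_zero hx]
    rw [h3, smul_zero]
    rfl

theorem sum_fubiniStudy (hE : GivesEmbedding E) (H : HermitianForms E) (x : X) :
    ∑ α, (fubiniStudy E H x ((orthonormalBasis H α).1 x) ((orthonormalBasis H α).1 x)).re = 1 := by
  simp only [fubiniStudy_self_re]
  rw [← Finset.sum_div, ← basisSq, div_self]
  exact (basisSq_pos _ hE (FiberBundle.mem_baseSet_trivializationAt ℂ L x)).ne'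

theorem finrank_pos_of_givesEmbedding [Nonempty X] (hE : GivesEmbedding E) :
    0 < Module.finrank ℂ E := by
  obtain ⟨α, _⟩ := exists_basis_coord_ne_zero (Module.finBasis ℂ E) hE
    (FiberBundle.mem_baseSet_trivializationAt ℂ L (Classical.arbitrary X))
  exact α.pos

end FubiniStudy

/-! ### The Hermitian form `Hilb(h)` -/

section Hilb

variable {n : ℕ} {X : Type*} [TopologicalSpace X] [CompactSpace X] [T2Space X] [Nonempty X]
  [ChartedSpace (Fin n → ℂ) X]
  [IsManifold 𝓘(ℂ, Fin n → ℂ) ω X] [MeasurableSpace X] [BorelSpace X]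
  {L : X → Type*} [∀ x, AddCommGroup (L x)] [∀ x, Module ℂ (L x)]
  [∀ x, TopologicalSpace (L x)] [TopologicalSpace (Bundle.TotalSpace ℂ L)]
  [FiberBundle ℂ L] [VectorBundle ℂ ℂ L] [ContMDiffVectorBundle ω ℂ L 𝓘(ℂ, Fin n → ℂ)]
  {h : ∀ x, L x → L x → ℂ}
  {E : Submodule ℂ Cₛ^ω⟮𝓘(ℂ, Fin n → ℂ); ℂ, L⟯} [FiniteDimensional ℂ E]

theorem integrable_section (hh : h ∈ posMetrics n L) (s t : Cₛ^ω⟮𝓘(ℂ, Fin n → ℂ); ℂ, L⟯) :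
    Integrable (fun x => h x (s x) (t x)) (volumeMeasure n h) := by
  have := isFiniteMeasure_volumeMeasure hh
  exact (hh.1.continuous_section s t).integrable_of_hasCompactSupport
    (HasCompactSupport.of_compactSpace _)

theorem re_integral_section (hh : h ∈ posMetrics n L) (s t : Cₛ^ω⟮𝓘(ℂ, Fin n → ℂ); ℂ, L⟯) :
    (∫ x, h x (s x) (t x) ∂(volumeMeasure n h)).re =
      ∫ x, (h x (s x) (t x)).re ∂(volumeMeasure n h) :=
  (integral_re (𝕜 := ℂ) (integrable_section hh s t)).symm

theorem IsHermitianMetric.self_re_nonneg (hh : IsHermitianMetric n h) (x : X) (v : L x) :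
    0 ≤ (h x v v).re := by
  have hx := FiberBundle.mem_baseSet_trivializationAt ℂ L x
  rw [hh.re_self_eq hx]
  exact mul_nonneg (sq_nonneg _) (hh.frameSq_pos hx).le

theorem exists_inner_eq_hilb (hE : GivesEmbedding E) (hh : h ∈ posMetrics n L) :
    ∃ H : HermitianForms E, H.inner = hilb E h := by
  have := isFiniteMeasure_volumeMeasure hh
  have := isOpenPosMeasure_volumeMeasure hh
  have hc : 0 < (Module.finrank ℂ E : ℝ) / vol n h :=
    div_pos (Nat.cast_pos.2 (finrank_pos_of_givesEmbedding hE)) (vol_pos hh)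
  refine ⟨{ inner := hilb E h
            conj_inner_symm := ?_
            re_inner_nonneg := ?_
            add_left := ?_
            smul_left := ?_
            definite := ?_ }, rfl⟩
  · intro s t
    simp only [hilb, map_mul, Complex.conj_ofReal, ← integral_conj, hh.1.conj_symm]
  · intro s
    change 0 ≤ (hilb E h s s).re
    rw [hilb, Complex.re_ofReal_mul, re_integral_section hh]
    exact mul_nonneg hc.le (integral_nonneg fun x => hh.1.self_re_nonneg x _)
  · intro s t u
    simp only [hilb]
    rw [← mul_add, ← integral_add (integrable_section hh _ _) (integrable_section hh _ _)]
    congr 2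
    ext x
    exact hh.1.add_left _ _ _
  · intro s t c
    simp only [hilb]
    rw [mul_left_comm, ← integral_const_mul (conj c)]
    congr 2
    ext x
    exact hh.1.smul_left c _ _
  · intro s hs
    change hilb E h s s = 0 at hs
    by_contra hne
    have h1 : ∃ x, s.1 x ≠ 0 := by
      by_contra! h0
      exact hne (Subtype.ext (ContMDiffSection.ext h0))
    obtain ⟨x, hx⟩ := h1
    -- The integrand is continuous, nonnegative and nonzero at `x`, and the volume measure charges
    -- every non-empty open set.
    have h2 : 0 < ∫ x, (h x (s.1 x) (s.1 x)).re ∂(volumeMeasure n h) :=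
      integral_pos_of_integrable_nonneg_nonzero
        (Complex.continuous_re.comp (hh.1.continuous_section s.1 s.1))
        (integrable_section hh s.1 s.1).re (fun x => hh.1.self_re_nonneg x _)
        (hh.1.pos x _ hx).ne'
    have h3 := congrArg Complex.re hs
    rw [hilb, Complex.re_ofReal_mul, re_integral_section hh] at h3
    exact (mul_pos hc h2).ne' h3

theorem sum_hilb_self (hh : h ∈ posMetrics n L) {ι : Type*} [Fintype ι] (s : ι → E) :
    ∑ α, (hilb E h (s α) (s α)).re = (Module.finrank ℂ E : ℝ) / vol n h *
      ∫ x, ∑ α, (h x ((s α).1 x) ((s α).1 x)).re ∂(volumeMeasure n h) := by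
  have hi : ∀ α, Integrable (fun x => (h x ((s α).1 x) ((s α).1 x)).re) (volumeMeasure n h) :=
    fun α => (integrable_section hh (s α).1 (s α).1).re
  rw [integral_finsetSum _ fun α _ => hi α, Finset.mul_sum]
  refine Finset.sum_congr rfl fun α _ => ?_
  rw [hilb, Complex.re_ofReal_mul, re_integral_section hh]

end Hilb

/-! ### Determinants of Hermitian forms -/

section LogDet

/-- Apply `log λ ≤ λ - 1` to every eigenvalue and add up. -/
theorem log_det_le_trace {m : ℕ} {A : Matrix (Fin m) (Fin m) ℂ} (hA : A.PosDef) :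
    Real.log A.det.re ≤ A.trace.re - m := by
  have h1 : A.det.re = ∏ i, hA.1.eigenvalues i := by
    rw [hA.1.det_eq_prod_eigenvalues]
    simp [← Complex.ofReal_prod]
  have h2 : A.trace.re = ∑ i, hA.1.eigenvalues i := by
    rw [hA.1.trace_eq_sum_eigenvalues]
    simp
  rw [h1, h2, Real.log_prod fun i _ => (hA.eigenvalues_pos i).ne']
  calc ∑ i, Real.log (hA.1.eigenvalues i) ≤ ∑ i, (hA.1.eigenvalues i - 1) :=
        Finset.sum_le_sum fun i _ => Real.log_le_sub_one_of_pos (hA.eigenvalues_pos i)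
    _ = _ := by simp

variable {E : Type*} [AddCommGroup E] [Module ℂ E]

/-- The matrix of a Hermitian form in a basis. -/
noncomputable def formMatrix {ι : Type*} (H : HermitianForms E) (s : ι → E) : Matrix ι ι ℂ :=
  Matrix.of fun i j => H.inner (s i) (s j)

theorem posDef_formMatrix {ι : Type*} [Fintype ι] (H : HermitianForms E) (s : Module.Basis ι ℂ E) :
    (formMatrix H s).PosDef := by
  let _ : NormedAddCommGroup E := H.toNormedAddCommGroup
  let _ : InnerProductSpace ℂ E := InnerProductSpace.ofCore H.toCore
  exact Matrix.posDef_gram_of_linearIndependent s.linearIndependent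

theorem formMatrix_change {ι : Type*} [Fintype ι] (H : HermitianForms E)
    (s b : Module.Basis ι ℂ E) : formMatrix H b =
      (s.toMatrix b).conjTranspose * formMatrix H s * s.toMatrix b := by
  let _ : NormedAddCommGroup E := H.toNormedAddCommGroup
  let _ : InnerProductSpace ℂ E := InnerProductSpace.ofCore H.toCore
  ext i j
  change inner ℂ (b i) (b j) = _
  rw [← s.sum_toMatrix_smul_self b i, ← s.sum_toMatrix_smul_self b j]
  simp only [sum_inner, inner_sum, inner_smul_left, inner_smul_right, Matrix.mul_apply,
    Matrix.conjTranspose_apply, Finset.sum_mul, Finset.mul_sum]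
  refine Finset.sum_congr rfl fun k _ => Finset.sum_congr rfl fun l _ => ?_
  change _ * (_ * H.inner (s l) (s k)) = _ * H.inner (s l) (s k) * _
  simp only [RCLike.star_def]
  ring

variable [FiniteDimensional ℂ E]

theorem orthonormalBasis_inner (H : HermitianForms E) (i j : Fin (Module.finrank ℂ E)) :
    H.inner (orthonormalBasis H i) (orthonormalBasis H j) = if i = j then 1 else 0 :=
  (exists_orthonormal H).choose_spec i j

theorem formMatrix_orthonormalBasis (H : HermitianForms E) :
    formMatrix H (orthonormalBasis H) = 1 := by
  ext i j
  rw [formMatrix, Matrix.of_apply, orthonormalBasis_inner, Matrix.one_apply]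

/-- A change of basis multiplies the determinants of both forms by the same factor `|det|²`, so the
difference of their logarithms can be computed in an `H`-orthonormal basis, where `H` itself
contributes nothing. -/
theorem logDet_inner (b : Module.Basis (Fin (Module.finrank ℂ E)) ℂ E) (H K : HermitianForms E) :
    logDet b K.inner = logDet b H.inner +
      Real.log (formMatrix K (orthonormalBasis H)).det.re := by
  set s := orthonormalBasis H
  have h0 : (s.toMatrix b).det ≠ 0 := by
    have := s.invertibleToMatrix b
    exact ((Matrix.isUnit_iff_isUnit_det _).1 (isUnit_of_invertible (s.toMatrix b))).ne_zero
  have key : ∀ G : HermitianForms E, (formMatrix G b).det.re =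
      ‖(s.toMatrix b).det‖ ^ 2 * (formMatrix G s).det.re := fun G => by
    rw [formMatrix_change G s b, Matrix.det_mul, Matrix.det_mul, Matrix.det_conjTranspose,
      mul_right_comm, RCLike.star_def, ← Complex.normSq_eq_conj_mul_self,
      Complex.normSq_eq_norm_sq, Complex.re_ofReal_mul]
  have hK : 0 < (formMatrix K s).det.re := (Complex.pos_iff.1 (posDef_formMatrix K s).det_pos).1
  change Real.log (formMatrix K b).det.re = Real.log (formMatrix H b).det.re + _
  rw [key K, key H, formMatrix_orthonormalBasis, Matrix.det_one, Complex.one_re, mul_one,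
    Real.log_mul (pow_ne_zero 2 (norm_ne_zero_iff.2 h0)) hK.ne']

theorem logDet_inner_le (b : Module.Basis (Fin (Module.finrank ℂ E)) ℂ E) (H K : HermitianForms E) :
    logDet b K.inner ≤ logDet b H.inner +
      (∑ α, (K.inner (orthonormalBasis H α) (orthonormalBasis H α)).re - Module.finrank ℂ E) := by
  rw [logDet_inner b H K]
  have h1 := log_det_le_trace (posDef_formMatrix K (orthonormalBasis H))
  rw [Matrix.trace, Complex.re_sum] at h1
  exact add_le_add_right h1 _

end LogDet

/-! ### The two comparison inequalities and the equivalence -/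

section Comparison

variable {n : ℕ} {X : Type*} [TopologicalSpace X] [CompactSpace X] [T2Space X] [Nonempty X]
  [ChartedSpace (Fin n → ℂ) X]
  [IsManifold 𝓘(ℂ, Fin n → ℂ) ω X] [MeasurableSpace X] [BorelSpace X]
  {L : X → Type*} [∀ x, AddCommGroup (L x)] [∀ x, Module ℂ (L x)]
  [∀ x, TopologicalSpace (L x)] [TopologicalSpace (Bundle.TotalSpace ℂ L)]
  [FiberBundle ℂ L] [VectorBundle ℂ ℂ L] [ContMDiffVectorBundle ω ℂ L 𝓘(ℂ, Fin n → ℂ)]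
  {h : ∀ x, L x → L x → ℂ}
  {E : Submodule ℂ Cₛ^ω⟮𝓘(ℂ, Fin n → ℂ); ℂ, L⟯} [FiniteDimensional ℂ E]

/-- The trace of `Hilb (FS H)` in an `H`-orthonormal basis is `(d / V) ∫ 1 = d`, so the trace bound
shows that its `log det` is at most that of `H`. The energy terms on the two sides are the same,
whatever `I` is. -/
theorem lTilde_fubiniStudy_le (hE : GivesEmbedding E)
    (b : Module.Basis (Fin (Module.finrank ℂ E)) ℂ E) (I : (∀ x, L x → L x → ℂ) → ℝ)
    (H : HermitianForms E) : lTilde E b I (fubiniStudy E H) ≤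
      (Module.finrank ℂ E : ℝ) / vol n (fubiniStudy E H) * zTilde E b I H := by
  have hh := fubiniStudy_mem_posMetrics hE H
  have hV := (vol_pos hh).ne'
  have hd : (Module.finrank ℂ E : ℝ) ≠ 0 :=
    Nat.cast_ne_zero.2 (finrank_pos_of_givesEmbedding hE).ne'
  obtain ⟨K, hK⟩ := exists_inner_eq_hilb hE hh
  have h1 := logDet_inner_le b H K
  rw [hK, sum_hilb_self hh] at h1
  simp only [sum_fubiniStudy hE, ← vol_eq_integral] at h1
  rw [div_mul_cancel₀ _ hV, sub_self, add_zero] at h1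
  have h2 : (Module.finrank ℂ E : ℝ) / vol n (fubiniStudy E H) * zTilde E b I H =
      logDet b H.inner - (Module.finrank ℂ E : ℝ) / vol n (fubiniStudy E H) *
        I (fubiniStudy E H) := by
    rw [zTilde]
    field_simp
    ring
  rw [h2, lTilde]
  exact sub_le_sub_right h1 _

/-- The determinant terms agree, so only `I h ≤ I (FS (Hilb h))` is at stake. It follows from
convexity of the energy once the logarithm `ψ` of the ratio of the two metrics has nonnegative
integral. -/
theorem zTilde_le_lTilde (hE : GivesEmbedding E) {I : (∀ x, L x → L x → ℂ) → ℝ}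
    (hI : IsEnergy n I) (b : Module.Basis (Fin (Module.finrank ℂ E)) ℂ E)
    (hh : h ∈ posMetrics n L) {H : HermitianForms E} (hH : H.inner = hilb E h) :
    zTilde E b I H ≤ vol n h / (Module.finrank ℂ E : ℝ) * lTilde E b I h := by
  have hk := fubiniStudy_mem_posMetrics hE H
  have hV := (vol_pos hh).ne'
  have hd : (Module.finrank ℂ E : ℝ) ≠ 0 :=
    Nat.cast_ne_zero.2 (finrank_pos_of_givesEmbedding hE).ne'
  obtain ⟨ψ, hψ, hkψ⟩ := exists_rescale_eq hh.1 hk.1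
  set s := orthonormalBasis H with hs
  -- The Bergman function of `h`. Orthonormality for `Hilb h` normalizes its mean to 1.
  set ρ : X → ℝ := fun x => ∑ α, (h x ((s α).1 x) ((s α).1 x)).re with hρ
  have hρi : Integrable ρ (volumeMeasure n h) :=
    integrable_finsetSum _ fun α _ => (integrable_section hh (s α).1 (s α).1).re
  have hρV : ∫ x, ρ x ∂(volumeMeasure n h) = vol n h := by
    have h1 := sum_hilb_self hh s
    rw [← hH] at h1
    simp only [hs, orthonormalBasis_inner, if_true, Complex.one_re, Finset.sum_const,
      Finset.card_univ, Fintype.card_fin, nsmul_eq_mul, mul_one] at h1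
    rw [div_mul_eq_mul_div, eq_div_iff hV] at h1
    exact (mul_left_cancel₀ hd h1).symm
  -- The normalization `∑ |s_α|² = 1` for `FS(H) = e^ψ h` says `e^ψ ρ = 1`, so the bound is `1 - ψ ≤
  -- e^(-ψ)`.
  have hψρ : ∀ x, 1 - ρ x ≤ ψ x := fun x => by
    have h1 := sum_fubiniStudy hE H x
    simp only [hkψ, rescale, Complex.re_ofReal_mul, ← Finset.mul_sum] at h1
    have h2 : ρ x = Real.exp (-ψ x) := by
      rw [Real.exp_neg]
      exact eq_inv_of_mul_eq_one_right h1
    linarith [Real.add_one_le_exp (-ψ x)]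
  have := isFiniteMeasure_volumeMeasure hh
  have h0 : 0 ≤ ∫ x, ψ x ∂(volumeMeasure n h) := by
    have h1 := integral_mono ((integrable_const 1).sub hρi)
      (integrable_volumeMeasure hh hψ.continuous) hψρ
    rwa [integral_sub' (integrable_const 1) hρi, hρV, ← vol_eq_integral, sub_self] at h1
  have h2 := hI.add_integral_le hh hψ (hkψ ▸ hk)
  rw [← hkψ] at h2
  have h3 : vol n h / (Module.finrank ℂ E : ℝ) * lTilde E b I h =
      -I h + vol n h / (Module.finrank ℂ E : ℝ) * logDet b H.inner := by
    rw [lTilde, hH]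
    field_simp
    ring
  rw [h3, zTilde, vol_eq_vol hh hk]
  linarith

/-- Each value of one functional bounds, up to the positive constant `d / V` or its inverse, some
value of the other from below. The constant is uniform because all positive metrics have the same
volume. -/
theorem bddBelow_lTilde_iff (hE : GivesEmbedding E) {I : (∀ x, L x → L x → ℂ) → ℝ}
    (hI : IsEnergy n I) (b : Module.Basis (Fin (Module.finrank ℂ E)) ℂ E) :
    BddBelow (lTilde E b I '' posMetrics n L) ↔ BddBelow (Set.range (zTilde E b I)) := by
  have hd : (0 : ℝ) < Module.finrank ℂ E := Nat.cast_pos.2 (finrank_pos_of_givesEmbedding hE)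
  constructor
  · rintro ⟨c, hc⟩
    -- An element is needed only to name the common volume `V`; with none, the set to be bounded is
    -- empty.
    by_cases hM : Nonempty (HermitianForms E)
    · obtain ⟨H₀⟩ := hM
      have hk₀ := fubiniStudy_mem_posMetrics hE H₀
      refine ⟨c / ((Module.finrank ℂ E : ℝ) / vol n (fubiniStudy E H₀)), ?_⟩
      rintro _ ⟨H, rfl⟩
      have hk := fubiniStudy_mem_posMetrics hE H
      rw [div_le_iff₀' (div_pos hd (vol_pos hk₀)), ← vol_eq_vol hk₀ hk]
      exact (hc ⟨_, hk, rfl⟩).trans (lTilde_fubiniStudy_le hE b I H)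
    · rw [not_nonempty_iff] at hM
      simp
  · rintro ⟨c, hc⟩
    by_cases hK : (posMetrics n L).Nonempty
    · obtain ⟨k, hk⟩ := hK
      refine ⟨c / (vol n k / (Module.finrank ℂ E : ℝ)), ?_⟩
      rintro _ ⟨h, hh, rfl⟩
      obtain ⟨H, hH⟩ := exists_inner_eq_hilb hE hh
      rw [div_le_iff₀' (div_pos (vol_pos hk) hd), ← vol_eq_vol hk hh]
      exact (hc ⟨H, rfl⟩).trans (zTilde_le_lTilde hE hI b hh hH)
    · rw [Set.not_nonempty_iff_eq_empty.1 hK]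
      simp

theorem nonempty_hermitianForms (E : Type*) [AddCommGroup E] [Module ℂ E] [FiniteDimensional ℂ E] :
    Nonempty (HermitianForms E) := by
  let f : E ≃ₗ[ℂ] EuclideanSpace ℂ (Fin (Module.finrank ℂ E)) :=
    LinearEquiv.ofFinrankEq _ _ (by simp)
  exact ⟨{ inner := fun x y => inner ℂ (f x) (f y)
           conj_inner_symm := fun x y => inner_conj_symm _ _
           re_inner_nonneg := fun x => inner_self_nonneg
           add_left := fun x y z => by rw [map_add, inner_add_left]
           smul_left := fun x y r => by rw [map_smul, inner_smul_left]
           definite := fun x hx => by simpa using hx }⟩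

end Comparison

end BalancedMetrics

theorem mainTheorem7 {n : ℕ} {X : Type*} [TopologicalSpace X] [T2Space X] [CompactSpace X]
    [Nonempty X] [MeasurableSpace X] [BorelSpace X]
    [ChartedSpace (Fin n → ℂ) X] [IsManifold 𝓘(ℂ, Fin n → ℂ) ω X]
    {L : X → Type*} [∀ x, AddCommGroup (L x)] [∀ x, Module ℂ (L x)]
    [∀ x, TopologicalSpace (L x)] [TopologicalSpace (Bundle.TotalSpace ℂ L)]
    [FiberBundle ℂ L] [VectorBundle ℂ ℂ L]
    [ContMDiffVectorBundle ω ℂ L 𝓘(ℂ, Fin n → ℂ)]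
    (E : Submodule ℂ Cₛ^ω⟮𝓘(ℂ, Fin n → ℂ); ℂ, L⟯) [FiniteDimensional ℂ E]
    (hE : BalancedMetrics.GivesEmbedding E)
    (b : Module.Basis (Fin (Module.finrank ℂ E)) ℂ E) :
    (∀ H : BalancedMetrics.HermitianForms E,
      BalancedMetrics.fubiniStudy E H ∈ BalancedMetrics.posMetrics n L) ∧
    (∀ h ∈ BalancedMetrics.posMetrics n L, ∃ H : BalancedMetrics.HermitianForms E,
      H.inner = BalancedMetrics.hilb E h) ∧
    (∃ V : ℝ, 0 < V ∧ ∀ h ∈ BalancedMetrics.posMetrics n L, BalancedMetrics.vol n h = V) ∧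
    (∃ I : (∀ x, L x → L x → ℂ) → ℝ, BalancedMetrics.IsEnergy n I) ∧
    ∀ I : (∀ x, L x → L x → ℂ) → ℝ, BalancedMetrics.IsEnergy n I →
      (BddBelow (BalancedMetrics.lTilde E b I '' BalancedMetrics.posMetrics n L) ↔
        BddBelow (Set.range (BalancedMetrics.zTilde E b I))) := by
  -- The Fubini-Study metric of any one Hermitian form shows that positive metrics exist. It
  -- supplies the value of `V` and the base metric for the energy.
  obtain ⟨H₀⟩ := BalancedMetrics.nonempty_hermitianForms E
  have hk := BalancedMetrics.fubiniStudy_mem_posMetrics hE H₀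
  exact ⟨BalancedMetrics.fubiniStudy_mem_posMetrics hE,
    fun h hh => BalancedMetrics.exists_inner_eq_hilb hE hh,
    ⟨_, BalancedMetrics.vol_pos hk, fun h hh => BalancedMetrics.vol_eq_vol hk hh⟩,
    BalancedMetrics.exists_isEnergy hk,
    fun I hI => BalancedMetrics.bddBelow_lTilde_iff hE hI b⟩
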